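/- Let $d\ge 1$ (the physical case is $d=3$; $d=1$ is the one-dimensional reduction), $\omega>0$, $0\le k<\omega^2$, and put $$\mu=\sqrt{\omega^2-k},\qquad \lambda=\frac{2\sqrt{\omega\mu}}{\omega+\mu}.$$ Harmonium is the system of two spin-$\frac12$ fermions in $\mathbb R^d$ with Hamiltonian ($\hbar=m=1$) $$H=-\tfrac12\Delta_{1}-\tfrac12\Delta_{2}+\tfrac{\omega^2}{2}(|q_1|^2+|q_2|^2)-\tfrac k4|q_1-q_2|^2 .$$ A ground state is a normalized antisymmetric Schwartz spinor wave function $\Psi(q_1,\sigma_1,q_2,\sigma_2)$ that is an eigenfunction of $H$ with eigenvalue equal to the least energy $\langle\Phi,H\Phi\rangle$ of normalized antisymmetric $\Phi$. With $u=(q,p)$, its two-body Wigner function is $$P_{\rm gs}(u_1,u_2;\sigma_1,\sigma_2;\sigma_1',\sigma_2')=\pi^{-2d}\!\int\!\Psi(q_1-z_1,\sigma_1,q_2-z_2,\sigma_2)\,\overline{\Psi(q_1+z_1,\sigma_1',q_2+z_2,\sigma_2')}\,e^{2i(p_1\cdot z_1+p_2\cdot z_2)}\,dz_1dz_2,$$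 and its one-body quasidensity is $d_{\rm gs}(u;\sigma,\sigma')=2\sum_\tau\int P_{\rm gs}(u,v;\sigma,\tau;\sigma',\tau)\,dv$. The twisted (Moyal) product on the phase space of one particle is $$f\times g(q,p)=\pi^{-2d}\!\int f(q',p')\,g(q'',p'')\,e^{2i(q\cdot p'-q'\cdot p+q'\cdot p''-q''\cdot p'+q''\cdot p-q\cdot p'')}\,dq'dp'dq''dp''.$$ For integers $r\ge s\ge 0$ and $Q+iP=Ue^{i\vartheta}$, $U\ge 0$, let $$f_{rs}(Q,P)=\frac{(-1)^s}{\pi}\sqrt{\frac{s!}{r!}}\,(2U^2)^{(r-s)/2}e^{-i(r-s)\vartheta}L_s^{r-s}(2U^2)\,e^{-U^2},\qquad f_{sr}=\overline{f_{rs}},$$ and for multi-indices $r,s\in\mathbb N^d$ let $$\chi_{rs}(q,p)=\prod_{i=1}^d f_{r_is_i}\bigl((\omega\mu)^{1/4}q_i,(\omega\mu)^{-1/4}p_i\bigr).$$ Let $x=(1-\lambda)/(1+\lambda)$ and $n_r=\prod_{i=1}^d(1-x)x^{r_i}$ (with $0^0=1$), $|r|=\sum_i r_i$, and let $S_{\sigma\tau}$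 be the singlet amplitude, $S_{\uparrow\downarrow}=-S_{\downarrow\uparrow}=1/\sqrt2$, $S_{\uparrow\uparrow}=S_{\downarrow\downarrow}=0$. Then a ground state exists, and for every ground state: 1. $P_{\rm gs}=S_{\sigma_1\sigma_2}S_{\sigma_1'\sigma_2'}\,\pi^{-2d}e^{-2H_R/\omega}e^{-2H_r/\mu}$, where $H_R=\frac14|p_1+p_2|^2+\frac{\omega^2}{4}|q_1+q_2|^2$ and $H_r=\frac14|p_1-p_2|^2+\frac{\omega^2-k}{4}|q_1-q_2|^2$. 2. $d_{\rm gs}(u;\sigma,\sigma')=\delta_{\sigma\sigma'}d_*(u)$ with $$d_*(q,p)=\Bigl(\frac{\lambda}{\pi}\Bigr)^{d}e^{-2(\omega\mu|q|^2+|p|^2)/(\omega+\mu)}=\sum_{r\in\mathbb N^d}n_r\,\chi_{rr}(q,p)$$ (pointwise and unconditionally), and $\sum_r n_r=1$. 3. The $\chi_{rs}$ are natural Wigner eigentransitions of $d_*$: $\overline{\chi_{rs}}=\chi_{sr}$, $(2\pi)^d d_*\times\chi_{rs}=n_r\chi_{rs}$, $(2\pi)^d\chi_{rs}\times d_*=n_s\chi_{rs}$,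 $(2\pi)^d\chi_{rs}\times\chi_{tv}=\delta_{st}\chi_{rv}$ and $\int\chi_{rs}\,dq\,dp=\delta_{rs}$. The $f_{rs}$ are the eigentransitions of the oscillator $h=\frac12(Q^2+P^2)$: $h\times f_{rs}=(r+\frac12)f_{rs}$ for all $r,s\in\mathbb N$, where $h\times f=hf+\frac i2(Q\partial_P-P\partial_Q)f-\frac18(\partial_Q^2+\partial_P^2)f$. 4. (Alternating sign rule.) With $c_r=(-1)^{|r|}\sqrt{n_r}$ (for $d=1$ and $i=r+1$ this is $c_i=(-1)^{i+1}\sqrt{n_i}$), the Shull–Löwdin–Kutzelnigg series sums to the two-body Wigner function of the ground state, pointwise and unconditionally: $$P_{\rm gs}(u_1,u_2;\sigma_1,\sigma_2;\sigma_1',\sigma_2')=S_{\sigma_1\sigma_2}S_{\sigma_1'\sigma_2'}\sum_{r,s\in\mathbb N^d}c_rc_s\,\chi_{rs}(u_1)\chi_{rs}(u_2).$$ 5. If $k>0$, there is $\beta>0$ with $\tanh(\beta/2)=\lambda$, and for all $r\in\mathbb N^d$ $$n_r=\prod_{i=1}^d(1-e^{-\beta})e^{-r_i\beta}=\bigl(2\sinh\tfrac\beta2\bigr)^{d}e^{-\beta\sum_i(r_i+1/2)}=\prod_{i=1}^d\frac{4\sqrt{\omega\mu}}{\omega-\mu}\Bigl(\frac{\sqrt\omega-\sqrt\mu}{\sqrt\omega+\sqrt\mu}\Bigr)^{2r_i+1},$$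 so that $d_*$ is a thermal (Gibbs) oscillator state at inverse temperature $\beta$. If $k=0$, then $n_0=1$ and $n_r=0$ for $r\ne0$. -/

import Mathlib

open scoped SchwartzMap ComplexConjugate

noncomputable section

namespace Harmonium

/-- Position (or momentum) space of one particle in `d` dimensions. -/
abbrev Space (d : ℕ) := EuclideanSpace ℝ (Fin d)

/-- Phase space of one particle; a point is a pair `u = (q, p)`. -/
abbrev Phase (d : ℕ) := Space d × Space d

/-- Spin variable of one electron: `0` is up, `1` is down. -/
abbrev Spin := Fin 2

/-- Two-particle spinor wave functions `Ψ(q₁, σ₁, q₂, σ₂)`, written `Ψ σ₁ σ₂ (q₁, q₂)`. -/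
abbrev SpinorWave (d : ℕ) := Spin → Spin → 𝓢(Space d × Space d, ℂ)

/-- The harmonium Hamiltonian in position representation (units with `ℏ = m = 1`):
`H = -Δ₁/2 - Δ₂/2 + ω²(|q₁|² + |q₂|²)/2 - k|q₁ - q₂|²/4`. -/
def hamiltonian {d : ℕ} (ω k : ℝ) (φ : 𝓢(Space d × Space d, ℂ)) (x : Space d × Space d) : ℂ :=
  -(1 / 2 : ℂ) * Laplacian.laplacian (fun y : Space d => φ (y, x.2)) x.1
    - (1 / 2 : ℂ) * Laplacian.laplacian (fun y : Space d => φ (x.1, y)) x.2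
    + ((ω ^ 2 / 2 * (‖x.1‖ ^ 2 + ‖x.2‖ ^ 2) - k / 4 * ‖x.1 - x.2‖ ^ 2 : ℝ) : ℂ) * φ x

/-- The Pauli principle: antisymmetry under exchange of the two particles. -/
def IsFermionic {d : ℕ} (Ψ : SpinorWave d) : Prop :=
  ∀ (σ₁ σ₂ : Spin) (q₁ q₂ : Space d), Ψ σ₂ σ₁ (q₂, q₁) = -Ψ σ₁ σ₂ (q₁, q₂)

def IsNormalized {d : ℕ} (Ψ : SpinorWave d) : Prop :=
  ∑ σ₁, ∑ σ₂, ∫ x, ‖Ψ σ₁ σ₂ x‖ ^ 2 = 1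

/-- The expected energy `⟨Ψ, H Ψ⟩`. -/
def expectedEnergy {d : ℕ} (ω k : ℝ) (Ψ : SpinorWave d) : ℝ :=
  (∑ σ₁, ∑ σ₂, ∫ x, conj (Ψ σ₁ σ₂ x) * hamiltonian ω k (Ψ σ₁ σ₂) x).re

/-- A (normalized) ground state of harmonium: a fermionic eigenstate of `H` whose eigenvalue is
the least energy of fermionic states. Eigenfunctions of `H` are Schwartz functions, and the
Schwartz functions are a core of `H`. -/
def IsGroundState {d : ℕ} (ω k : ℝ) (Ψ : SpinorWave d) : Prop :=
  IsFermionic Ψ ∧ IsNormalized Ψ ∧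
    ∃ E : ℝ, (∀ σ₁ σ₂ x, hamiltonian ω k (Ψ σ₁ σ₂) x = (E : ℂ) * Ψ σ₁ σ₂ x) ∧
      ∀ Φ : SpinorWave d, IsFermionic Φ → IsNormalized Φ → E ≤ expectedEnergy ω k Φ

/-- The two-body Wigner function of a two-particle state, a function on phase space with values
in the spin matrices:
`π^(-2d) ∫ Ψ(q₁ - z₁, σ₁, q₂ - z₂, σ₂) conj Ψ(q₁ + z₁, σ₁', q₂ + z₂, σ₂')
  exp(2i(p₁·z₁ + p₂·z₂)) dz₁ dz₂`. -/
def wigner {d : ℕ} (Ψ : SpinorWave d) (u₁ u₂ : Phase d) (σ₁ σ₂ σ₁' σ₂' : Spin) : ℂ :=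
  ((1 / Real.pi ^ (2 * d) : ℝ) : ℂ) *
    ∫ z : Space d × Space d,
      Ψ σ₁ σ₂ (u₁.1 - z.1, u₂.1 - z.2) * conj (Ψ σ₁' σ₂' (u₁.1 + z.1, u₂.1 + z.2)) *
        Complex.exp (2 * Complex.I * ((inner ℝ u₁.2 z.1 + inner ℝ u₂.2 z.2 : ℝ) : ℂ))

/-- The one-body quasidensity of a two-particle Wigner function, normalized to the number `2` of
particles. -/
def oneBody {d : ℕ} (D₂ : Phase d → Phase d → Spin → Spin → Spin → Spin → ℂ)
    (u : Phase d) (σ σ' : Spin) : ℂ :=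
  2 * ∫ v : Phase d, ∑ τ, D₂ u v σ τ σ' τ

/-- The spin singlet amplitude `(↑₁↓₂ - ↓₁↑₂)/√2`. -/
def singlet (σ₁ σ₂ : Spin) : ℝ :=
  if σ₁ = 0 ∧ σ₂ = 1 then 1 / √2 else if σ₁ = 1 ∧ σ₂ = 0 then -(1 / √2) else 0

/-- The twisted (Moyal) product on the phase space of one particle, with `ℏ = 1`; the integration
variable is `z = ((q', p'), (q'', p''))`. -/
def twisted {d : ℕ} (f g : Phase d → ℂ) (u : Phase d) : ℂ :=
  ((1 / Real.pi ^ (2 * d) : ℝ) : ℂ) *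
    ∫ z : Phase d × Phase d, f z.1 * g z.2 *
      Complex.exp (2 * Complex.I *
        ((inner ℝ u.1 z.1.2 - inner ℝ z.1.1 u.2 + inner ℝ z.1.1 z.2.2 - inner ℝ z.2.1 z.1.2
          + inner ℝ z.2.1 u.2 - inner ℝ u.1 z.2.2 : ℝ) : ℂ))

/-- `χ` is a system of natural Wigner eigentransitions, with occupation numbers `n`, of the
one-body quasidensity `D`. Since the quasidensity of a one-body operator is `(2π)^(-d)` times its
symbol, the factor `(2π)^d` makes the twisted product correspond to the product of operators. -/
structure IsNaturalSystem {d : ℕ} {ι : Type} (D : Phase d → ℂ) (n : ι → ℝ)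
    (χ : ι → ι → Phase d → ℂ) : Prop where
  conj_eq : ∀ r s u, conj (χ r s u) = χ s r u
  twisted_left : ∀ r s u,
    (((2 * Real.pi) ^ d : ℝ) : ℂ) * twisted D (χ r s) u = (n r : ℂ) * χ r s u
  twisted_right : ∀ r s u,
    (((2 * Real.pi) ^ d : ℝ) : ℂ) * twisted (χ r s) D u = (n s : ℂ) * χ r s u
  matrix_unit : ∀ r s t v u, s = t →
    (((2 * Real.pi) ^ d : ℝ) : ℂ) * twisted (χ r s) (χ t v) u = χ r v u
  matrix_unit_zero : ∀ r s t v u, s ≠ t → twisted (χ r s) (χ t v) u = 0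
  integral_diag : ∀ r, ∫ u, χ r r u = 1
  integral_offdiag : ∀ r s, r ≠ s → ∫ u, χ r s u = 0

/-- The `(r, s)` term `c_r c_s χ_rs(u₁) χ_rs(u₂)` of the Shull–Löwdin–Kutzelnigg series with
coefficients `c` (without spin factor). -/
def slkTerm {d : ℕ} {ι : Type} (c : ι → ℝ) (χ : ι → ι → Phase d → ℂ) (u₁ u₂ : Phase d)
    (x : ι × ι) : ℂ :=
  (c x.1 : ℂ) * (c x.2 : ℂ) * χ x.1 x.2 u₁ * χ x.1 x.2 u₂

/-- The associated Laguerre polynomial `L_n^a`, for natural `a`. -/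
def laguerre (n a : ℕ) (x : ℝ) : ℝ :=
  ∑ j ∈ Finset.range (n + 1),
    (-1) ^ j * ((n + a).choose (n - j) : ℝ) * x ^ j / (j.factorial : ℝ)

/-- For `s ≤ r`, the oscillator eigentransition
`π⁻¹ (-1)^s √(s!/r!) (2U²)^((r-s)/2) e^(-i(r-s)ϑ) L_s^(r-s)(2U²) e^(-U²)`, where `(U, ϑ)` are the
polar coordinates of `(Q, P)`, so that `(2U²)^(1/2) e^(-iϑ) = √2 (Q - iP)`. -/
def oscLower (r s : ℕ) (Q P : ℝ) : ℂ :=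
  (((1 / Real.pi) * (-1) ^ s * √((s.factorial : ℝ) / (r.factorial : ℝ)) *
      laguerre s (r - s) (2 * (Q ^ 2 + P ^ 2)) * Real.exp (-(Q ^ 2 + P ^ 2)) : ℝ) : ℂ) *
    ((√2 : ℝ) * ((Q : ℂ) - Complex.I * (P : ℂ))) ^ (r - s)

/-- The oscillator eigentransitions, for all pairs of indices. -/
def osc (r s : ℕ) (Q P : ℝ) : ℂ :=
  if s ≤ r then oscLower r s Q P else conj (oscLower s r Q P)

/-- The twisted product `h × f` with the symbol `h = (Q² + P²)/2` of the harmonic oscillator. For a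
quadratic symbol the Moyal expansion terminates:
`h × f = h f + (i/2)(Q ∂_P f - P ∂_Q f) - (1/8)(∂_Q² f + ∂_P² f)`. -/
def oscHamiltonianTwisted (f : ℝ → ℝ → ℂ) (Q P : ℝ) : ℂ :=
  (((Q ^ 2 + P ^ 2) / 2 : ℝ) : ℂ) * f Q P
    + Complex.I / 2 * ((Q : ℂ) * deriv (fun y => f Q y) P - (P : ℂ) * deriv (fun x => f x P) Q)
    - 1 / 8 * (iteratedDeriv 2 (fun x => f x P) Q + iteratedDeriv 2 (fun y => f Q y) P)

/-- The frequency `μ = √(ω² - k)` of the relative motion. -/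
def relFreq (ω k : ℝ) : ℝ := √(ω ^ 2 - k)

/-- The eigentransitions in `d` dimensions: products over the axes of the one-dimensional ones,
in the variables `Q = (ωμ)^(1/4) q`, `P = (ωμ)^(-1/4) p`. -/
def transition {d : ℕ} (ω k : ℝ) (r s : Fin d → ℕ) (u : Phase d) : ℂ :=
  ∏ i, osc (r i) (s i) ((ω * relFreq ω k) ^ (1 / 4 : ℝ) * u.1 i)
    ((ω * relFreq ω k) ^ (-(1 / 4) : ℝ) * u.2 i)

/-- `λ = 2√(ωμ)/(ω + μ)`. -/
def lam (ω k : ℝ) : ℝ := 2 * √(ω * relFreq ω k) / (ω + relFreq ω k)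

/-- The Boltzmann factor `e^(-β) = (1 - λ)/(1 + λ)`, where `λ = tanh(β/2)`; it is `0`
(`β = ∞`) in the absence of interaction. -/
def boltzmann (ω k : ℝ) : ℝ := (1 - lam ω k) / (1 + lam ω k)

/-- The occupation numbers `n_r = ∏ (1 - e^(-β)) e^(-r_i β)`. -/
def occupation {d : ℕ} (ω k : ℝ) (r : Fin d → ℕ) : ℝ :=
  ∏ i, (1 - boltzmann ω k) * boltzmann ω k ^ r i

/-- The coefficients given by the alternating sign rule. -/
def alternatingCoeff {d : ℕ} (ω k : ℝ) (r : Fin d → ℕ) : ℝ :=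
  (-1) ^ (∑ i, r i) * √(occupation ω k r)

/-- Classical extracule Hamiltonian `P²/4 + ω²R²`, with `R = (q₁ + q₂)/2`, `P = p₁ + p₂`. -/
def extraculeH {d : ℕ} (ω : ℝ) (u₁ u₂ : Phase d) : ℝ :=
  ‖u₁.2 + u₂.2‖ ^ 2 / 4 + ω ^ 2 * ‖(1 / 2 : ℝ) • (u₁.1 + u₂.1)‖ ^ 2

/-- Classical intracule Hamiltonian `p² + (ω² - k)r²/4`, with `r = q₁ - q₂`,
`p = (p₁ - p₂)/2`. -/
def intraculeH {d : ℕ} (ω k : ℝ) (u₁ u₂ : Phase d) : ℝ :=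
  ‖(1 / 2 : ℝ) • (u₁.2 - u₂.2)‖ ^ 2 + (ω ^ 2 - k) * ‖u₁.1 - u₂.1‖ ^ 2 / 4

end Harmonium

end

/-! The ground state is found by completing squares. In the normal directions q₁ ± q₂ the
Hamiltonian is a quarter of a sum of products A†A plus the constant d(ω+μ)/2 (`hamiltonian_eq`), so
a state of least energy is annihilated by every A. These first-order equations make each spin
component a multiple of exp(-ω|q₁+q₂|²/4 - μ|q₁-q₂|²/4) (`eq_smul_pairGaussian`). This Gaussian is
symmetric, so antisymmetry forces the singlet (`IsGroundState.eq_singletWave`). The ground state is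
thus unique up to a phase, which the Wigner function does not see; the Wigner function and its
reduction are Gaussian integrals (`wigner_singletWave`, `oneBody_wigner_singletWave`).

The statements on eigentransitions reduce to one phase plane: the kernel of the twisted product and
the Gaussians factor over the axes (`twisted_prod`, `hasSum_fin_prod`), and the symplectic rescaling
by (ωμ)^(1/4) preserves the product (`twisted_comp_scaleEquiv`). With w = √2(Q - iP), f_rs is
H_rs(w, w̄) exp(-w w̄/2)/(π√(r! s!)), where H_rs are the complex Hermite polynomials (`osc_eq`). A
parameter κ is kept in their generating function exp(αx + βy - καβ) because integration against a
Gaussian of rate c just replaces κ by κ - 1/c and moves the arguments (`gaussMoment_hermitePoly`).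
The symplectic Fourier transform turns κ = 1 into -1, a mere sign flip; with the orthogonality
relation `gaussMoment_pair` this gives the matrix units (`twistedPlane_oscPlane`). Multiplication by
the thermal Gaussian turns κ = 1 into x, and homogeneity extracts the eigenvalue factor x^r
(`twistedPlane_thermalPlane`).

The two series are Mehler sums. A Hermite polynomial is a Gaussian integral of a monomial, so
summing under the integral leaves an exponential series (`hasSum_complexHermite_diag`) or the
generating function (`hasSum_complexHermite_mehler`). The second sum has a parameter t with t² = x,
and the alternating sign rule is the choice t = -√x: the cross term of the resulting Gaussian is
linear in t, and since ω ≥ μ this sign is the one that matches the Wigner function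
(`hasSum_slkPlane`, `wignerGaussian_eq`). -/

noncomputable section

namespace Harmonium

open MeasureTheory

/-! ### Complex Hermite polynomials -/

/-- The complex Hermite polynomials, with generating function `exp (α x + β y - κ α β)`. -/
def complexHermite {R : Type*} [CommRing R] (κ x y : R) : ℕ → ℕ → R
  | 0, s => y ^ s
  | r + 1, s => x * complexHermite κ x y r s - κ * s * complexHermite κ x y r (s - 1)

section complexHermite

variable {R : Type*} [CommRing R] (κ x y : R)

@[simp] lemma complexHermite_zero_left (s : ℕ) : complexHermite κ x y 0 s = y ^ s := rfl

lemma complexHermite_succ_left (r s : ℕ) : complexHermite κ x y (r + 1) s =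
    x * complexHermite κ x y r s - κ * s * complexHermite κ x y r (s - 1) := rfl

@[simp] lemma complexHermite_zero_right (r : ℕ) : complexHermite κ x y r 0 = x ^ r := by
  induction r with
  | zero => simp
  | succ r ih => simp [complexHermite_succ_left, ih, pow_succ']

/-- The definition recurses in r only; this mirrored recursion makes the symmetry
`complexHermite_swap` provable. At index 0 the truncated predecessor is harmless, being multiplied
by zero. -/
lemma complexHermite_succ_right (r s : ℕ) : complexHermite κ x y r (s + 1) =
    y * complexHermite κ x y r s - κ * r * complexHermite κ x y (r - 1) s := by
  induction r generalizing s with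
  | zero => simp [pow_succ']
  | succ r ih =>
    have e1 := ih s
    have e2 := complexHermite_succ_left κ x y r (s + 1)
    have e3 := complexHermite_succ_left κ x y r s
    simp only [Nat.add_sub_cancel] at e2 ⊢
    rw [e2, e3]
    rcases s with _ | s
    · rcases r with _ | r
      · simp; ring
      · simp only [Nat.add_sub_cancel, complexHermite_zero_right] at e1 ⊢
        rw [e1]
        push_cast
        ring
    · rcases r with _ | r
      · simp [pow_succ]; ring
      · have e4 := ih s
        have e5 := complexHermite_succ_left κ x y r (s + 1)
        simp only [Nat.add_sub_cancel] at e1 e4 e5 ⊢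
        rw [e1]
        push_cast at e4 e5 ⊢
        linear_combination κ * (r + 1) * e5 - κ * (s + 1) * e4

lemma complexHermite_swap (r s : ℕ) : complexHermite κ x y r s = complexHermite κ y x s r := by
  induction r using Nat.strong_induction_on generalizing s with
  | _ r ih =>
    rcases r with _ | r
    · simp
    · rw [complexHermite_succ_left, complexHermite_succ_right, ih r (by omega), ih r (by omega)]

lemma map_complexHermite {S F : Type*} [CommRing S] [FunLike F R S] [RingHomClass F R S] (f : F)
    (r s : ℕ) : f (complexHermite κ x y r s) = complexHermite (f κ) (f x) (f y) r s := by
  induction r generalizing s with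
  | zero => simp
  | succ r ih => simp [complexHermite_succ_left, ih]

lemma complexHermite_kappa_zero (r s : ℕ) : complexHermite 0 x y r s = x ^ r * y ^ s := by
  induction r with
  | zero => simp
  | succ r ih => simp [complexHermite_succ_left, ih, pow_succ']; ring

/-- Homogeneity of the generating function under α ↦ aα, β ↦ bβ. It later yields the sign flip for κ
= -1, the powers of i in the integral representation, and the thermal factor x^r. -/
lemma complexHermite_scale (a b : R) (r s : ℕ) :
    complexHermite (a * b * κ) (a * x) (b * y) r s = a ^ r * b ^ s * complexHermite κ x y r s := by
  induction r generalizing s with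
  | zero => simp [mul_pow]
  | succ r ih =>
    rw [complexHermite_succ_left, complexHermite_succ_left, ih, ih]
    rcases s with _ | s
    · simp [pow_succ]; ring
    · simp [pow_succ]; ring

/-- The Appell property. An arbitrary derivation is allowed so that both partial derivatives, in
plain and in shifted variables, are covered at once. -/
lemma derivation_complexHermite {k : Type*} [CommSemiring k] [Algebra k R] (D : Derivation k R R)
    (hκ : D κ = 0) (r s : ℕ) : D (complexHermite κ x y r s) =
      r * complexHermite κ x y (r - 1) s * D x + s * complexHermite κ x y r (s - 1) * D y := by
  induction r generalizing s with
  | zero => simp [Derivation.leibniz_pow]; ring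
  | succ r ih =>
    have h1 : (r : R) * complexHermite κ x y r s = r * (x * complexHermite κ x y (r - 1) s -
        κ * s * complexHermite κ x y (r - 1) (s - 1)) := by
      rcases r with _ | r
      · simp
      · simp [complexHermite_succ_left]
    have h2 : complexHermite κ x y (r + 1) (s - 1) = _ := complexHermite_succ_left κ x y r (s - 1)
    rw [complexHermite_succ_left, map_sub, Derivation.leibniz, Derivation.leibniz,
      Derivation.leibniz, ih, ih, hκ, h2]
    simp only [Derivation.map_natCast, smul_eq_mul, Nat.add_sub_cancel, Nat.cast_add, Nat.cast_one]
    linear_combination (-D x) * h1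

end complexHermite

/-! ### The Laguerre form -/

/-- This contiguity relation, raising s while mixing a and a + 1, is the one that corresponds to the
recursion of H_{s+a,s} in its second index. -/
lemma laguerre_succ (s a : ℕ) (X : ℝ) : ((s : ℝ) + 1) * laguerre (s + 1) a X =
    ((s : ℝ) + 1 + a) * laguerre s a X - X * laguerre s (a + 1) X := by
  have key : ∀ j ∈ Finset.range (s + 1), ((s : ℝ) + 1 - j) * ((s + 1 + a).choose (s + 1 - j) : ℝ) =
      ((s : ℝ) + 1 + a) * ((s + a).choose (s - j) : ℝ) := by
    intro j hj
    have hj' : j ≤ s := Nat.lt_succ_iff.mp (Finset.mem_range.mp hj)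
    have h := Nat.add_one_mul_choose_eq (s + a) (s - j)
    rw [show s + a + 1 = s + 1 + a by ring, show s - j + 1 = s + 1 - j by omega] at h
    have h' : ((s + 1 + a : ℕ) : ℝ) * ((s + a).choose (s - j) : ℝ) =
      ((s + 1 + a).choose (s + 1 - j) : ℝ) * ((s + 1 - j : ℕ) : ℝ) := by exact_mod_cast h
    rw [Nat.cast_sub (by omega)] at h'
    push_cast at h'
    linarith
  -- The factor s + 1 is split as (s + 1 - j) + j. The first part kills the top term and is absorbed
  -- by the binomial; the second kills j = 0 and, after a shift of index, is absorbed by the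
  -- factorial.
  have hsplit : ∑ j ∈ Finset.range (s + 1 + 1), ((s : ℝ) + 1) *
        ((-1) ^ j * ((s + 1 + a).choose (s + 1 - j) : ℝ) * X ^ j / (j.factorial : ℝ)) =
      ∑ j ∈ Finset.range (s + 1 + 1), ((s : ℝ) + 1 - j) *
        ((-1) ^ j * ((s + 1 + a).choose (s + 1 - j) : ℝ) * X ^ j / (j.factorial : ℝ)) +
      ∑ j ∈ Finset.range (s + 1 + 1), (j : ℝ) *
        ((-1) ^ j * ((s + 1 + a).choose (s + 1 - j) : ℝ) * X ^ j / (j.factorial : ℝ)) := by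
    rw [← Finset.sum_add_distrib]
    exact Finset.sum_congr rfl fun j _ => by ring
  unfold laguerre
  rw [Finset.mul_sum, hsplit, Finset.sum_range_succ _ (s + 1), Finset.sum_range_succ' _ (s + 1),
    Finset.mul_sum, Finset.mul_sum]
  have e1 : ∀ j ∈ Finset.range (s + 1), ((s : ℝ) + 1 - j) *
        ((-1) ^ j * ((s + 1 + a).choose (s + 1 - j) : ℝ) * X ^ j / (j.factorial : ℝ)) =
      ((s : ℝ) + 1 + a) * ((-1) ^ j * ((s + a).choose (s - j) : ℝ) * X ^ j / (j.factorial : ℝ)) := by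
    intro j hj
    have := key j hj
    linear_combination ((-1) ^ j * X ^ j / (j.factorial : ℝ)) * this
  have e2 : ∀ j ∈ Finset.range (s + 1), ((j + 1 : ℕ) : ℝ) *
        ((-1) ^ (j + 1) * ((s + 1 + a).choose (s + 1 - (j + 1)) : ℝ) * X ^ (j + 1) /
          ((j + 1).factorial : ℝ)) =
      -(X * ((-1) ^ j * ((s + (a + 1)).choose (s - j) : ℝ) * X ^ j / (j.factorial : ℝ))) := by
    intro j hj
    rw [Nat.factorial_succ, show s + 1 - (j + 1) = s - j by omega,
      show s + (a + 1) = s + 1 + a by ring]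
    have : (j.factorial : ℝ) ≠ 0 := by positivity
    have : ((j : ℝ) + 1) ≠ 0 := by positivity
    push_cast
    field_simp
    ring
  rw [Finset.sum_congr rfl e1, Finset.sum_congr rfl e2, Finset.sum_neg_distrib]
  push_cast
  ring

lemma complexHermite_eq_laguerre (x y : ℂ) (X : ℝ) (hX : x * y = X) (s a : ℕ) :
    complexHermite 1 x y (s + a) s = (-1) ^ s * s.factorial * (laguerre s a X : ℂ) * x ^ a := by
  induction s generalizing a with
  | zero => simp [laguerre]
  | succ s ih =>
    have h := laguerre_succ s a X
    have h' : ((s : ℂ) + 1) * (laguerre (s + 1) a X : ℂ) =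
      ((s : ℂ) + 1 + a) * (laguerre s a X : ℂ) - X * (laguerre s (a + 1) X : ℂ) := by
      exact_mod_cast congrArg (fun t : ℝ => (t : ℂ)) h
    rw [complexHermite_succ_right, show s + 1 + a = s + (a + 1) by ring, ih,
      show s + (a + 1) - 1 = s + a by omega, ih, Nat.factorial_succ]
    push_cast
    rw [← hX] at h'
    linear_combination (-1) ^ s * (s.factorial : ℂ) * x ^ a * h'

/-- The complex coordinate `√2 (Q - iP)` on the phase plane. -/
def wcoord (u : ℝ × ℝ) : ℂ := (√2 : ℝ) * ((u.1 : ℂ) - Complex.I * u.2)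

/-- The complex conjugate coordinate `√2 (Q + iP)`. -/
def wconj (u : ℝ × ℝ) : ℂ := (√2 : ℝ) * ((u.1 : ℂ) + Complex.I * u.2)

lemma conj_wcoord (u : ℝ × ℝ) : conj (wcoord u) = wconj u := by
  simp [wcoord, wconj]

lemma sqrt_two_sq : ((√2 : ℝ) : ℂ) ^ 2 = 2 := by
  exact_mod_cast congrArg (fun t : ℝ => (t : ℂ)) (Real.sq_sqrt (zero_le_two (α := ℝ)))

lemma wcoord_mul_wconj (u : ℝ × ℝ) :
    wcoord u * wconj u = ((2 * (u.1 ^ 2 + u.2 ^ 2) : ℝ) : ℂ) := by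
  unfold wcoord wconj
  push_cast
  linear_combination ((u.1 : ℂ) ^ 2 - Complex.I ^ 2 * u.2 ^ 2) * sqrt_two_sq
    - 2 * (u.2 : ℂ) ^ 2 * Complex.I_sq

/-- One formula for both orderings of r and s: below the diagonal it is the Laguerre form, and
conjugation exchanges w with w̄, hence r with s. The factor s! in the Laguerre form turns 1/√(r! s!)
into √(s!/r!). -/
lemma osc_eq (r s : ℕ) (Q P : ℝ) : osc r s Q P =
    ((1 / Real.pi / √(r.factorial * s.factorial) : ℝ) : ℂ) *
      complexHermite 1 (wcoord (Q, P)) (wconj (Q, P)) r s *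
      Complex.exp (-(wcoord (Q, P) * wconj (Q, P)) / 2) := by
  have lower : ∀ r s : ℕ, s ≤ r → oscLower r s Q P =
      ((1 / Real.pi / √(r.factorial * s.factorial) : ℝ) : ℂ) *
      complexHermite 1 (wcoord (Q, P)) (wconj (Q, P)) r s *
      Complex.exp (-(wcoord (Q, P) * wconj (Q, P)) / 2) := by
    intro r s hsr
    obtain ⟨a, rfl⟩ := Nat.exists_eq_add_of_le hsr
    rw [complexHermite_eq_laguerre _ _ _ (wcoord_mul_wconj (Q, P)), wcoord_mul_wconj,
      oscLower, show s + a - s = a by omega]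
    have hs : (0 : ℝ) < s.factorial := by positivity
    have hr : (0 : ℝ) < (s + a).factorial := by positivity
    have h1 : √((s.factorial : ℝ) / ((s + a).factorial : ℝ)) =
        s.factorial / √((s + a).factorial * s.factorial) := by
      rw [Real.sqrt_div hs.le, Real.sqrt_mul hr.le]
      have := Real.sqrt_pos.2 hs
      have := Real.sqrt_pos.2 hr
      field_simp
      rw [Real.sq_sqrt hs.le]
    rw [h1, ← Complex.ofReal_neg]
    have h2 : (-(2 * (Q ^ 2 + P ^ 2)) : ℝ) / 2 = -(Q ^ 2 + P ^ 2) := by ring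
    have h3 : ((-(2 * (Q ^ 2 + P ^ 2)) : ℝ) : ℂ) / 2 = ((-(Q ^ 2 + P ^ 2) : ℝ) : ℂ) := by
      rw [← h2]; push_cast; ring
    simp only [wcoord]
    rw [h3]
    push_cast
    ring
  unfold osc
  split_ifs with h
  · exact lower r s h
  · rw [lower s r (by omega)]
    simp only [map_mul, Complex.conj_ofReal, map_complexHermite, ← Complex.exp_conj, map_div₀,
      map_neg, map_one]
    have h2 : conj (wconj (Q, P)) = wcoord (Q, P) := by rw [← conj_wcoord, Complex.conj_conj]
    rw [h2, conj_wcoord, complexHermite_swap, mul_comm (wconj _), mul_comm (s.factorial : ℝ),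
      Complex.conj_ofNat]

/-! ### Polynomials in the complex coordinates -/

/-- Evaluation of a polynomial in the variables `w, w̄` at a point of the phase plane. -/
def evalW (u : ℝ × ℝ) : MvPolynomial (Fin 2) ℂ →+* ℂ :=
  MvPolynomial.eval ![wcoord u, wconj u]

@[simp] lemma evalW_X_zero (u : ℝ × ℝ) : evalW u (MvPolynomial.X 0) = wcoord u := by simp [evalW]
@[simp] lemma evalW_X_one (u : ℝ × ℝ) : evalW u (MvPolynomial.X 1) = wconj u := by simp [evalW]
@[simp] lemma evalW_C (u : ℝ × ℝ) (c : ℂ) : evalW u (MvPolynomial.C c) = c := by simp [evalW]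

lemma hasDerivAt_evalW (P : MvPolynomial (Fin 2) ℂ) (γ : ℝ → ℝ × ℝ) (a b : ℂ) (t : ℝ)
    (ha : HasDerivAt (fun t => wcoord (γ t)) a t) (hb : HasDerivAt (fun t => wconj (γ t)) b t) :
    HasDerivAt (fun t => evalW (γ t) P) (a * evalW (γ t) (MvPolynomial.pderiv 0 P) +
      b * evalW (γ t) (MvPolynomial.pderiv 1 P)) t := by
  induction P using MvPolynomial.induction_on with
  | C c => simpa using hasDerivAt_const t c
  | add P Q hP hQ =>
    simp only [map_add]
    exact (hP.add hQ).congr_deriv (by ring)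
  | mul_X P i hP =>
    obtain rfl | rfl : i = 0 ∨ i = 1 := by omega
    · simp only [map_mul, evalW_X_zero]
      refine (hP.mul ha).congr_deriv ?_
      simp [Derivation.leibniz, MvPolynomial.pderiv_X]
      ring
    · simp only [map_mul, evalW_X_one]
      refine (hP.mul hb).congr_deriv ?_
      simp [Derivation.leibniz, MvPolynomial.pderiv_X]
      ring

lemma hasDerivAt_wcoord_left (q p : ℝ) :
    HasDerivAt (fun t : ℝ => wcoord (t, p)) (√2 : ℝ) q := by
  have := ((Complex.ofRealCLM.hasDerivAt (x := q)).sub_const (Complex.I * p)).const_mul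
    ((√2 : ℝ) : ℂ)
  simpa [wcoord] using this

lemma hasDerivAt_wconj_left (q p : ℝ) :
    HasDerivAt (fun t : ℝ => wconj (t, p)) (√2 : ℝ) q := by
  have := ((Complex.ofRealCLM.hasDerivAt (x := q)).add_const (Complex.I * p)).const_mul
    ((√2 : ℝ) : ℂ)
  simpa [wconj] using this

lemma hasDerivAt_wcoord_right (q p : ℝ) :
    HasDerivAt (fun t : ℝ => wcoord (q, t)) (-((√2 : ℝ) * Complex.I)) p := by
  have := (((Complex.ofRealCLM.hasDerivAt (x := p)).const_mul Complex.I).const_sub (q : ℂ)).const_mul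
    ((√2 : ℝ) : ℂ)
  simpa [wcoord] using this

lemma hasDerivAt_wconj_right (q p : ℝ) :
    HasDerivAt (fun t : ℝ => wconj (q, t)) ((√2 : ℝ) * Complex.I) p := by
  have := (((Complex.ofRealCLM.hasDerivAt (x := p)).const_mul Complex.I).const_add (q : ℂ)).const_mul
    ((√2 : ℝ) : ℂ)
  simpa [wconj] using this

/-! ### Gaussian weights on the phase plane -/

open MeasureTheory MvPolynomial in
/-- The Gaussian `exp (-c w w̄ + a w + b w̄)`. -/
def gaussW (c : ℝ) (a b : ℂ) (u : ℝ × ℝ) : ℂ :=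
  Complex.exp (-(c * (wcoord u * wconj u)) + a * wcoord u + b * wconj u)

/-- The operator `∂_w` conjugated by a Gaussian weight. -/
def twistedD₀ (c : ℝ) (a : ℂ) (P : MvPolynomial (Fin 2) ℂ) : MvPolynomial (Fin 2) ℂ :=
  MvPolynomial.pderiv 0 P - MvPolynomial.C (c : ℂ) * MvPolynomial.X 1 * P + MvPolynomial.C a * P

/-- The operator `∂_w̄` conjugated by a Gaussian weight. -/
def twistedD₁ (c : ℝ) (b : ℂ) (P : MvPolynomial (Fin 2) ℂ) : MvPolynomial (Fin 2) ℂ :=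
  MvPolynomial.pderiv 1 P - MvPolynomial.C (c : ℂ) * MvPolynomial.X 0 * P + MvPolynomial.C b * P

lemma twistedD₀_combination (c : ℝ) (a x y : ℂ) (P Q : MvPolynomial (Fin 2) ℂ) :
    twistedD₀ c a (MvPolynomial.C x * P + MvPolynomial.C y * Q) =
      MvPolynomial.C x * twistedD₀ c a P + MvPolynomial.C y * twistedD₀ c a Q := by
  simp [twistedD₀, Derivation.leibniz]
  ring

lemma twistedD₁_combination (c : ℝ) (a x y : ℂ) (P Q : MvPolynomial (Fin 2) ℂ) :
    twistedD₁ c a (MvPolynomial.C x * P + MvPolynomial.C y * Q) =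
      MvPolynomial.C x * twistedD₁ c a P + MvPolynomial.C y * twistedD₁ c a Q := by
  simp [twistedD₁, Derivation.leibniz]
  ring

/-- Polynomials times a fixed Gaussian are closed under differentiation; derivatives become
algebraic operators on the polynomial factor. -/
lemma hasDerivAt_evalW_mul_gaussW (c : ℝ) (a b : ℂ) (P : MvPolynomial (Fin 2) ℂ)
    (γ : ℝ → ℝ × ℝ) (A B : ℂ) (t : ℝ)
    (hA : HasDerivAt (fun t => wcoord (γ t)) A t) (hB : HasDerivAt (fun t => wconj (γ t)) B t) :
    HasDerivAt (fun t => evalW (γ t) P * gaussW c a b (γ t))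
      (evalW (γ t) (MvPolynomial.C A * twistedD₀ c a P + MvPolynomial.C B * twistedD₁ c b P) *
        gaussW c a b (γ t)) t := by
  have h := (hasDerivAt_evalW P γ A B t hA hB).mul
    (((((hA.mul hB).const_mul (c : ℂ)).neg.add (hA.const_mul a)).add (hB.const_mul b)).cexp)
  refine h.congr_deriv ?_
  simp [twistedD₀, twistedD₁, gaussW]
  ring

lemma hasDerivAt_left (c : ℝ) (a b : ℂ) (P : MvPolynomial (Fin 2) ℂ) (q p : ℝ) :
    HasDerivAt (fun t => evalW (t, p) P * gaussW c a b (t, p))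
      (evalW (q, p) (MvPolynomial.C ((√2 : ℝ) : ℂ) * twistedD₀ c a P +
        MvPolynomial.C ((√2 : ℝ) : ℂ) * twistedD₁ c b P) * gaussW c a b (q, p)) q :=
  hasDerivAt_evalW_mul_gaussW c a b P (fun t => (t, p)) _ _ q
    (hasDerivAt_wcoord_left q p) (hasDerivAt_wconj_left q p)

lemma hasDerivAt_right (c : ℝ) (a b : ℂ) (P : MvPolynomial (Fin 2) ℂ) (q p : ℝ) :
    HasDerivAt (fun t => evalW (q, t) P * gaussW c a b (q, t))
      (evalW (q, p) (MvPolynomial.C (-((√2 : ℝ) * Complex.I)) * twistedD₀ c a P +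
        MvPolynomial.C ((√2 : ℝ) * Complex.I) * twistedD₁ c b P) * gaussW c a b (q, p)) p :=
  hasDerivAt_evalW_mul_gaussW c a b P (fun t => (q, t)) _ _ p
    (hasDerivAt_wcoord_right q p) (hasDerivAt_wconj_right q p)

/-! ### The oscillator eigenvalue equation -/

/-- The complex Hermite polynomial as a polynomial in `w, w̄`. -/
def hermitePoly (κ : ℂ) (r s : ℕ) : MvPolynomial (Fin 2) ℂ :=
  complexHermite (MvPolynomial.C κ) (MvPolynomial.X 0) (MvPolynomial.X 1) r s

@[simp] lemma evalW_hermitePoly (u : ℝ × ℝ) (κ : ℂ) (r s : ℕ) :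
    evalW u (hermitePoly κ r s) = complexHermite κ (wcoord u) (wconj u) r s := by
  simp [hermitePoly, map_complexHermite]

@[simp] lemma pderiv_zero_hermitePoly (κ : ℂ) (r s : ℕ) :
    MvPolynomial.pderiv 0 (hermitePoly κ r s) = (r : MvPolynomial (Fin 2) ℂ) *
      hermitePoly κ (r - 1) s := by
  rw [hermitePoly, derivation_complexHermite _ _ _ _ (by simp)]
  simp [MvPolynomial.pderiv_X, hermitePoly]

@[simp] lemma pderiv_one_hermitePoly (κ : ℂ) (r s : ℕ) :
    MvPolynomial.pderiv 1 (hermitePoly κ r s) = (s : MvPolynomial (Fin 2) ℂ) *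
      hermitePoly κ r (s - 1) := by
  rw [hermitePoly, derivation_complexHermite _ _ _ _ (by simp)]
  simp [MvPolynomial.pderiv_X, hermitePoly]

lemma osc_eq_evalW (r s : ℕ) (Q P : ℝ) : osc r s Q P =
    ((1 / Real.pi / √(r.factorial * s.factorial) : ℝ) : ℂ) *
      (evalW (Q, P) (hermitePoly 1 r s) * gaussW (1 / 2) 0 0 (Q, P)) := by
  rw [osc_eq, evalW_hermitePoly, gaussW, mul_assoc]
  congr 3
  push_cast
  ring

/-- In the complex coordinates, h × is w w̄/4 + (w∂ - w̄∂̄)/2 - ∂∂̄. Conjugation by exp(-w w̄/2)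
turns it into w∂ - ∂∂̄ + 1/2, and (w∂ - ∂∂̄)H_rs = r H_rs is the Appell property followed by the
recursion in r. -/
theorem oscHamiltonianTwisted_osc (r s : ℕ) (Q P : ℝ) :
    oscHamiltonianTwisted (osc r s) Q P = ((r : ℂ) + 1 / 2) * osc r s Q P := by
  set K : ℂ := ((1 / Real.pi / √(r.factorial * s.factorial) : ℝ) : ℂ)
  have hq : ∀ p, deriv (fun x => osc r s x p) = fun q => K * (evalW (q, p)
      (MvPolynomial.C ((√2 : ℝ) : ℂ) * twistedD₀ (1 / 2) 0 (hermitePoly 1 r s) +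
        MvPolynomial.C ((√2 : ℝ) : ℂ) * twistedD₁ (1 / 2) 0 (hermitePoly 1 r s)) *
        gaussW (1 / 2) 0 0 (q, p)) := fun p => by
    funext q
    simp only [osc_eq_evalW]
    exact ((hasDerivAt_left _ _ _ _ q p).const_mul K).deriv
  have hp : ∀ q, deriv (fun y => osc r s q y) = fun p => K * (evalW (q, p)
      (MvPolynomial.C (-((√2 : ℝ) * Complex.I)) * twistedD₀ (1 / 2) 0 (hermitePoly 1 r s) +
        MvPolynomial.C ((√2 : ℝ) * Complex.I) * twistedD₁ (1 / 2) 0 (hermitePoly 1 r s)) *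
        gaussW (1 / 2) 0 0 (q, p)) := fun q => by
    funext p
    simp only [osc_eq_evalW]
    exact ((hasDerivAt_right _ _ _ _ q p).const_mul K).deriv
  unfold oscHamiltonianTwisted
  rw [iteratedDeriv_succ, iteratedDeriv_one, iteratedDeriv_succ, iteratedDeriv_one, hq P, hp Q,
    ((hasDerivAt_left _ _ _ _ Q P).const_mul K).deriv,
    ((hasDerivAt_right _ _ _ _ Q P).const_mul K).deriv, osc_eq_evalW]
  have hw : wcoord (Q, P) * wconj (Q, P) = 2 * ((Q : ℂ) ^ 2 + P ^ 2) := by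
    rw [wcoord_mul_wconj]; push_cast; ring
  -- Multiplied by r, the recursion also holds at r = 0, where `r - 1` truncates.
  have hH : (r : ℂ) * complexHermite 1 (wcoord (Q, P)) (wconj (Q, P)) r s = r * (wcoord (Q, P) *
      complexHermite 1 (wcoord (Q, P)) (wconj (Q, P)) (r - 1) s -
      s * complexHermite 1 (wcoord (Q, P)) (wconj (Q, P)) (r - 1) (s - 1)) := by
    rcases r with _ | r
    · simp
    · simp [complexHermite_succ_left]
  have hQ : (Q : ℂ) * (√2 : ℝ) = (wcoord (Q, P) + wconj (Q, P)) / 2 := by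
    simp [wcoord, wconj]; ring
  have hP : (P : ℂ) * (√2 : ℝ) = Complex.I * (wcoord (Q, P) - wconj (Q, P)) / 2 := by
    simp [wcoord, wconj]; linear_combination (√2 : ℂ) * P * Complex.I_sq
  set x := wcoord (Q, P)
  set y := wconj (Q, P)
  set d₀ := evalW (Q, P) (twistedD₀ (1 / 2) 0 (hermitePoly 1 r s)) with hd₀
  set d₁ := evalW (Q, P) (twistedD₁ (1 / 2) 0 (hermitePoly 1 r s)) with hd₁
  -- The Laplacian is 8∂∂̄: only the mixed second derivatives are needed, since the pure ones cancel
  -- through I² = -1.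
  have h01 : evalW (Q, P) (twistedD₀ (1 / 2) 0 (twistedD₁ (1 / 2) 0 (hermitePoly 1 r s))) +
      evalW (Q, P) (twistedD₁ (1 / 2) 0 (twistedD₀ (1 / 2) 0 (hermitePoly 1 r s))) =
      2 * (r * s * complexHermite 1 x y (r - 1) (s - 1) - 1 / 2 * complexHermite 1 x y r s
        - 1 / 2 * x * (r * complexHermite 1 x y (r - 1) s)
        - 1 / 2 * y * (s * complexHermite 1 x y r (s - 1))
        + 1 / 4 * x * y * complexHermite 1 x y r s) := by
    simp [twistedD₀, twistedD₁, Derivation.leibniz, MvPolynomial.pderiv_X]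
    ring
  have h0 : d₀ = r * complexHermite 1 x y (r - 1) s - 1 / 2 * y * complexHermite 1 x y r s := by
    simp [hd₀, twistedD₀, y, x]
  have h1 : d₁ = s * complexHermite 1 x y r (s - 1) - 1 / 2 * x * complexHermite 1 x y r s := by
    simp [hd₁, twistedD₁, y, x]
  beta_reduce
  simp only [twistedD₀_combination, twistedD₁_combination]
  simp only [map_add, map_mul (evalW (Q, P)), evalW_C, evalW_hermitePoly, ← hd₀, ← hd₁]
  change _ = ((r : ℂ) + 1 / 2) * (K * (complexHermite 1 x y r s * gaussW (1 / 2) 0 0 (Q, P)))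
  change ((((Q ^ 2 + P ^ 2) / 2 : ℝ)) : ℂ) *
    (K * (complexHermite 1 x y r s * gaussW (1 / 2) 0 0 (Q, P))) + _ - _ = _
  generalize gaussW (1 / 2) 0 0 (Q, P) = g
  generalize evalW (Q, P) (twistedD₀ (1 / 2) 0 (twistedD₁ (1 / 2) 0 (hermitePoly 1 r s))) = d01
    at *
  generalize evalW (Q, P) (twistedD₁ (1 / 2) 0 (twistedD₀ (1 / 2) 0 (hermitePoly 1 r s))) = d10
    at *
  generalize evalW (Q, P) (twistedD₀ (1 / 2) 0 (twistedD₀ (1 / 2) 0 (hermitePoly 1 r s))) = d00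
  generalize evalW (Q, P) (twistedD₁ (1 / 2) 0 (twistedD₁ (1 / 2) 0 (hermitePoly 1 r s))) = d11
  have h2 := sqrt_two_sq
  generalize ((√2 : ℝ) : ℂ) = S at *
  clear_value d₀ d₁ K x y
  push_cast
  linear_combination (-1 / 4 * K * g * complexHermite 1 x y r s) * hw
    + (Complex.I ^ 2 / 2 * (d₁ - d₀) * K * g) * hQ - (Complex.I / 2 * (d₀ + d₁) * K * g) * hP
    + K * g * ((x + y) / 4 * (d₁ - d₀) - (x - y) / 4 * (d₀ + d₁)
      - 1 / 8 * S ^ 2 * (d00 - d01 - d10 + d11)) * Complex.I_sq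
    - 1 / 4 * (d01 + d10) * K * g * h2 - 1 / 2 * K * g * h01 + 1 / 2 * x * K * g * h0
    - 1 / 2 * y * K * g * h1 - K * g * hH

/-! ### Integrability -/


lemma norm_wcoord_sq (u : ℝ × ℝ) : ‖wcoord u‖ ^ 2 = 2 * (u.1 ^ 2 + u.2 ^ 2) := by
  have h : ((‖wcoord u‖ ^ 2 : ℝ) : ℂ) = ((2 * (u.1 ^ 2 + u.2 ^ 2) : ℝ) : ℂ) := by
    rw [← wcoord_mul_wconj, ← conj_wcoord, Complex.mul_conj, Complex.normSq_eq_norm_sq]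
  exact_mod_cast h

lemma norm_wconj (u : ℝ × ℝ) : ‖wconj u‖ = ‖wcoord u‖ := by
  rw [← conj_wcoord, RCLike.norm_conj]

lemma continuous_wcoord : Continuous wcoord := by unfold wcoord; fun_prop

lemma continuous_wconj : Continuous wconj := by unfold wconj; fun_prop

lemma continuous_gaussW (c : ℝ) (a b : ℂ) : Continuous (gaussW c a b) := by
  have := continuous_wcoord
  have := continuous_wconj
  unfold gaussW
  fun_prop

lemma continuous_evalW (P : MvPolynomial (Fin 2) ℂ) : Continuous fun u => evalW u P := by
  unfold evalW
  have : (fun u => MvPolynomial.eval ![wcoord u, wconj u] P) =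
      (fun x => MvPolynomial.eval x P) ∘ fun u => ![wcoord u, wconj u] := rfl
  rw [this]
  refine (MvPolynomial.continuous_eval P).comp (continuous_pi fun i => ?_)
  fin_cases i
  · exact continuous_wcoord
  · exact continuous_wconj

/-- Polynomials grow slower than every Gaussian. The rate ε is quantified inside the induction
because multiplication by a variable spends half of it. -/
lemma exists_norm_evalW_le (P : MvPolynomial (Fin 2) ℂ) : ∀ ε : ℝ, 0 < ε →
    ∃ C : ℝ, ∀ u, ‖evalW u P‖ ≤ C * Real.exp (ε * ‖wcoord u‖ ^ 2) := by
  induction P using MvPolynomial.induction_on with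
  | C c =>
    intro ε hε
    refine ⟨‖c‖, fun u => ?_⟩
    rw [evalW_C]
    exact le_mul_of_one_le_right (norm_nonneg _) (Real.one_le_exp (by positivity))
  | add P Q hP hQ =>
    intro ε hε
    obtain ⟨C, hC⟩ := hP ε hε
    obtain ⟨D, hD⟩ := hQ ε hε
    refine ⟨C + D, fun u => ?_⟩
    rw [map_add, add_mul]
    exact (norm_add_le _ _).trans (add_le_add (hC u) (hD u))
  | mul_X P i hP =>
    intro ε hε
    obtain ⟨C, hC⟩ := hP (ε / 2) (by positivity)
    refine ⟨C * (1 + 2 / ε), fun u => ?_⟩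
    have hX : ‖evalW u (MvPolynomial.X i)‖ = ‖wcoord u‖ := by
      obtain rfl | rfl : i = 0 ∨ i = 1 := by omega
      · rw [evalW_X_zero]
      · rw [evalW_X_one, norm_wconj]
    have h1 : ‖wcoord u‖ ≤ (1 + 2 / ε) * Real.exp (ε / 2 * ‖wcoord u‖ ^ 2) := by
      have h2 := Real.add_one_le_exp (ε / 2 * ‖wcoord u‖ ^ 2)
      have h3 : ‖wcoord u‖ ≤ 1 + ‖wcoord u‖ ^ 2 := by nlinarith [sq_nonneg (‖wcoord u‖ - 1)]
      have h4 : (1 + 2 / ε) * (ε / 2 * ‖wcoord u‖ ^ 2 + 1) =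
          ‖wcoord u‖ ^ 2 + 1 + ε / 2 * ‖wcoord u‖ ^ 2 + 2 / ε := by field_simp; ring
      have h5 : (0 : ℝ) < 1 + 2 / ε := by positivity
      have h6 : 0 ≤ ε / 2 * ‖wcoord u‖ ^ 2 + 2 / ε := by positivity
      nlinarith [mul_le_mul_of_nonneg_left h2 h5.le]
    rw [map_mul, norm_mul, hX]
    calc ‖evalW u P‖ * ‖wcoord u‖ ≤ (C * Real.exp (ε / 2 * ‖wcoord u‖ ^ 2)) *
          ((1 + 2 / ε) * Real.exp (ε / 2 * ‖wcoord u‖ ^ 2)) :=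
          mul_le_mul (hC u) h1 (norm_nonneg _) ((norm_nonneg _).trans (hC u))
      _ = C * (1 + 2 / ε) * (Real.exp (ε / 2 * ‖wcoord u‖ ^ 2) *
          Real.exp (ε / 2 * ‖wcoord u‖ ^ 2)) := by ring
      _ = _ := by rw [← Real.exp_add]; ring_nf

lemma norm_gaussW_le (c : ℝ) (hc : 0 < c) (a b : ℂ) : ∃ C : ℝ, 0 < C ∧
    ∀ u, ‖gaussW c a b u‖ ≤ C * Real.exp (-(c / 2) * ‖wcoord u‖ ^ 2) := by
  set M := ‖a‖ + ‖b‖ with hM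
  refine ⟨Real.exp (M ^ 2 / (2 * c)), Real.exp_pos _, fun u => ?_⟩
  rw [gaussW, Complex.norm_exp, ← Real.exp_add]
  refine Real.exp_le_exp.2 ?_
  have h1 : (a * wcoord u + b * wconj u).re ≤ M * ‖wcoord u‖ := by
    refine (Complex.re_le_norm _).trans ((norm_add_le _ _).trans ?_)
    rw [norm_mul, norm_mul, norm_wconj, hM, add_mul]
  have h2 : M * ‖wcoord u‖ ≤ M ^ 2 / (2 * c) + c / 2 * ‖wcoord u‖ ^ 2 := by
    have : M ^ 2 / (2 * c) + c / 2 * ‖wcoord u‖ ^ 2 - M * ‖wcoord u‖ =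
        (M - c * ‖wcoord u‖) ^ 2 / (2 * c) := by field_simp; ring
    have : 0 ≤ (M - c * ‖wcoord u‖) ^ 2 / (2 * c) := by positivity
    linarith
  have h3 : (-((c : ℂ) * (wcoord u * wconj u)) + a * wcoord u + b * wconj u).re =
      -(c * ‖wcoord u‖ ^ 2) + (a * wcoord u + b * wconj u).re := by
    rw [add_assoc, Complex.add_re, wcoord_mul_wconj, norm_wcoord_sq, ← Complex.ofReal_mul,
      Complex.neg_re, Complex.ofReal_re]
  rw [h3]
  linarith

lemma integrable_exp_neg_norm_wcoord_sq (c : ℝ) (hc : 0 < c) :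
    Integrable fun u : ℝ × ℝ => Real.exp (-c * ‖wcoord u‖ ^ 2) := by
  have h := (integrable_exp_neg_mul_sq (b := 2 * c) (by positivity)).mul_prod
    (integrable_exp_neg_mul_sq (b := 2 * c) (by positivity))
  refine h.congr (Filter.Eventually.of_forall fun u => ?_)
  simp only
  rw [← Real.exp_add, norm_wcoord_sq]
  ring_nf

lemma integrable_evalW_mul_gaussW (c : ℝ) (hc : 0 < c) (a b : ℂ) (P : MvPolynomial (Fin 2) ℂ) :
    Integrable fun u => evalW u P * gaussW c a b u := by
  -- Half of the decay rate c pays for the linear terms in `norm_gaussW_le` and a quarter for the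
  -- polynomial, which leaves c/4.
  obtain ⟨C, hC⟩ := exists_norm_evalW_le P (c / 4) (by positivity)
  obtain ⟨D, hD, hD'⟩ := norm_gaussW_le c hc a b
  refine ((integrable_exp_neg_norm_wcoord_sq (c / 4) (by positivity)).const_mul (C * D)).mono'
    ((continuous_evalW P).mul (continuous_gaussW c a b)).aestronglyMeasurable
    (Filter.Eventually.of_forall fun u => ?_)
  rw [norm_mul]
  refine (mul_le_mul (hC u) (hD' u) (norm_nonneg _) ((norm_nonneg _).trans (hC u))).trans
    (le_of_eq ?_)
  rw [mul_mul_mul_comm, ← Real.exp_add]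
  ring_nf

/-! ### Gaussian moments -/

/-- The Gaussian moment functional on polynomials in `w, w̄`. -/
def gaussMoment (c : ℝ) (a b : ℂ) (P : MvPolynomial (Fin 2) ℂ) : ℂ :=
  ∫ u, evalW u P * gaussW c a b u

lemma gaussMoment_add (c : ℝ) (hc : 0 < c) (a b : ℂ) (P Q : MvPolynomial (Fin 2) ℂ) :
    gaussMoment c a b (P + Q) = gaussMoment c a b P + gaussMoment c a b Q := by
  unfold gaussMoment
  rw [← integral_add (integrable_evalW_mul_gaussW c hc a b P)
    (integrable_evalW_mul_gaussW c hc a b Q)]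
  simp only [map_add, add_mul]

lemma gaussMoment_C_mul (c : ℝ) (a b x : ℂ) (P : MvPolynomial (Fin 2) ℂ) :
    gaussMoment c a b (MvPolynomial.C x * P) = x * gaussMoment c a b P := by
  unfold gaussMoment
  rw [← integral_const_mul]
  simp only [map_mul, evalW_C, mul_assoc]

lemma gaussMoment_sub (c : ℝ) (hc : 0 < c) (a b : ℂ) (P Q : MvPolynomial (Fin 2) ℂ) :
    gaussMoment c a b (P - Q) = gaussMoment c a b P - gaussMoment c a b Q := by
  unfold gaussMoment
  rw [← integral_sub (integrable_evalW_mul_gaussW c hc a b P)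
    (integrable_evalW_mul_gaussW c hc a b Q)]
  simp only [map_sub, sub_mul]

/-- The integrand is a derivative in q, so the inner integral vanishes for almost every p, namely
wherever the slices are integrable. -/
lemma gaussMoment_left (c : ℝ) (hc : 0 < c) (a b : ℂ) (P : MvPolynomial (Fin 2) ℂ) :
    gaussMoment c a b (MvPolynomial.C ((√2 : ℝ) : ℂ) * twistedD₀ c a P +
        MvPolynomial.C ((√2 : ℝ) : ℂ) * twistedD₁ c b P) = 0 := by
  have h1 := integrable_evalW_mul_gaussW c hc a b P
  have h2 := integrable_evalW_mul_gaussW c hc a b (MvPolynomial.C ((√2 : ℝ) : ℂ) *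
    twistedD₀ c a P + MvPolynomial.C ((√2 : ℝ) : ℂ) * twistedD₁ c b P)
  unfold gaussMoment
  rw [Measure.volume_eq_prod] at h1 h2 ⊢
  rw [integral_prod_symm _ h2]
  refine integral_eq_zero_of_ae ?_
  filter_upwards [h1.prod_left_ae, h2.prod_left_ae] with p hp1 hp2
  exact integral_eq_zero_of_hasDerivAt_of_integrable (fun q => hasDerivAt_left c a b P q p)
    hp2 hp1

lemma gaussMoment_right (c : ℝ) (hc : 0 < c) (a b : ℂ) (P : MvPolynomial (Fin 2) ℂ) :
    gaussMoment c a b (MvPolynomial.C (-((√2 : ℝ) * Complex.I)) * twistedD₀ c a P +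
        MvPolynomial.C ((√2 : ℝ) * Complex.I) * twistedD₁ c b P) = 0 := by
  have h1 := integrable_evalW_mul_gaussW c hc a b P
  have h2 := integrable_evalW_mul_gaussW c hc a b (MvPolynomial.C (-((√2 : ℝ) * Complex.I)) *
    twistedD₀ c a P + MvPolynomial.C ((√2 : ℝ) * Complex.I) * twistedD₁ c b P)
  unfold gaussMoment
  rw [Measure.volume_eq_prod] at h1 h2 ⊢
  rw [integral_prod _ h2]
  refine integral_eq_zero_of_ae ?_
  filter_upwards [h1.prod_right_ae, h2.prod_right_ae] with q hq1 hq2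
  exact integral_eq_zero_of_hasDerivAt_of_integrable (fun p => hasDerivAt_right c a b P q p)
    hq2 hq1

/-- The real derivatives are independent combinations of ∂_w and ∂_w̄, so the two vanishing
integrals can be solved for the complex ones. -/
lemma gaussMoment_twistedD (c : ℝ) (hc : 0 < c) (a b : ℂ) (P : MvPolynomial (Fin 2) ℂ) :
    gaussMoment c a b (twistedD₀ c a P) = 0 ∧ gaussMoment c a b (twistedD₁ c b P) = 0 := by
  have h1 := gaussMoment_left c hc a b P
  have h2 := gaussMoment_right c hc a b P
  rw [gaussMoment_add c hc, gaussMoment_C_mul, gaussMoment_C_mul] at h1 h2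
  have hS : ((√2 : ℝ) : ℂ) ≠ 0 := by simp
  have e1 := mul_left_cancel₀ hS (show ((√2 : ℝ) : ℂ) * (gaussMoment c a b (twistedD₀ c a P) +
    gaussMoment c a b (twistedD₁ c b P)) = ((√2 : ℝ) : ℂ) * 0 by linear_combination h1)
  have e2 := mul_left_cancel₀ (mul_ne_zero hS Complex.I_ne_zero)
    (show ((√2 : ℝ) : ℂ) * Complex.I * (gaussMoment c a b (twistedD₁ c b P) -
    gaussMoment c a b (twistedD₀ c a P)) = ((√2 : ℝ) : ℂ) * Complex.I * 0 by
      linear_combination h2)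
  constructor
  · linear_combination (e1 - e2) / 2
  · linear_combination (e1 + e2) / 2

/-- Integration by parts in `w`. -/
lemma gaussMoment_X_one_mul (c : ℝ) (hc : 0 < c) (a b : ℂ) (P : MvPolynomial (Fin 2) ℂ) :
    c * gaussMoment c a b (MvPolynomial.X 1 * P) =
      gaussMoment c a b (MvPolynomial.pderiv 0 P) + a * gaussMoment c a b P := by
  have h := (gaussMoment_twistedD c hc a b P).1
  rw [twistedD₀, gaussMoment_add c hc, gaussMoment_sub c hc, mul_assoc, gaussMoment_C_mul,
    gaussMoment_C_mul] at h
  linear_combination -h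

/-- Integration by parts in `w̄`. -/
lemma gaussMoment_X_zero_mul (c : ℝ) (hc : 0 < c) (a b : ℂ) (P : MvPolynomial (Fin 2) ℂ) :
    c * gaussMoment c a b (MvPolynomial.X 0 * P) =
      gaussMoment c a b (MvPolynomial.pderiv 1 P) + b * gaussMoment c a b P := by
  have h := (gaussMoment_twistedD c hc a b P).2
  rw [twistedD₁, gaussMoment_add c hc, gaussMoment_sub c hc, mul_assoc, gaussMoment_C_mul,
    gaussMoment_C_mul] at h
  linear_combination -h

/-- Here a and b are independent complex numbers, not conjugates, so that shifts by symplectic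
phases are covered. The 2 in the denominator is the Jacobian of w = √2(Q - iP). -/
lemma integral_gaussW (c : ℝ) (hc : 0 < c) (a b : ℂ) :
    ∫ u, gaussW c a b u = Real.pi / (2 * c) * Complex.exp (a * b / c) := by
  have hc' : (c : ℂ) ≠ 0 := by exact_mod_cast hc.ne'
  have hre : (-(2 * c : ℂ)).re < 0 := by simpa using hc
  have h1 := integral_cexp_quadratic hre ((√2 : ℝ) * (a + b)) 0
  have h2 := integral_cexp_quadratic hre ((√2 : ℝ) * Complex.I * (b - a)) 0
  have e : ∀ u : ℝ × ℝ, gaussW c a b u =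
      Complex.exp (-(2 * c : ℂ) * u.1 ^ 2 + (√2 : ℝ) * (a + b) * u.1 + 0) *
      Complex.exp (-(2 * c : ℂ) * u.2 ^ 2 + (√2 : ℝ) * Complex.I * (b - a) * u.2 + 0) := by
    intro u
    rw [gaussW, wcoord_mul_wconj, ← Complex.exp_add]
    congr 1
    simp only [wcoord, wconj]
    push_cast
    ring
  simp only [e]
  rw [Measure.volume_eq_prod, integral_prod_mul
    (fun x : ℝ => Complex.exp (-(2 * c : ℂ) * x ^ 2 + (√2 : ℝ) * (a + b) * x + 0))
    (fun x : ℝ => Complex.exp (-(2 * c : ℂ) * x ^ 2 + (√2 : ℝ) * Complex.I * (b - a) * x + 0)),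
    h1, h2, mul_mul_mul_comm, ← Complex.exp_add]
  have hp : (Real.pi / - -(2 * c) : ℂ) ≠ 0 := by
    rw [neg_neg]
    exact div_ne_zero (by exact_mod_cast Real.pi_ne_zero) (mul_ne_zero two_ne_zero hc')
  -- Each one-dimensional integral carries the power 1/2 of the same base.
  rw [← Complex.cpow_add _ _ hp]
  norm_num
  left
  congr 1
  field_simp
  linear_combination ((a + b) ^ 2 + Complex.I ^ 2 * (b - a) ^ 2) * sqrt_two_sq
    + 2 * (b - a) ^ 2 * Complex.I_sq

/-- Gaussian moments of the complex Hermite polynomials. -/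
lemma gaussMoment_hermitePoly (c : ℝ) (hc : 0 < c) (a b κ : ℂ) (r s : ℕ) :
    gaussMoment c a b (hermitePoly κ r s) =
      Real.pi / (2 * c) * Complex.exp (a * b / c) *
        complexHermite (κ - 1 / c) (b / c) (a / c) r s := by
  have hc' : (c : ℂ) ≠ 0 := by exact_mod_cast hc.ne'
  induction r using Nat.strong_induction_on generalizing s with
  | _ r ih =>
    rcases r with _ | r
    · induction s with
      | zero =>
        simp [hermitePoly, gaussMoment, integral_gaussW c hc a b]
      | succ s ihs =>
        have h := gaussMoment_X_one_mul c hc a b (hermitePoly κ 0 s)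
        simp only [pderiv_zero_hermitePoly] at h
        have e : hermitePoly κ 0 (s + 1) = MvPolynomial.X 1 * hermitePoly κ 0 s := by
          simp [hermitePoly, pow_succ']
        rw [e]
        refine mul_left_cancel₀ hc' (h.trans ?_)
        rw [ihs]
        simp [pow_succ, gaussMoment]
        field_simp
    -- The integration by parts contributes s/c and the recursion -κs, with the same lower
    -- polynomial; together they shift κ by -1/c.
    · have h := gaussMoment_X_zero_mul c hc a b (hermitePoly κ r s)
      have e : hermitePoly κ (r + 1) s = MvPolynomial.X 0 * hermitePoly κ r s -
          MvPolynomial.C (κ * s) * hermitePoly κ r (s - 1) := by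
        simp [hermitePoly, complexHermite_succ_left]
      have e' : MvPolynomial.pderiv 1 (hermitePoly κ r s) =
          MvPolynomial.C (s : ℂ) * hermitePoly κ r (s - 1) := by simp
      rw [e', gaussMoment_C_mul] at h
      rw [e, gaussMoment_sub c hc, gaussMoment_C_mul, complexHermite_succ_left]
      rw [ih r (by omega), ih r (by omega)] at h
      rw [ih r (by omega)]
      refine mul_left_cancel₀ hc' ?_
      rw [mul_sub, h]
      field_simp
      ring

/-! ### Moments of products of two Hermite polynomials -/

/-- The complex Hermite polynomial in the shifted variables `w - x, w̄ - y`. -/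
def shiftedHermitePoly (x y : ℂ) (t v : ℕ) : MvPolynomial (Fin 2) ℂ :=
  complexHermite 1 (MvPolynomial.X 0 - MvPolynomial.C x) (MvPolynomial.X 1 - MvPolynomial.C y) t v

@[simp] lemma evalW_shiftedHermitePoly (u : ℝ × ℝ) (x y : ℂ) (r s : ℕ) :
    evalW u (shiftedHermitePoly x y r s) =
      complexHermite 1 (wcoord u - x) (wconj u - y) r s := by
  simp [shiftedHermitePoly, map_complexHermite]

@[simp] lemma pderiv_zero_shiftedHermitePoly (x y : ℂ) (r s : ℕ) :
    MvPolynomial.pderiv 0 (shiftedHermitePoly x y r s) = (r : MvPolynomial (Fin 2) ℂ) *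
      shiftedHermitePoly x y (r - 1) s := by
  rw [shiftedHermitePoly, derivation_complexHermite _ _ _ _ (by simp)]
  simp [MvPolynomial.pderiv_X, shiftedHermitePoly]

@[simp] lemma pderiv_one_shiftedHermitePoly (x y : ℂ) (r s : ℕ) :
    MvPolynomial.pderiv 1 (shiftedHermitePoly x y r s) = (s : MvPolynomial (Fin 2) ℂ) *
      shiftedHermitePoly x y r (s - 1) := by
  rw [shiftedHermitePoly, derivation_complexHermite _ _ _ _ (by simp)]
  simp [MvPolynomial.pderiv_X, shiftedHermitePoly]

lemma gaussMoment_natCast_mul (c : ℝ) (a b : ℂ) (n : ℕ) (P : MvPolynomial (Fin 2) ℂ) :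
    gaussMoment c a b ((n : MvPolynomial (Fin 2) ℂ) * P) = n * gaussMoment c a b P := by
  rw [← gaussMoment_C_mul, map_natCast]

/-- For rate 1 and a = 0, multiplication by w̄ integrates to ∂_w. The derivative of the first factor
cancels the correction term of its recursion, so only the derivative of the second factor survives
and s, t drop together. -/
lemma gaussMoment_pair_succ_second (x y : ℂ) (r s t v : ℕ) :
    gaussMoment 1 0 x (hermitePoly 1 r (s + 1) * shiftedHermitePoly x y t v) =
      t * gaussMoment 1 0 x (hermitePoly 1 r s * shiftedHermitePoly x y (t - 1) v) := by
  have h := gaussMoment_X_one_mul 1 one_pos 0 x (hermitePoly 1 r s * shiftedHermitePoly x y t v)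
  have e : hermitePoly 1 r (s + 1) * shiftedHermitePoly x y t v =
      MvPolynomial.X 1 * (hermitePoly 1 r s * shiftedHermitePoly x y t v) -
      (r : MvPolynomial (Fin 2) ℂ) * (hermitePoly 1 (r - 1) s * shiftedHermitePoly x y t v) := by
    simp [hermitePoly, complexHermite_succ_right]; ring
  have e' : MvPolynomial.pderiv 0 (hermitePoly 1 r s * shiftedHermitePoly x y t v) =
      (r : MvPolynomial (Fin 2) ℂ) * (hermitePoly 1 (r - 1) s * shiftedHermitePoly x y t v) +
      (t : MvPolynomial (Fin 2) ℂ) * (hermitePoly 1 r s * shiftedHermitePoly x y (t - 1) v) := by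
    simp [Derivation.leibniz]; ring
  rw [e', gaussMoment_add 1 one_pos, gaussMoment_natCast_mul, gaussMoment_natCast_mul] at h
  rw [e, gaussMoment_sub 1 one_pos, gaussMoment_natCast_mul]
  push_cast at h
  linear_combination h

/-- The same cancellation with w; the linear coefficient b = x of the weight removes the shift of
the second polynomial. -/
lemma gaussMoment_pair_succ_third (x y : ℂ) (r s t v : ℕ) :
    gaussMoment 1 0 x (hermitePoly 1 r s * shiftedHermitePoly x y (t + 1) v) =
      s * gaussMoment 1 0 x (hermitePoly 1 r (s - 1) * shiftedHermitePoly x y t v) := by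
  have h := gaussMoment_X_zero_mul 1 one_pos 0 x (hermitePoly 1 r s * shiftedHermitePoly x y t v)
  have e : hermitePoly 1 r s * shiftedHermitePoly x y (t + 1) v =
      MvPolynomial.X 0 * (hermitePoly 1 r s * shiftedHermitePoly x y t v) -
      MvPolynomial.C x * (hermitePoly 1 r s * shiftedHermitePoly x y t v) -
      (v : MvPolynomial (Fin 2) ℂ) * (hermitePoly 1 r s * shiftedHermitePoly x y t (v - 1)) := by
    simp [shiftedHermitePoly, complexHermite_succ_left]; ring
  have e' : MvPolynomial.pderiv 1 (hermitePoly 1 r s * shiftedHermitePoly x y t v) =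
      (s : MvPolynomial (Fin 2) ℂ) * (hermitePoly 1 r (s - 1) * shiftedHermitePoly x y t v) +
      (v : MvPolynomial (Fin 2) ℂ) * (hermitePoly 1 r s * shiftedHermitePoly x y t (v - 1)) := by
    simp [Derivation.leibniz]; ring
  rw [e', gaussMoment_add 1 one_pos, gaussMoment_natCast_mul, gaussMoment_natCast_mul] at h
  rw [e, gaussMoment_sub 1 one_pos, gaussMoment_sub 1 one_pos, gaussMoment_natCast_mul,
    gaussMoment_C_mul]
  push_cast at h
  linear_combination h

lemma gaussMoment_pair_succ_fourth (x y : ℂ) (v : ℕ) :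
    gaussMoment 1 0 x (hermitePoly 1 0 0 * shiftedHermitePoly x y 0 (v + 1)) =
      -y * gaussMoment 1 0 x (hermitePoly 1 0 0 * shiftedHermitePoly x y 0 v) := by
  have h := gaussMoment_X_one_mul 1 one_pos 0 x (hermitePoly 1 0 0 * shiftedHermitePoly x y 0 v)
  have e : hermitePoly 1 0 0 * shiftedHermitePoly x y 0 (v + 1) =
      MvPolynomial.X 1 * (hermitePoly 1 0 0 * shiftedHermitePoly x y 0 v) -
      MvPolynomial.C y * (hermitePoly 1 0 0 * shiftedHermitePoly x y 0 v) := by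
    simp [shiftedHermitePoly, complexHermite_succ_right]; ring
  have e' : MvPolynomial.pderiv 0 (hermitePoly 1 0 0 * shiftedHermitePoly x y 0 v) =
      MvPolynomial.C 0 * (hermitePoly 1 0 0 * shiftedHermitePoly x y 0 v) := by
    simp [Derivation.leibniz]
  rw [e', gaussMoment_C_mul] at h
  rw [e, gaussMoment_sub 1 one_pos, gaussMoment_C_mul]
  push_cast at h
  linear_combination h

lemma gaussMoment_pair_succ_first (x y : ℂ) (r v : ℕ) :
    gaussMoment 1 0 x (hermitePoly 1 (r + 1) 0 * shiftedHermitePoly x y 0 v) =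
      x * gaussMoment 1 0 x (hermitePoly 1 r 0 * shiftedHermitePoly x y 0 v) +
      v * gaussMoment 1 0 x (hermitePoly 1 r 0 * shiftedHermitePoly x y 0 (v - 1)) := by
  have h := gaussMoment_X_zero_mul 1 one_pos 0 x (hermitePoly 1 r 0 * shiftedHermitePoly x y 0 v)
  have e : hermitePoly 1 (r + 1) 0 * shiftedHermitePoly x y 0 v =
      MvPolynomial.X 0 * (hermitePoly 1 r 0 * shiftedHermitePoly x y 0 v) := by
    simp [hermitePoly, complexHermite_succ_left]; ring
  have e' : MvPolynomial.pderiv 1 (hermitePoly 1 r 0 * shiftedHermitePoly x y 0 v) =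
      (v : MvPolynomial (Fin 2) ℂ) * (hermitePoly 1 r 0 * shiftedHermitePoly x y 0 (v - 1)) := by
    simp [Derivation.leibniz]; ring
  rw [e', gaussMoment_natCast_mul] at h
  rw [e]
  push_cast at h
  linear_combination h

/-- For s = t = 0 the factors are the powers w^r and (w̄ - y)^v, and integration by parts reproduces
the recursion of H_rv up to the sign (-1)^v. -/
lemma gaussMoment_pair_base (x y : ℂ) (r v : ℕ) :
    gaussMoment 1 0 x (hermitePoly 1 r 0 * shiftedHermitePoly x y 0 v) =
      Real.pi / 2 * ((-1) ^ v * complexHermite 1 x y r v) := by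
  induction r generalizing v with
  | zero =>
    induction v with
    | zero => simp [hermitePoly, shiftedHermitePoly, gaussMoment, integral_gaussW 1 one_pos]
    | succ v ih =>
      rw [gaussMoment_pair_succ_fourth, ih]
      simp [pow_succ]; ring
  | succ r ih =>
    rw [gaussMoment_pair_succ_first, ih, ih, complexHermite_succ_left]
    rcases v with _ | v
    · simp; ring
    · simp [pow_succ]; ring

/-- The lowering rules descend in s and t simultaneously and give zero when one index is exhausted
before the other; the descents collect s!. This is the source of the Kronecker delta in the
matrix-unit relation. -/
lemma gaussMoment_pair (x y : ℂ) (r s t v : ℕ) :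
    gaussMoment 1 0 x (hermitePoly 1 r s * shiftedHermitePoly x y t v) =
      if s = t then Real.pi / 2 * (s.factorial * ((-1) ^ v * complexHermite 1 x y r v)) else 0 := by
  induction s generalizing t with
  | zero =>
    rcases t with _ | t
    · simp [gaussMoment_pair_base]
    · simp [gaussMoment_pair_succ_third]
  | succ s ih =>
    rcases t with _ | t
    · simp [gaussMoment_pair_succ_second]
    · rw [gaussMoment_pair_succ_second, Nat.add_sub_cancel, ih]
      simp only [Nat.add_right_cancel_iff]
      split_ifs with h
      · subst h; rw [Nat.factorial_succ]; push_cast; ring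
      · simp

/-! ### The twisted product in one degree of freedom -/

/-- The phase of the twisted product, `2 (q p' - q' p)`. -/
def symplecticPhase (u v : ℝ × ℝ) : ℂ :=
  Complex.exp (2 * Complex.I * ((u.1 * v.2 - v.1 * u.2 : ℝ) : ℂ))

/-- The twisted product on the phase plane. -/
def twistedPlane (f g : ℝ × ℝ → ℂ) (u : ℝ × ℝ) : ℂ :=
  ((1 / Real.pi ^ 2 : ℝ) : ℂ) * ∫ z : (ℝ × ℝ) × (ℝ × ℝ), f z.1 * g z.2 *
    (symplecticPhase u z.1 * symplecticPhase z.1 z.2 * symplecticPhase z.2 u)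

lemma symplecticPhase_eq (u v : ℝ × ℝ) : symplecticPhase u v =
    Complex.exp ((wconj v * wcoord u - wcoord v * wconj u) / 2) := by
  unfold symplecticPhase
  congr 1
  simp only [wcoord, wconj]
  push_cast
  linear_combination (-Complex.I * (u.1 * v.2 - v.1 * u.2)) * sqrt_two_sq

lemma norm_symplecticPhase (u v : ℝ × ℝ) : ‖symplecticPhase u v‖ = 1 := by
  unfold symplecticPhase
  rw [mul_right_comm, mul_comm, show (2 : ℂ) = ((2 : ℝ) : ℂ) by simp, ← Complex.ofReal_mul,
    mul_comm Complex.I]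
  exact Complex.norm_exp_ofReal_mul_I _

lemma continuous_symplecticPhase :
    Continuous fun x : (ℝ × ℝ) × (ℝ × ℝ) => symplecticPhase x.1 x.2 := by
  unfold symplecticPhase
  fun_prop

lemma integrable_twistedPlane {f g : ℝ × ℝ → ℂ} (hf : Integrable f) (hg : Integrable g)
    (u : ℝ × ℝ) : Integrable (fun z : (ℝ × ℝ) × (ℝ × ℝ) => f z.1 * g z.2 *
    (symplecticPhase u z.1 * symplecticPhase z.1 z.2 * symplecticPhase z.2 u))
    ((volume : Measure (ℝ × ℝ)).prod volume) := by
  refine (hf.mul_prod hg).mul_bdd (c := 1) (Continuous.aestronglyMeasurable ?_)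
    (Filter.Eventually.of_forall fun z => ?_)
  · have h := continuous_symplecticPhase
    have h1 := h.comp (show Continuous fun z : (ℝ × ℝ) × (ℝ × ℝ) => (u, z.1) by fun_prop)
    have h2 := h.comp (show Continuous fun z : (ℝ × ℝ) × (ℝ × ℝ) => (z.2, u) by fun_prop)
    exact (h1.mul h).mul h2
  · simp [norm_symplecticPhase]

/-- Both orders of integration are needed: the right factor is transformed first for two
eigentransitions, the left factor first when it is the thermal Gaussian (`twistedPlane_eq_right`).
-/
lemma twistedPlane_eq_left {f g : ℝ × ℝ → ℂ} (hf : Integrable f) (hg : Integrable g)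
    (u : ℝ × ℝ) : twistedPlane f g u = ((1 / Real.pi ^ 2 : ℝ) : ℂ) *
      ∫ z₁, f z₁ * symplecticPhase u z₁ *
        ∫ z₂, g z₂ * (symplecticPhase z₁ z₂ * symplecticPhase z₂ u) := by
  unfold twistedPlane
  rw [Measure.volume_eq_prod (ℝ × ℝ), integral_prod _ (integrable_twistedPlane hf hg u)]
  congr 2
  funext z₁
  rw [← integral_const_mul]
  congr 1
  funext z₂
  ring

lemma twistedPlane_eq_right {f g : ℝ × ℝ → ℂ} (hf : Integrable f) (hg : Integrable g)
    (u : ℝ × ℝ) : twistedPlane f g u = ((1 / Real.pi ^ 2 : ℝ) : ℂ) *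
      ∫ z₂, g z₂ * symplecticPhase z₂ u *
        ∫ z₁, f z₁ * (symplecticPhase u z₁ * symplecticPhase z₁ z₂) := by
  unfold twistedPlane
  rw [Measure.volume_eq_prod (ℝ × ℝ), integral_prod_symm _ (integrable_twistedPlane hf hg u)]
  congr 2
  funext z₂
  rw [← integral_const_mul]
  congr 1
  funext z₁
  ring

/-- `osc` as a function on the phase plane. -/
def oscPlane (r s : ℕ) (u : ℝ × ℝ) : ℂ := osc r s u.1 u.2

/-- The normalization constant of `osc`. -/
def oscNorm (r s : ℕ) : ℂ := ((1 / Real.pi / √(r.factorial * s.factorial) : ℝ) : ℂ)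

lemma oscPlane_eq (r s : ℕ) (u : ℝ × ℝ) :
    oscPlane r s u = oscNorm r s * (evalW u (hermitePoly 1 r s) * gaussW (1 / 2) 0 0 u) :=
  osc_eq_evalW r s u.1 u.2

lemma integrable_oscPlane (r s : ℕ) : Integrable (oscPlane r s) := by
  have h : oscPlane r s = fun u => oscNorm r s *
      (evalW u (hermitePoly 1 r s) * gaussW (1 / 2) 0 0 u) := funext (oscPlane_eq r s)
  rw [h]
  exact (integrable_evalW_mul_gaussW _ (by norm_num) _ _ _).const_mul _

lemma conj_oscPlane (r s : ℕ) (u : ℝ × ℝ) : conj (oscPlane r s u) = oscPlane s r u := by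
  have h2 : conj (wconj u) = wcoord u := by rw [← conj_wcoord, Complex.conj_conj]
  simp only [oscPlane_eq, oscNorm, gaussW, evalW_hermitePoly, map_mul, Complex.conj_ofReal,
    map_complexHermite, ← Complex.exp_conj, map_neg, map_add, map_one, map_zero, conj_wcoord, h2]
  rw [complexHermite_swap, mul_comm (wconj u), mul_comm (s.factorial : ℝ)]
  simp

lemma oscNorm_mul (r s v : ℕ) :
    oscNorm r s * oscNorm s v * s.factorial = oscNorm r v / Real.pi := by
  unfold oscNorm
  rw [← Complex.ofReal_mul, ← Complex.ofReal_natCast, ← Complex.ofReal_mul, ← Complex.ofReal_div]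
  congr 1
  have hr : (0 : ℝ) < r.factorial := by positivity
  have hs : (0 : ℝ) < s.factorial := by positivity
  have hv : (0 : ℝ) < v.factorial := by positivity
  rw [Real.sqrt_mul hr.le, Real.sqrt_mul hs.le, Real.sqrt_mul hr.le]
  have := Real.sqrt_pos.2 hr
  have := Real.sqrt_pos.2 hv
  have := Real.sqrt_pos.2 hs
  have := Real.pi_pos
  field_simp
  rw [Real.sq_sqrt hs.le]

lemma oscNorm_self (r : ℕ) : oscNorm r r * Real.pi * r.factorial = 1 := by
  unfold oscNorm
  rw [← Complex.ofReal_mul, ← Complex.ofReal_natCast, ← Complex.ofReal_mul,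
    Real.sqrt_mul_self (by positivity)]
  have : (0 : ℝ) < r.factorial := by positivity
  have := Real.pi_pos
  rw [← Complex.ofReal_one]
  congr 1
  field_simp

lemma complexHermite_zero_zero (κ : ℂ) (r s : ℕ) :
    complexHermite κ 0 0 r s = if r = s then (-κ) ^ r * r.factorial else 0 := by
  induction r generalizing s with
  | zero => rcases s with _ | s <;> simp
  | succ r ih =>
    rw [complexHermite_succ_left, ih, ih]
    rcases s with _ | s
    · simp
    · simp only [Nat.add_sub_cancel, Nat.add_right_cancel_iff, zero_mul]
      by_cases h : r = s
      · subst h; simp only [if_true]; rw [Nat.factorial_succ]; push_cast; ring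
      · simp [h]

lemma integral_oscPlane (r s : ℕ) : ∫ u, oscPlane r s u = if r = s then 1 else 0 := by
  simp only [oscPlane_eq]
  rw [integral_const_mul]
  have h := gaussMoment_hermitePoly (1 / 2) (by norm_num) 0 0 1 r s
  unfold gaussMoment at h
  rw [h]
  simp only [zero_div, complexHermite_zero_zero]
  split_ifs with hrs
  · subst hrs
    have := oscNorm_self r
    norm_num
    linear_combination this
  · simp

lemma complexHermite_neg_one_neg (x y : ℂ) (r s : ℕ) :
    complexHermite (-1) x (-y) r s = (-1) ^ s * complexHermite 1 x y r s := by
  have := complexHermite_scale (1 : ℂ) x y 1 (-1) r s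
  simpa using this

/-- At rate 1/2 the shift is κ - 1/c = 1 - 2 = -1, which is undone by a change of sign of one
argument. Hence the symplectic Fourier transform of an eigentransition is, up to a factor, the same
eigentransition at z - u. -/
lemma symplecticFourier_oscPlane (t v : ℕ) (z u : ℝ × ℝ) :
    ∫ z₂, oscPlane t v z₂ * (symplecticPhase z z₂ * symplecticPhase z₂ u) =
      oscNorm t v * (Real.pi * (-1) ^ v) *
        Complex.exp (-((wcoord z - wcoord u) * (wconj z - wconj u) / 2)) *
        complexHermite 1 (wcoord z - wcoord u) (wconj z - wconj u) t v := by
  have e : ∀ z₂, oscPlane t v z₂ * (symplecticPhase z z₂ * symplecticPhase z₂ u) =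
      oscNorm t v * (evalW z₂ (hermitePoly 1 t v) *
        gaussW (1 / 2) (-(wconj z - wconj u) / 2) ((wcoord z - wcoord u) / 2) z₂) := by
    intro z₂
    rw [oscPlane_eq, symplecticPhase_eq, symplecticPhase_eq, mul_assoc, mul_assoc]
    congr 2
    rw [gaussW, gaussW, ← Complex.exp_add, ← Complex.exp_add]
    congr 1
    push_cast
    ring
  simp only [e]
  rw [integral_const_mul]
  have h := gaussMoment_hermitePoly (1 / 2) (by norm_num) (-(wconj z - wconj u) / 2)
    ((wcoord z - wcoord u) / 2) 1 t v
  unfold gaussMoment at h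
  rw [h]
  have e1 : (1 : ℂ) - 1 / ((1 / 2 : ℝ) : ℂ) = -1 := by norm_num
  have e2 : (wcoord z - wcoord u) / 2 / ((1 / 2 : ℝ) : ℂ) = wcoord z - wcoord u := by
    push_cast; field_simp
  have e3 : -(wconj z - wconj u) / 2 / ((1 / 2 : ℝ) : ℂ) = -(wconj z - wconj u) := by
    push_cast; field_simp
  rw [e1, e2, e3, complexHermite_neg_one_neg]
  have e4 : -(wconj z - wconj u) / 2 * ((wcoord z - wcoord u) / 2) / ((1 / 2 : ℝ) : ℂ) =
      -((wcoord z - wcoord u) * (wconj z - wconj u) / 2) := by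
    push_cast; field_simp
  rw [e4]
  push_cast
  ring

/-- After the inner transform all exponents add up to -w w̄ + w_u w̄ plus a constant. This is
exactly the weight of rate 1 with a = 0, for which `gaussMoment_pair` is an orthogonality relation.
-/
theorem twistedPlane_oscPlane (r s t v : ℕ) (u : ℝ × ℝ) :
    2 * Real.pi * twistedPlane (oscPlane r s) (oscPlane t v) u =
      if s = t then oscPlane r v u else 0 := by
  rw [twistedPlane_eq_left (integrable_oscPlane r s) (integrable_oscPlane t v)]
  have e : ∀ z₁, oscPlane r s z₁ * symplecticPhase u z₁ *
      ∫ z₂, oscPlane t v z₂ * (symplecticPhase z₁ z₂ * symplecticPhase z₂ u) =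
      (oscNorm r s * oscNorm t v * (Real.pi * (-1) ^ v) *
        Complex.exp (-(wcoord u * wconj u / 2))) *
      (evalW z₁ (hermitePoly 1 r s * shiftedHermitePoly (wcoord u) (wconj u) t v) *
        gaussW 1 0 (wcoord u) z₁) := by
    intro z₁
    rw [symplecticFourier_oscPlane, oscPlane_eq, symplecticPhase_eq, map_mul,
      evalW_shiftedHermitePoly]
    have : gaussW (1 / 2) 0 0 z₁ *
        Complex.exp ((wconj z₁ * wcoord u - wcoord z₁ * wconj u) / 2) *
        Complex.exp (-((wcoord z₁ - wcoord u) * (wconj z₁ - wconj u) / 2)) =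
        Complex.exp (-(wcoord u * wconj u / 2)) * gaussW 1 0 (wcoord u) z₁ := by
      rw [gaussW, gaussW, ← Complex.exp_add, ← Complex.exp_add, ← Complex.exp_add]
      congr 1
      push_cast
      ring
    linear_combination (oscNorm r s * evalW z₁ (hermitePoly 1 r s) * (oscNorm t v *
      (Real.pi * (-1) ^ v)) *
      complexHermite 1 (wcoord z₁ - wcoord u) (wconj z₁ - wconj u) t v) * this
  simp only [e]
  rw [integral_const_mul]
  have h := gaussMoment_pair (wcoord u) (wconj u) r s t v
  unfold gaussMoment at h
  rw [h]
  split_ifs with hst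
  · subst hst
    rw [oscPlane_eq, evalW_hermitePoly, gaussW]
    have hπ : (Real.pi : ℂ) ≠ 0 := by exact_mod_cast Real.pi_ne_zero
    have h1 := oscNorm_mul r s v
    have h2 : ((-1 : ℂ) ^ v) * (-1) ^ v = 1 := by rw [← mul_pow]; simp
    have h3 : -(((1 / 2 : ℝ) : ℂ) * (wcoord u * wconj u)) + 0 * wcoord u + 0 * wconj u =
        -(wcoord u * wconj u / 2) := by push_cast; ring
    rw [h3]
    generalize Complex.exp (-(wcoord u * wconj u / 2)) = E
    push_cast
    field_simp
    rw [eq_div_iff hπ] at h1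
    linear_combination (oscNorm r s * oscNorm s v * E * s.factorial * Real.pi *
      complexHermite 1 (wcoord u) (wconj u) r v) * h2 +
      E * complexHermite 1 (wcoord u) (wconj u) r v * h1
  · simp

/-- The thermal Gaussian `(λ/π) exp (-λ U²)`. -/
def thermalPlane (l : ℝ) (u : ℝ × ℝ) : ℂ := (l / Real.pi : ℝ) * gaussW (l / 2) 0 0 u

lemma integrable_thermalPlane (l : ℝ) (hl : 0 < l) : Integrable (thermalPlane l) := by
  have := integrable_evalW_mul_gaussW (l / 2) (by positivity) 0 0 1
  simp only [map_one, one_mul] at this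
  exact this.const_mul _

/-- The Gaussian kernel left after the inner integral replaces κ = 1 by x and the arguments (w, w̄)
by (xw, w̄). Homogeneity then returns H_rs itself with the factor x^r. -/
theorem twistedPlane_thermalPlane (l x : ℝ) (hl : 0 < l) (hx : x = (1 - l) / (1 + l))
    (r s : ℕ) (u : ℝ × ℝ) :
    2 * Real.pi * twistedPlane (thermalPlane l) (oscPlane r s) u =
      ((1 - x) * x ^ r : ℝ) * oscPlane r s u := by
  rw [twistedPlane_eq_right (integrable_thermalPlane l hl) (integrable_oscPlane r s)]
  have hl' : (l : ℂ) ≠ 0 := by exact_mod_cast hl.ne'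
  have hl1 : (1 + l : ℂ) ≠ 0 := by exact_mod_cast (by positivity : (1 + l : ℝ) ≠ 0)
  have hl2 : (l + 1 : ℂ) ≠ 0 := by rwa [add_comm]
  have hπ : (Real.pi : ℂ) ≠ 0 := by exact_mod_cast Real.pi_ne_zero
  have inner : ∀ z₂, ∫ z₁, thermalPlane l z₁ * (symplecticPhase u z₁ * symplecticPhase z₁ z₂) =
      Complex.exp (-((wcoord u - wcoord z₂) * (wconj u - wconj z₂) / (2 * l))) := by
    intro z₂
    have e : ∀ z₁, thermalPlane l z₁ * (symplecticPhase u z₁ * symplecticPhase z₁ z₂) =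
        (l / Real.pi : ℝ) * gaussW (l / 2) (-(wconj u - wconj z₂) / 2)
          ((wcoord u - wcoord z₂) / 2) z₁ := by
      intro z₁
      rw [thermalPlane, symplecticPhase_eq, symplecticPhase_eq, mul_assoc]
      congr 1
      rw [gaussW, gaussW, ← Complex.exp_add, ← Complex.exp_add]
      congr 1
      push_cast
      ring
    simp only [e]
    rw [integral_const_mul, integral_gaussW _ (by positivity)]
    push_cast
    have e1 : -(wconj u - wconj z₂) / 2 * ((wcoord u - wcoord z₂) / 2) / ((l : ℂ) / 2) =
      -((wcoord u - wcoord z₂) * (wconj u - wconj z₂) / (2 * l)) := by field_simp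
    rw [e1]
    field_simp
  -- The rate 1/2 of the eigentransition plus the rate 1/(2l) of the transformed thermal Gaussian.
  set c : ℝ := (1 + 1 / l) / 2 with hc
  have hc0 : 0 < c := by positivity
  have e : ∀ z₂, oscPlane r s z₂ * symplecticPhase z₂ u *
      ∫ z₁, thermalPlane l z₁ * (symplecticPhase u z₁ * symplecticPhase z₁ z₂) =
      (oscNorm r s * Complex.exp (-(wcoord u * wconj u / (2 * l)))) *
      (evalW z₂ (hermitePoly 1 r s) *
        gaussW c ((1 + 1 / l) / 2 * wconj u) ((1 / l - 1) / 2 * wcoord u) z₂) := by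
    intro z₂
    rw [inner, oscPlane_eq, symplecticPhase_eq]
    have : gaussW (1 / 2) 0 0 z₂ *
        Complex.exp ((wconj u * wcoord z₂ - wcoord u * wconj z₂) / 2) *
        Complex.exp (-((wcoord u - wcoord z₂) * (wconj u - wconj z₂) / (2 * l))) =
        Complex.exp (-(wcoord u * wconj u / (2 * l))) *
        gaussW c ((1 + 1 / l) / 2 * wconj u) ((1 / l - 1) / 2 * wcoord u) z₂ := by
      rw [gaussW, gaussW, ← Complex.exp_add, ← Complex.exp_add, ← Complex.exp_add]
      congr 1
      rw [hc]
      push_cast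
      field_simp
      ring
    linear_combination (oscNorm r s * evalW z₂ (hermitePoly 1 r s)) * this
  simp only [e]
  rw [integral_const_mul]
  have h := gaussMoment_hermitePoly c hc0 ((1 + 1 / l) / 2 * wconj u)
    ((1 / l - 1) / 2 * wcoord u) 1 r s
  unfold gaussMoment at h
  rw [h]
  have hcC : (c : ℂ) = (1 + 1 / l) / 2 := by rw [hc]; push_cast; ring
  have hxC : (x : ℂ) = (1 - l) / (1 + l) := by rw [hx]; push_cast; ring
  -- Written in the shape a * b * κ of `complexHermite_scale`, with a = x and b = κ = 1.
  have e1 : (1 : ℂ) - 1 / c = x * 1 * 1 := by rw [hcC, hxC]; field_simp; ring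
  have e2 : ((1 / l - 1) / 2 * wcoord u) / (c : ℂ) = x * wcoord u := by
    rw [hcC, hxC]; field_simp; ring
  have e3 : ((1 + 1 / l) / 2 * wconj u) / (c : ℂ) = 1 * wconj u := by
    rw [hcC]; field_simp
  rw [e1, e2, e3, complexHermite_scale, oscPlane_eq, evalW_hermitePoly]
  have e4 : Complex.exp (-(wcoord u * wconj u / (2 * l))) *
      Complex.exp ((1 + 1 / l) / 2 * wconj u * ((1 / l - 1) / 2 * wcoord u) / c) =
      gaussW (1 / 2) 0 0 u := by
    rw [gaussW, ← Complex.exp_add, hcC]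
    congr 1
    push_cast
    field_simp
    ring
  rw [← e4]
  have e5 : (Real.pi / (2 * c) : ℂ) = Real.pi * (1 - x) / 2 := by
    rw [hcC, hxC]; field_simp; ring
  rw [e5]
  push_cast
  field_simp
  ring

/-! ### Generating function of the complex Hermite polynomials -/

lemma hasSum_of_eq {ι E : Type*} [AddCommMonoid E] [TopologicalSpace E] {f g : ι → E} {a b : E}
    (h : HasSum f a) (hf : ∀ i, g i = f i) (ha : b = a) : HasSum g b := by
  rw [ha, funext hf]
  exact h

section generating

variable {𝕜 : Type*} [RCLike 𝕜] (κ x y : 𝕜)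

/-- Induction on s through the recursion in s: the weight r lowers the factorial, so that series is
α times the previous one, shifted by one index whose missing term is zero. -/
lemma hasSum_complexHermite_left (α : 𝕜) (s : ℕ) :
    HasSum (fun r : ℕ => α ^ r / r.factorial * complexHermite κ x y r s)
      (NormedSpace.exp (α * x) * (y - κ * α) ^ s) := by
  induction s with
  | zero =>
    have h := NormedSpace.expSeries_div_hasSum_exp (α * x)
    simp only [complexHermite_zero_right, pow_zero, mul_one]
    exact hasSum_of_eq h (fun r => by rw [mul_pow]; ring) rfl
  | succ s ih =>
    have h1 : HasSum (fun r : ℕ => α ^ r / r.factorial * (r * complexHermite κ x y (r - 1) s))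
        (α * (NormedSpace.exp (α * x) * (y - κ * α) ^ s)) := by
      rw [← hasSum_nat_add_iff' 1]
      simp only [Finset.range_one, Finset.sum_singleton, Nat.cast_zero, zero_mul, mul_zero,
        sub_zero, Nat.add_sub_cancel]
      refine hasSum_of_eq (ih.mul_left α) (fun r => ?_) rfl
      have : (r.factorial : 𝕜) ≠ 0 := by exact_mod_cast r.factorial_ne_zero
      have : (r + 1 : 𝕜) ≠ 0 := by exact_mod_cast r.succ_ne_zero
      rw [Nat.factorial_succ]
      push_cast
      field_simp
      ring
    have h2 := (ih.mul_left y).sub (h1.mul_left κ)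
    exact hasSum_of_eq h2 (fun r => by rw [complexHermite_succ_right]; ring) (by ring)

lemma hasSum_complexHermite_right (β : 𝕜) (r : ℕ) :
    HasSum (fun s : ℕ => β ^ s / s.factorial * complexHermite κ x y r s)
      (NormedSpace.exp (β * y) * (x - κ * β) ^ r) := by
  simp only [complexHermite_swap κ x y r]
  exact hasSum_complexHermite_left κ y x β r

/-- With the parameter -‖κ‖ all coefficients become nonnegative, so the same family of polynomials
serves as its own majorant. -/
lemma norm_complexHermite_le (r s : ℕ) :
    ‖complexHermite κ x y r s‖ ≤ complexHermite (-‖κ‖) ‖x‖ ‖y‖ r s := by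
  induction r generalizing s with
  | zero => simp
  | succ r ih =>
    rw [complexHermite_succ_left, complexHermite_succ_left]
    refine (norm_sub_le _ _).trans ?_
    rw [neg_mul, neg_mul, sub_neg_eq_add, norm_mul, norm_mul, norm_mul, RCLike.norm_natCast]
    gcongr
    · exact ih s
    · exact ih (s - 1)

lemma hasSum_complexHermite_of_summable (α β : 𝕜) (h : Summable fun p : ℕ × ℕ =>
      α ^ p.1 / p.1.factorial * (β ^ p.2 / p.2.factorial * complexHermite κ x y p.1 p.2)) :
    HasSum (fun p : ℕ × ℕ =>
      α ^ p.1 / p.1.factorial * (β ^ p.2 / p.2.factorial * complexHermite κ x y p.1 p.2))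
      (NormedSpace.exp (β * y) * NormedSpace.exp (α * (x - κ * β))) := by
  have h1 := h.hasSum.prod_fiberwise fun r =>
    (hasSum_complexHermite_right κ x y β r).mul_left (α ^ r / (r.factorial : 𝕜))
  have h2 := (NormedSpace.expSeries_div_hasSum_exp (α * (x - κ * β))).mul_left
    (NormedSpace.exp (β * y))
  have h3 := h1.unique (hasSum_of_eq h2 (fun r => by rw [mul_pow]; ring) rfl)
  rw [← h3]
  exact h.hasSum

end generating

lemma complexHermite_nonneg {k x y : ℝ} (hk : 0 ≤ k) (hx : 0 ≤ x) (hy : 0 ≤ y) (r s : ℕ) :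
    0 ≤ complexHermite (-k) x y r s := by
  induction r generalizing s with
  | zero => simp; positivity
  | succ r ih =>
    rw [complexHermite_succ_left, neg_mul, neg_mul, sub_neg_eq_add]
    have := ih s
    have := ih (s - 1)
    positivity

/-- Nonnegative terms make iterated summability sufficient for double summability. This provides the
majorant for the complex generating function and for dominated convergence in Mehler's formula. -/
lemma hasSum_complexHermite_real {k x y α β : ℝ} (hk : 0 ≤ k) (hx : 0 ≤ x) (hy : 0 ≤ y)
    (hα : 0 ≤ α) (hβ : 0 ≤ β) :
    HasSum (fun p : ℕ × ℕ =>
      α ^ p.1 / p.1.factorial * (β ^ p.2 / p.2.factorial * complexHermite (-k) x y p.1 p.2))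
      (Real.exp (α * x + β * y + k * α * β)) := by
  have h : Summable fun p : ℕ × ℕ =>
      α ^ p.1 / p.1.factorial * (β ^ p.2 / p.2.factorial * complexHermite (-k) x y p.1 p.2) := by
    rw [summable_prod_of_nonneg]
    · have h1 := fun r : ℕ => (hasSum_complexHermite_right (-k) x y β r).mul_left
        (α ^ r / (r.factorial : ℝ))
      refine ⟨fun r => (h1 r).summable, ?_⟩
      simp only [fun r => (h1 r).tsum_eq]
      refine ((NormedSpace.expSeries_div_hasSum_exp (α * (x - -k * β))).mul_left
        (NormedSpace.exp (β * y))).summable.congr fun r => ?_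
      rw [mul_pow]; ring
    · intro p
      have := complexHermite_nonneg hk hx hy p.1 p.2
      simp only [Pi.zero_apply]
      positivity
  have h1 := hasSum_complexHermite_of_summable (-k) x y α β h
  rw [← Real.exp_eq_exp_ℝ, ← Real.exp_add] at h1
  exact hasSum_of_eq h1 (fun _ => rfl) (by ring_nf)

lemma norm_complexHermite_term_le (κ x y α β : ℂ) (p : ℕ × ℕ) :
    ‖α ^ p.1 / p.1.factorial * (β ^ p.2 / p.2.factorial * complexHermite κ x y p.1 p.2)‖ ≤
      ‖α‖ ^ p.1 / p.1.factorial *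
        (‖β‖ ^ p.2 / p.2.factorial * complexHermite (-‖κ‖) ‖x‖ ‖y‖ p.1 p.2) := by
  rw [norm_mul, norm_mul, norm_div, norm_div, norm_pow, norm_pow, Complex.norm_natCast,
    Complex.norm_natCast]
  gcongr
  exact norm_complexHermite_le κ x y p.1 p.2

lemma hasSum_complexHermite (κ x y α β : ℂ) :
    HasSum (fun p : ℕ × ℕ =>
      α ^ p.1 / p.1.factorial * (β ^ p.2 / p.2.factorial * complexHermite κ x y p.1 p.2))
      (Complex.exp (α * x + β * y - κ * α * β)) := by
  have h := Summable.of_norm_bounded (hasSum_complexHermite_real (norm_nonneg κ) (norm_nonneg x)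
    (norm_nonneg y) (norm_nonneg α) (norm_nonneg β)).summable
    (norm_complexHermite_term_le κ x y α β)
  have h1 := hasSum_complexHermite_of_summable κ x y α β h
  rw [← Complex.exp_eq_exp_ℂ, ← Complex.exp_add] at h1
  exact hasSum_of_eq h1 (fun _ => rfl) (by ring_nf)

/-! ### Gaussian representation and Mehler sums -/

lemma norm_gaussW_le_exp (c : ℝ) (a b : ℂ) (u : ℝ × ℝ) :
    ‖gaussW c a b u‖ ≤ Real.exp ((‖a‖ + ‖b‖) * ‖wcoord u‖ - c * ‖wcoord u‖ ^ 2) := by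
  rw [gaussW, Complex.norm_exp]
  refine Real.exp_le_exp.2 ?_
  have h1 : (a * wcoord u + b * wconj u).re ≤ (‖a‖ + ‖b‖) * ‖wcoord u‖ := by
    refine (Complex.re_le_norm _).trans ((norm_add_le _ _).trans ?_)
    rw [norm_mul, norm_mul, norm_wconj, add_mul]
  have h3 : (-((c : ℂ) * (wcoord u * wconj u)) + a * wcoord u + b * wconj u).re =
      -(c * ‖wcoord u‖ ^ 2) + (a * wcoord u + b * wconj u).re := by
    rw [add_assoc, Complex.add_re, wcoord_mul_wconj, norm_wcoord_sq, ← Complex.ofReal_mul,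
      Complex.neg_re, Complex.ofReal_re]
  rw [h3]
  linarith

lemma integrable_exp_mul_norm_sub (M c : ℝ) (hc : 0 < c) :
    Integrable fun u : ℝ × ℝ => Real.exp (M * ‖wcoord u‖ - c * ‖wcoord u‖ ^ 2) := by
  refine ((integrable_exp_neg_norm_wcoord_sq (c / 2) (by positivity)).const_mul
    (Real.exp (M ^ 2 / (2 * c)))).mono' (Continuous.aestronglyMeasurable ?_)
    (Filter.Eventually.of_forall fun u => ?_)
  · have := continuous_wcoord
    fun_prop
  · rw [Real.norm_eq_abs, abs_of_pos (Real.exp_pos _), ← Real.exp_add]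
    refine Real.exp_le_exp.2 ?_
    have : M ^ 2 / (2 * c) + c / 2 * ‖wcoord u‖ ^ 2 - M * ‖wcoord u‖ =
        (M - c * ‖wcoord u‖) ^ 2 / (2 * c) := by field_simp; ring
    have : 0 ≤ (M - c * ‖wcoord u‖) ^ 2 / (2 * c) := by positivity
    linarith

/-- The complex Hermite polynomials as Gaussian moments. -/
lemma complexHermite_eq_integral (x y : ℂ) (r s : ℕ) :
    complexHermite 1 x y r s = 2 / Real.pi * Complex.exp (x * y) *
      ∫ z, (Complex.I * wcoord z) ^ r * (Complex.I * wconj z) ^ s *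
        gaussW 1 (-Complex.I * y) (-Complex.I * x) z := by
  have h := gaussMoment_hermitePoly 1 one_pos (-Complex.I * y) (-Complex.I * x) 0 r s
  have e : ∀ z, (Complex.I * wcoord z) ^ r * (Complex.I * wconj z) ^ s *
        gaussW 1 (-Complex.I * y) (-Complex.I * x) z = (Complex.I ^ r * Complex.I ^ s) *
        (evalW z (hermitePoly 0 r s) * gaussW 1 (-Complex.I * y) (-Complex.I * x) z) := by
    intro z
    rw [evalW_hermitePoly, complexHermite_kappa_zero]
    ring
  simp only [e]
  rw [integral_const_mul]
  unfold gaussMoment at h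
  rw [h]
  have e1 : (0 : ℂ) - 1 / ((1 : ℝ) : ℂ) = -Complex.I * -Complex.I * 1 := by
    simp
  have e2 : ∀ v : ℂ, -Complex.I * v / ((1 : ℝ) : ℂ) = -Complex.I * v := fun v => by simp
  rw [e1, e2, e2, complexHermite_scale]
  have e3 : -Complex.I * y * (-Complex.I * x) / ((1 : ℝ) : ℂ) = -(x * y) := by
    simp; linear_combination (x * y) * Complex.I_sq
  have e4 : (Complex.I ^ r) * (-Complex.I) ^ r = 1 := by
    rw [← mul_pow]; simp
  have e5 : (Complex.I ^ s) * (-Complex.I) ^ s = 1 := by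
    rw [← mul_pow]; simp
  have hπ : (Real.pi : ℂ) ≠ 0 := by exact_mod_cast Real.pi_ne_zero
  have e6 : Complex.exp (x * y) * Complex.exp (-(x * y)) = 1 := by
    rw [← Complex.exp_add]; simp
  rw [e3]
  generalize Complex.exp (x * y) = E at *
  generalize Complex.exp (-(x * y)) = E' at *
  push_cast
  field_simp
  linear_combination (-complexHermite 1 x y r s) * (e6 + E * E' * e4 +
    E * E' * (Complex.I ^ r) * (-Complex.I) ^ r * e5)

/-- Writing H_rr as the Gaussian integral of (iw · iw̄)^r leaves an exponential series under the
integral, which changes the rate from 1 to 1 + x. The majorant loses the sign i² = -1 and has rate 1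
- x, whence x < 1. -/
theorem hasSum_complexHermite_diag (x : ℝ) (hx0 : 0 ≤ x) (hx1 : x < 1) (z w : ℂ) :
    HasSum (fun r : ℕ => (x : ℂ) ^ r / r.factorial * complexHermite 1 z w r r)
      (1 / (1 + x) * Complex.exp (x * (z * w) / (1 + x))) := by
  have hx' : (1 + x : ℂ) ≠ 0 := by exact_mod_cast (by positivity : (1 + x : ℝ) ≠ 0)
  set a := -Complex.I * w with ha
  set b := -Complex.I * z with hb
  have key := hasSum_integral_of_dominated_convergence (μ := (volume : Measure (ℝ × ℝ)))
    (F := fun (r : ℕ) u => ((x : ℂ) * ((Complex.I * wcoord u) * (Complex.I * wconj u))) ^ r /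
      r.factorial * gaussW 1 a b u)
    (f := fun u => gaussW (1 + x) a b u)
    (fun r u => (x * ‖wcoord u‖ ^ 2) ^ r / r.factorial * ‖gaussW 1 a b u‖)
    (fun r => by
      have := continuous_wcoord
      have := continuous_wconj
      have := continuous_gaussW 1 a b
      exact Continuous.aestronglyMeasurable (by fun_prop))
    (fun r => Filter.Eventually.of_forall fun u => by
      rw [norm_mul, norm_div, norm_pow, norm_mul, norm_mul, norm_mul, norm_mul, Complex.norm_I,
        norm_wconj, one_mul, Complex.norm_natCast, Complex.norm_real, Real.norm_of_nonneg hx0,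
        sq])
    (Filter.Eventually.of_forall fun u =>
      ((NormedSpace.expSeries_div_hasSum_exp (x * ‖wcoord u‖ ^ 2)).summable.mul_right _))
    (by
      have e : ∀ u, ∑' r : ℕ, (x * ‖wcoord u‖ ^ 2) ^ r / r.factorial * ‖gaussW 1 a b u‖ =
          Real.exp (x * ‖wcoord u‖ ^ 2) * ‖gaussW 1 a b u‖ := by
        intro u
        rw [Real.exp_eq_exp_ℝ]
        exact ((NormedSpace.expSeries_div_hasSum_exp (x * ‖wcoord u‖ ^ 2)).mul_right _).tsum_eq
      simp only [e]
      refine (integrable_exp_mul_norm_sub (‖a‖ + ‖b‖) (1 - x) (by linarith)).mono'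
        (Continuous.aestronglyMeasurable ?_) (Filter.Eventually.of_forall fun u => ?_)
      · have := continuous_wcoord
        have := continuous_gaussW 1 a b
        fun_prop
      · rw [norm_mul, norm_norm, Real.norm_eq_abs, abs_of_pos (Real.exp_pos _)]
        refine (mul_le_mul_of_nonneg_left (norm_gaussW_le_exp 1 a b u)
          (Real.exp_pos _).le).trans (le_of_eq ?_)
        rw [← Real.exp_add]
        ring_nf)
    (Filter.Eventually.of_forall fun u => by
      have h := (NormedSpace.expSeries_div_hasSum_exp
        ((x : ℂ) * ((Complex.I * wcoord u) * (Complex.I * wconj u)))).mul_right (gaussW 1 a b u)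
      rw [← Complex.exp_eq_exp_ℂ] at h
      refine hasSum_of_eq h (fun _ => rfl) ?_
      rw [gaussW, gaussW, ← Complex.exp_add]
      congr 1
      push_cast
      linear_combination (-(x : ℂ) * wcoord u * wconj u) * Complex.I_sq)
  have key2 := key.mul_left (2 / Real.pi * Complex.exp (z * w))
  refine hasSum_of_eq key2 (fun r => ?_) ?_
  · rw [complexHermite_eq_integral, mul_left_comm, ← integral_const_mul]
    congr 2
    funext u
    rw [mul_pow, mul_pow]
    ring
  · rw [integral_gaussW _ (by positivity)]
    have hπ : (Real.pi : ℂ) ≠ 0 := by exact_mod_cast Real.pi_ne_zero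
    have e1 : a * b / ((1 + x : ℝ) : ℂ) = x * (z * w) / (1 + x) - z * w := by
      rw [ha, hb]
      push_cast
      field_simp
      linear_combination (w * z) * Complex.I_sq
    rw [e1, Complex.exp_sub]
    have := Complex.exp_ne_zero (z * w)
    push_cast
    field_simp

/-- Mehler's formula for the complex Hermite polynomials. -/
theorem hasSum_complexHermite_mehler (t : ℝ) (ht : t ^ 2 < 1) (z₁ w₁ z₂ w₂ : ℂ) :
    HasSum (fun p : ℕ × ℕ => (t : ℂ) ^ p.1 / p.1.factorial * ((t : ℂ) ^ p.2 / p.2.factorial *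
        (complexHermite 1 z₁ w₁ p.1 p.2 * complexHermite 1 z₂ w₂ p.1 p.2)))
      (1 / (1 - t ^ 2) * Complex.exp (z₁ * w₁ -
        (w₁ - t * z₂) * (z₁ - t * w₂) / (1 - t ^ 2))) := by
  have ht' : (1 - t ^ 2 : ℂ) ≠ 0 := by exact_mod_cast (by linarith : (0 : ℝ) < 1 - t ^ 2).ne'
  set a := -Complex.I * w₁ with ha
  set b := -Complex.I * z₁ with hb
  have hreal := fun u : ℝ × ℝ => hasSum_complexHermite_real (norm_nonneg (1 : ℂ))
    (norm_nonneg z₂) (norm_nonneg w₂) (norm_nonneg ((t : ℂ) * (Complex.I * wcoord u)))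
    (norm_nonneg ((t : ℂ) * (Complex.I * wconj u)))
  -- Only one Hermite factor is replaced by its Gaussian integral. The double series of the other is
  -- then its generating function at α = t·iw, β = t·iw̄, where -αβ = t² w w̄ lowers the rate to 1 -
  -- t².
  have key := hasSum_integral_of_dominated_convergence (μ := (volume : Measure (ℝ × ℝ)))
    (F := fun (p : ℕ × ℕ) u => ((t : ℂ) * (Complex.I * wcoord u)) ^ p.1 / p.1.factorial *
      (((t : ℂ) * (Complex.I * wconj u)) ^ p.2 / p.2.factorial *
        complexHermite 1 z₂ w₂ p.1 p.2) * gaussW 1 a b u)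
    (f := fun u => gaussW (1 - t ^ 2) (-Complex.I * (w₁ - t * z₂)) (-Complex.I * (z₁ - t * w₂)) u)
    (fun p u => ‖(t : ℂ) * (Complex.I * wcoord u)‖ ^ p.1 / p.1.factorial *
        (‖(t : ℂ) * (Complex.I * wconj u)‖ ^ p.2 / p.2.factorial *
          complexHermite (-‖(1 : ℂ)‖) ‖z₂‖ ‖w₂‖ p.1 p.2) * ‖gaussW 1 a b u‖)
    (fun r => by
      have := continuous_wcoord
      have := continuous_wconj
      have := continuous_gaussW 1 a b
      exact Continuous.aestronglyMeasurable (by fun_prop))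
    (fun p => Filter.Eventually.of_forall fun u => by
      rw [norm_mul]
      exact mul_le_mul_of_nonneg_right (norm_complexHermite_term_le 1 z₂ w₂ _ _ p)
        (norm_nonneg _))
    (Filter.Eventually.of_forall fun u => (hreal u).summable.mul_right _)
    (by
      simp only [fun u => ((hreal u).mul_right (‖gaussW 1 a b u‖)).tsum_eq]
      refine (integrable_exp_mul_norm_sub (|t| * (‖z₂‖ + ‖w₂‖) + (‖a‖ + ‖b‖)) (1 - t ^ 2)
        (by linarith)).mono'
        (Continuous.aestronglyMeasurable ?_) (Filter.Eventually.of_forall fun u => ?_)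
      · have := continuous_wcoord
        have := continuous_wconj
        have := continuous_gaussW 1 a b
        fun_prop
      · rw [norm_mul, norm_norm, Real.norm_eq_abs, abs_of_pos (Real.exp_pos _)]
        refine (mul_le_mul_of_nonneg_left (norm_gaussW_le_exp 1 a b u)
          (Real.exp_pos _).le).trans (le_of_eq ?_)
        rw [← Real.exp_add]
        simp only [norm_mul, Complex.norm_I, norm_wconj, Complex.norm_real, Real.norm_eq_abs,
          norm_one, ← sq_abs t]
        ring_nf)
    (Filter.Eventually.of_forall fun u => by
      have h := (hasSum_complexHermite 1 z₂ w₂ ((t : ℂ) * (Complex.I * wcoord u))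
        ((t : ℂ) * (Complex.I * wconj u))).mul_right (gaussW 1 a b u)
      refine hasSum_of_eq h (fun _ => rfl) ?_
      rw [gaussW, gaussW, ← Complex.exp_add]
      congr 1
      rw [ha, hb]
      push_cast
      linear_combination ((t : ℂ) ^ 2 * wcoord u * wconj u) * Complex.I_sq)
  have key2 := key.mul_left (2 / Real.pi * Complex.exp (z₁ * w₁))
  refine hasSum_of_eq key2 (fun p => ?_) ?_
  · rw [complexHermite_eq_integral z₁ w₁, ← integral_const_mul, ← integral_const_mul,
      mul_comm (∫ z, _), ← integral_const_mul, ← integral_const_mul, ← integral_const_mul]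
    congr 1
    funext u
    rw [mul_pow, mul_pow (t : ℂ)]
    ring
  · rw [integral_gaussW _ (by linarith)]
    have hπ : (Real.pi : ℂ) ≠ 0 := by exact_mod_cast Real.pi_ne_zero
    have e1 : -Complex.I * (w₁ - t * z₂) * (-Complex.I * (z₁ - t * w₂)) /
        ((1 - t ^ 2 : ℝ) : ℂ) = -((w₁ - t * z₂) * (z₁ - t * w₂) / (1 - t ^ 2)) := by
      push_cast
      field_simp
      linear_combination ((w₁ - t * z₂) * (z₁ - t * w₂)) * Complex.I_sq
    rw [e1, sub_eq_add_neg (z₁ * w₁), Complex.exp_add]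
    push_cast
    field_simp

/-! ### Series of eigentransitions in one degree of freedom -/

lemma oscNorm_sq (r s : ℕ) :
    oscNorm r s * oscNorm r s = 1 / Real.pi ^ 2 / (r.factorial * s.factorial) := by
  unfold oscNorm
  rw [← Complex.ofReal_mul, div_mul_div_comm, Real.mul_self_sqrt (by positivity)]
  push_cast
  ring

/-- The rates combine as 1/2 - x/(1+x) = l/2. The bound l ≤ 1 is what makes x nonnegative. -/
theorem hasSum_thermalPlane (l x : ℝ) (hl : 0 < l) (hl1 : l ≤ 1) (hx : x = (1 - l) / (1 + l))
    (u : ℝ × ℝ) : HasSum (fun r : ℕ => (((1 - x) * x ^ r : ℝ) : ℂ) * oscPlane r r u)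
      (thermalPlane l u) := by
  have hx0 : 0 ≤ x := by rw [hx]; exact div_nonneg (by linarith) (by linarith)
  have hx1 : x < 1 := by rw [hx, div_lt_one (by linarith)]; linarith
  have hl' : (l : ℂ) ≠ 0 := by exact_mod_cast hl.ne'
  have hl2 : (l + 1 : ℂ) ≠ 0 := by exact_mod_cast (by positivity : (l + 1 : ℝ) ≠ 0)
  have hl3 : (1 + l : ℂ) ≠ 0 := by rwa [add_comm]
  have hπ : (Real.pi : ℂ) ≠ 0 := by exact_mod_cast Real.pi_ne_zero
  have hxC : (x : ℂ) = (1 - l) / (1 + l) := by rw [hx]; push_cast; ring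
  have h := (hasSum_complexHermite_diag x hx0 hx1 (wcoord u) (wconj u)).mul_left
    ((1 - x) / Real.pi * gaussW (1 / 2) 0 0 u)
  refine hasSum_of_eq h (fun r => ?_) ?_
  · rw [oscPlane_eq, evalW_hermitePoly]
    have hr : (r.factorial : ℂ) ≠ 0 := by exact_mod_cast r.factorial_ne_zero
    have h1 : oscNorm r r = 1 / Real.pi / r.factorial := by
      have := oscNorm_self r
      field_simp
      linear_combination this
    rw [h1]
    push_cast
    field_simp
  · have e1 : (1 + x : ℂ) = 2 / (1 + l) := by rw [hxC]; field_simp; ring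
    have e2 : (1 - x : ℂ) = 2 * l / (1 + l) := by rw [hxC]; field_simp; ring
    have e3 : gaussW (1 / 2) 0 0 u * Complex.exp (x * (wcoord u * wconj u) / (1 + x)) =
        gaussW (l / 2) 0 0 u := by
      rw [gaussW, gaussW, ← Complex.exp_add, e1, hxC]
      congr 1
      push_cast
      field_simp
      ring
    rw [thermalPlane, ← e3, e2, e1]
    push_cast
    field_simp

/-- The coefficients of the alternating sign rule in one degree of freedom. -/
def planeCoeff (x : ℝ) (r : ℕ) : ℝ := (-1) ^ r * √((1 - x) * x ^ r)

/-- The alternating signs turn the coefficients into a geometric sequence of ratio -√x, which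
becomes the parameter of Mehler's formula. -/
lemma planeCoeff_eq {x : ℝ} (hx0 : 0 ≤ x) (hx1 : x < 1) (r : ℕ) :
    planeCoeff x r = √(1 - x) * (-√x) ^ r := by
  have : √(x ^ r) = √x ^ r := by
    rw [← Real.sqrt_sq (pow_nonneg (Real.sqrt_nonneg x) r), ← pow_mul, mul_comm r, pow_mul,
      Real.sq_sqrt hx0]
  rw [planeCoeff, Real.sqrt_mul (by linarith), this, neg_pow (√x)]
  ring

theorem hasSum_slkPlane (x : ℝ) (hx0 : 0 ≤ x) (hx1 : x < 1) (u v : ℝ × ℝ) :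
    HasSum (fun p : ℕ × ℕ => (planeCoeff x p.1 : ℂ) * (planeCoeff x p.2 : ℂ) *
      oscPlane p.1 p.2 u * oscPlane p.1 p.2 v)
      ((1 / Real.pi ^ 2 * Real.exp (-((1 + x) * (u.1 ^ 2 + u.2 ^ 2 + v.1 ^ 2 + v.2 ^ 2) +
        4 * √x * (u.1 * v.1 - u.2 * v.2)) / (1 - x)) : ℝ) : ℂ) := by
  have hs : (-√x) ^ 2 = x := by rw [neg_sq, Real.sq_sqrt hx0]
  have hπ : (Real.pi : ℂ) ≠ 0 := by exact_mod_cast Real.pi_ne_zero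
  have hx' : (1 - x : ℂ) ≠ 0 := by exact_mod_cast (by linarith : (0 : ℝ) < 1 - x).ne'
  have h1x : ((√(1 - x) : ℝ) : ℂ) * ((√(1 - x) : ℝ) : ℂ) = 1 - x := by
    rw [← Complex.ofReal_mul, Real.mul_self_sqrt (by linarith)]; push_cast; ring
  have h := (hasSum_complexHermite_mehler (-√x) (by rw [hs]; exact hx1) (wcoord u) (wconj u)
    (wcoord v) (wconj v)).mul_left
      ((1 - x) / Real.pi ^ 2 * (gaussW (1 / 2) 0 0 u * gaussW (1 / 2) 0 0 v))
  have hsC : ((-√x : ℝ) : ℂ) ^ 2 = x := by exact_mod_cast congrArg (fun t : ℝ => (t : ℂ)) hs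
  refine hasSum_of_eq h (fun p => ?_) ?_
  · rw [planeCoeff_eq hx0 hx1, planeCoeff_eq hx0 hx1, oscPlane_eq, oscPlane_eq,
      evalW_hermitePoly, evalW_hermitePoly, Complex.ofReal_mul, Complex.ofReal_mul,
      Complex.ofReal_pow, Complex.ofReal_pow]
    have h2 := oscNorm_sq p.1 p.2
    have hr : (p.1.factorial : ℂ) ≠ 0 := by exact_mod_cast p.1.factorial_ne_zero
    have hs : (p.2.factorial : ℂ) ≠ 0 := by exact_mod_cast p.2.factorial_ne_zero
    generalize ((-√x : ℝ) : ℂ) = t at *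
    generalize oscNorm p.1 p.2 = N at *
    generalize ((√(1 - x) : ℝ) : ℂ) = S at *
    generalize gaussW (1 / 2) 0 0 u = g₁
    generalize gaussW (1 / 2) 0 0 v = g₂
    generalize complexHermite 1 (wcoord u) (wconj u) p.1 p.2 = H₁
    generalize complexHermite 1 (wcoord v) (wconj v) p.1 p.2 = H₂
    calc S * t ^ p.1 * (S * t ^ p.2) * (N * (H₁ * g₁)) * (N * (H₂ * g₂)) =
        (S * S) * (N * N) * (t ^ p.1 * t ^ p.2 * H₁ * g₁ * H₂ * g₂) := by ring
      _ = _ := by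
        rw [h1x, h2]
        field_simp
  · have e3 : gaussW (1 / 2) 0 0 u * gaussW (1 / 2) 0 0 v *
        Complex.exp (wcoord u * wconj u - (wconj u - (-√x : ℝ) * wcoord v) *
          (wcoord u - (-√x : ℝ) * wconj v) / (1 - (-√x : ℝ) ^ 2)) =
        Complex.exp ((-((1 + x) * (u.1 ^ 2 + u.2 ^ 2 + v.1 ^ 2 + v.2 ^ 2) +
          4 * √x * (u.1 * v.1 - u.2 * v.2)) / (1 - x) : ℝ) : ℂ) := by
      rw [gaussW, gaussW, ← Complex.exp_add, ← Complex.exp_add, hsC]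
      congr 1
      have hu := wcoord_mul_wconj u
      have hv := wcoord_mul_wconj v
      have huv : wcoord u * wcoord v + wconj u * wconj v = 4 * (u.1 * v.1 - u.2 * v.2) := by
        simp only [wcoord, wconj]
        linear_combination (2 * ((u.1 : ℂ) * v.1 + Complex.I ^ 2 * u.2 * v.2)) * sqrt_two_sq +
          4 * (u.2 : ℂ) * v.2 * Complex.I_sq
      push_cast at hu hv hsC ⊢
      rw [neg_sq] at hsC
      field_simp
      generalize ((√x : ℝ) : ℂ) = t at *
      rw [← hsC]
      linear_combination (-(1 + t ^ 2)) * hu + (-(1 + t ^ 2)) * hv - 2 * t * huv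
    rw [Complex.ofReal_mul, Complex.ofReal_exp, ← e3, hsC]
    push_cast
    field_simp

/-! ### Factorization over the axes -/

/-- The phase point of the `i`-th degree of freedom. -/
def coordAt {d : ℕ} (u : Phase d) (i : Fin d) : ℝ × ℝ := (u.1 i, u.2 i)

/-- The phase space as a product of phase planes. -/
def phaseEquiv (d : ℕ) : Phase d ≃ᵐ (Fin d → ℝ × ℝ) :=
  ((MeasurableEquiv.toLp 2 (Fin d → ℝ)).symm.prodCongr
    (MeasurableEquiv.toLp 2 (Fin d → ℝ)).symm).trans
    (MeasurableEquiv.arrowProdEquivProdArrow ℝ ℝ (Fin d)).symm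

lemma measurePreserving_phaseEquiv (d : ℕ) : MeasurePreserving (phaseEquiv d) := by
  have h := EuclideanSpace.volume_preserving_symm_measurableEquiv_toLp (Fin d)
  exact (volume_measurePreserving_arrowProdEquivProdArrow ℝ ℝ (Fin d)).symm.comp (h.prod h)

lemma integral_prod_coordAt {d : ℕ} (F : Fin d → ℝ × ℝ → ℂ) :
    ∫ u : Phase d, ∏ i, F i (coordAt u i) = ∏ i, ∫ x, F i x := by
  rw [← integral_fintype_prod_volume_eq_prod]
  exact (measurePreserving_phaseEquiv d).integral_comp' (fun y => ∏ i, F i (y i))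

lemma integral_prod_coordAt₂ {d : ℕ} (F : Fin d → (ℝ × ℝ) × (ℝ × ℝ) → ℂ) :
    ∫ z : Phase d × Phase d, ∏ i, F i (coordAt z.1 i, coordAt z.2 i) = ∏ i, ∫ x, F i x := by
  rw [← integral_fintype_prod_volume_eq_prod]
  have h := measurePreserving_phaseEquiv d
  have h2 : MeasurePreserving (((phaseEquiv d).prodCongr (phaseEquiv d)).trans
      (MeasurableEquiv.arrowProdEquivProdArrow (ℝ × ℝ) (ℝ × ℝ) (Fin d)).symm) :=
    (volume_measurePreserving_arrowProdEquivProdArrow (ℝ × ℝ) (ℝ × ℝ) (Fin d)).symm.comp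
      (h.prod h)
  exact h2.integral_comp' (fun y => ∏ i, F i (y i))

lemma inner_eq_sum {d : ℕ} (x y : Space d) : inner ℝ x y = ∑ i, x i * y i := by
  simp [PiLp.inner_apply, mul_comm]

/-- The symplectic phase is the exponential of a sum over the axes, so both kernel and measure
factor. -/
lemma twisted_prod {d : ℕ} (f g : Fin d → ℝ × ℝ → ℂ) (u : Phase d) :
    twisted (fun v => ∏ i, f i (coordAt v i)) (fun v => ∏ i, g i (coordAt v i)) u =
      ∏ i, twistedPlane (f i) (g i) (coordAt u i) := by
  unfold twisted twistedPlane
  rw [Finset.prod_mul_distrib, Finset.prod_const, Finset.card_univ, Fintype.card_fin,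
    ← integral_prod_coordAt₂]
  congr 1
  · rw [← Complex.ofReal_pow, div_pow, one_pow, ← pow_mul]
  · congr 1
    funext z
    rw [Finset.prod_mul_distrib, Finset.prod_mul_distrib]
    congr 1
    simp only [symplecticPhase, ← Complex.exp_add]
    rw [← Complex.exp_sum]
    congr 1
    simp only [← mul_add, ← Complex.ofReal_add]
    rw [← Finset.mul_sum, ← Complex.ofReal_sum]
    congr 2
    simp only [inner_eq_sum, ← Finset.sum_add_distrib, ← Finset.sum_sub_distrib, coordAt]
    exact Finset.sum_congr rfl fun i _ => by ring

/-! ### Symplectic scaling -/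

/-- The symplectic scaling `(q, p) ↦ (κ q, κ⁻¹ p)`. -/
def scaleEquiv (d : ℕ) (κ : ℝ) (hκ : κ ≠ 0) : Phase d ≃ᵐ Phase d :=
  (MeasurableEquiv.smul₀ κ hκ).prodCongr (MeasurableEquiv.smul₀ κ⁻¹ (inv_ne_zero hκ))

/-- The Jacobians of the dilations by κ and κ⁻¹ cancel. -/
lemma measurePreserving_scaleEquiv (d : ℕ) (κ : ℝ) (hκ : κ ≠ 0) :
    MeasurePreserving (scaleEquiv d κ hκ) := by
  refine ⟨(scaleEquiv d κ hκ).measurable, ?_⟩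
  have h1 := Measure.map_addHaar_smul (volume : Measure (Space d)) hκ
  have h2 := Measure.map_addHaar_smul (volume : Measure (Space d)) (inv_ne_zero hκ)
  have e : (scaleEquiv d κ hκ : Phase d → Phase d) =
    Prod.map (κ • ·) (κ⁻¹ • ·) := rfl
  have := Measure.map_prod_map (volume : Measure (Space d)) (volume : Measure (Space d))
    (f := (κ • ·)) (g := (κ⁻¹ • ·)) (measurable_const_smul κ) (measurable_const_smul κ⁻¹)
  rw [Measure.volume_eq_prod, e, ← this, h1, h2, Measure.prod_smul_left,
    Measure.prod_smul_right, smul_smul, ← ENNReal.ofReal_mul (abs_nonneg _), ← abs_mul,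
    ← mul_inv, ← mul_pow, mul_inv_cancel₀ hκ]
  simp

lemma twisted_comp_scaleEquiv {d : ℕ} {κ : ℝ} (hκ : κ ≠ 0) (f g : Phase d → ℂ) (u : Phase d) :
    twisted (fun v => f (scaleEquiv d κ hκ v)) (fun v => g (scaleEquiv d κ hκ v)) u =
      twisted f g (scaleEquiv d κ hκ u) := by
  unfold twisted
  congr 1
  have h := measurePreserving_scaleEquiv d κ hκ
  have h2 : MeasurePreserving ((scaleEquiv d κ hκ).prodCongr (scaleEquiv d κ hκ)) := h.prod h
  symm
  rw [← h2.integral_comp']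
  congr 1
  funext z
  change f (scaleEquiv d κ hκ z.1) * g (scaleEquiv d κ hκ z.2) * _ = _
  congr 4
  change inner ℝ (κ • u.1) (κ⁻¹ • z.1.2) - inner ℝ (κ • z.1.1) (κ⁻¹ • u.2) +
    inner ℝ (κ • z.1.1) (κ⁻¹ • z.2.2) - inner ℝ (κ • z.2.1) (κ⁻¹ • z.1.2) +
    inner ℝ (κ • z.2.1) (κ⁻¹ • u.2) - inner ℝ (κ • u.1) (κ⁻¹ • z.2.2) = _
  simp only [real_inner_smul_left, real_inner_smul_right, ← mul_assoc, inv_mul_cancel₀ hκ, one_mul]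

/-- Conjugation reverses the order of the product, so the right eigenvalue equations follow from the
left ones. -/
lemma conj_twisted {d : ℕ} (f g : Phase d → ℂ) (u : Phase d) :
    conj (twisted f g u) = twisted (fun v => conj (g v)) (fun v => conj (f v)) u := by
  unfold twisted
  rw [map_mul, Complex.conj_ofReal, ← integral_conj, Measure.volume_eq_prod (Phase d),
    ← integral_prod_swap]
  congr 2
  funext z
  simp only [Prod.fst_swap, Prod.snd_swap, map_mul, ← Complex.exp_conj, Complex.conj_ofReal,
    Complex.conj_I, Complex.conj_ofNat]
  rw [mul_comm (conj (f z.2))]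
  congr 2
  push_cast
  ring

/-! ### Natural systems in several degrees of freedom -/

/-- Eigentransitions of an isotropic oscillator, in scaled variables. -/
def oscPhase {d : ℕ} (r s : Fin d → ℕ) (u : Phase d) : ℂ := ∏ i, oscPlane (r i) (s i) (coordAt u i)

/-- Thermal Gaussian in scaled variables. -/
def thermalPhase {d : ℕ} (l : ℝ) (u : Phase d) : ℂ := ∏ i, thermalPlane l (coordAt u i)

lemma two_pi_pow (d : ℕ) : (((2 * Real.pi) ^ d : ℝ) : ℂ) = ∏ _i : Fin d, (2 * Real.pi : ℂ) := by
  simp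

lemma conj_thermalPlane (l : ℝ) (u : ℝ × ℝ) : conj (thermalPlane l u) = thermalPlane l u := by
  rw [thermalPlane, gaussW, map_mul, Complex.conj_ofReal, ← Complex.exp_conj, wcoord_mul_wconj]
  simp [Complex.conj_ofNat]

theorem isNaturalSystem_scaled {d : ℕ} {κ : ℝ} (hκ : κ ≠ 0) (l x : ℝ) (hl : 0 < l)
    (hx : x = (1 - l) / (1 + l)) :
    IsNaturalSystem (fun u : Phase d => thermalPhase l (scaleEquiv d κ hκ u))
      (fun r : Fin d → ℕ => ∏ i, (1 - x) * x ^ r i)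
      (fun r s u => oscPhase r s (scaleEquiv d κ hκ u)) := by
  have hconj : ∀ (r s : Fin d → ℕ) (u : Phase d), conj (oscPhase r s u) = oscPhase s r u := by
    intro r s u
    simp only [oscPhase, map_prod, conj_oscPlane]
  have hconjD : ∀ u : Phase d, conj (thermalPhase l u) = thermalPhase l u := by
    intro u
    simp only [thermalPhase, map_prod, conj_thermalPlane]
  have hleft : ∀ (r s : Fin d → ℕ) (u : Phase d), (((2 * Real.pi) ^ d : ℝ) : ℂ) *
      twisted (thermalPhase l) (oscPhase r s) u =
      ((∏ i, (1 - x) * x ^ r i : ℝ) : ℂ) * oscPhase r s u := by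
    intro r s u
    have := twisted_prod (fun _ : Fin d => thermalPlane l) (fun i => oscPlane (r i) (s i)) u
    change twisted (thermalPhase l) (oscPhase r s) u = _ at this
    rw [this, two_pi_pow, ← Finset.prod_mul_distrib, oscPhase, Complex.ofReal_prod,
      ← Finset.prod_mul_distrib]
    exact Finset.prod_congr rfl fun i _ => twistedPlane_thermalPlane l x hl hx _ _ _
  have hunit : ∀ (r s t v : Fin d → ℕ) (u : Phase d), (((2 * Real.pi) ^ d : ℝ) : ℂ) *
      twisted (oscPhase r s) (oscPhase t v) u = ∏ i, if s i = t i then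
        oscPlane (r i) (v i) (coordAt u i) else 0 := by
    intro r s t v u
    have := twisted_prod (fun i => oscPlane (r i) (s i)) (fun i => oscPlane (t i) (v i)) u
    change twisted (oscPhase r s) (oscPhase t v) u = _ at this
    rw [this, two_pi_pow, ← Finset.prod_mul_distrib]
    exact Finset.prod_congr rfl fun i _ => twistedPlane_oscPlane _ _ _ _ _
  have hint : ∀ r s : Fin d → ℕ, ∫ u : Phase d, oscPhase r s (scaleEquiv d κ hκ u) =
      ∏ i, if r i = s i then 1 else 0 := by
    intro r s
    rw [(measurePreserving_scaleEquiv d κ hκ).integral_comp']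
    unfold oscPhase
    rw [integral_prod_coordAt fun i => oscPlane (r i) (s i)]
    exact Finset.prod_congr rfl fun i _ => integral_oscPlane _ _
  refine ⟨fun r s u => hconj r s _, fun r s u => ?_, fun r s u => ?_, fun r s t v u hst => ?_,
    fun r s t v u hst => ?_, fun r => ?_, fun r s hrs => ?_⟩
  · rw [twisted_comp_scaleEquiv]
    exact hleft r s _
  · rw [twisted_comp_scaleEquiv]
    have h := congrArg conj (hleft s r (scaleEquiv d κ hκ u))
    rw [map_mul, map_mul, conj_twisted, hconj, Complex.conj_ofReal, Complex.conj_ofReal] at h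
    simp only [hconj, hconjD] at h
    exact h
  · rw [twisted_comp_scaleEquiv, hunit]
    subst hst
    simp [oscPhase]
  · rw [twisted_comp_scaleEquiv]
    obtain ⟨i, hi⟩ := Function.ne_iff.1 hst
    have h := hunit r s t v (scaleEquiv d κ hκ u)
    rw [Finset.prod_eq_zero (Finset.mem_univ i) (by simp [hi])] at h
    exact (mul_eq_zero.1 h).resolve_left (by
      exact_mod_cast (pow_pos Real.two_pi_pos d).ne')
  · rw [hint]; simp
  · rw [hint]
    obtain ⟨i, hi⟩ := Function.ne_iff.1 hrs
    exact Finset.prod_eq_zero (Finset.mem_univ i) (by simp [hi])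

/-! ### Products of series -/

/-- Summable complex series are absolutely summable, so a finite product of sums expands
unconditionally into a sum over multi-indices. -/
lemma hasSum_fin_prod {ι : Type*} : ∀ {d : ℕ} (f : Fin d → ι → ℂ) (a : Fin d → ℂ),
    (∀ i, HasSum (f i) (a i)) → HasSum (fun r : Fin d → ι => ∏ i, f i (r i)) (∏ i, a i)
  | 0, f, a, _ => by
    simp
  | d + 1, f, a, h => by
    have ih := hasSum_fin_prod (fun i : Fin d => f i.succ) (fun i => a i.succ) fun i => h i.succ
    have h0 := h 0
    have hs := summable_mul_of_summable_norm h0.summable.norm ih.summable.norm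
    have hm := h0.mul ih hs
    rw [Fin.prod_univ_succ]
    rw [← (Fin.consEquiv fun _ : Fin (d + 1) => ι).hasSum_iff]
    refine hasSum_of_eq hm (fun p => ?_) rfl
    simp [Fin.prod_univ_succ, Fin.consEquiv]

theorem hasSum_thermalPhase {d : ℕ} (l x : ℝ) (hl : 0 < l) (hl1 : l ≤ 1)
    (hx : x = (1 - l) / (1 + l)) (u : Phase d) :
    HasSum (fun r : Fin d → ℕ => ((∏ i, (1 - x) * x ^ r i : ℝ) : ℂ) * oscPhase r r u)
      (thermalPhase l u) := by
  refine hasSum_of_eq (hasSum_fin_prod _ _ fun i => hasSum_thermalPlane l x hl hl1 hx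
    (coordAt u i)) (fun r => ?_) rfl
  rw [oscPhase, Complex.ofReal_prod, Finset.prod_mul_distrib]

theorem hasSum_slkPhase {d : ℕ} (x : ℝ) (hx0 : 0 ≤ x) (hx1 : x < 1) (u v : Phase d) :
    HasSum (fun p : (Fin d → ℕ) × (Fin d → ℕ) =>
      slkTerm (fun r : Fin d → ℕ => (-1) ^ (∑ i, r i) * √(∏ i, (1 - x) * x ^ r i)) oscPhase u v p)
      (((1 / Real.pi ^ 2) ^ d * Real.exp (∑ i, -((1 + x) * (u.1 i ^ 2 + u.2 i ^ 2 + v.1 i ^ 2 +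
        v.2 i ^ 2) + 4 * √x * (u.1 i * v.1 i - u.2 i * v.2 i)) / (1 - x)) : ℝ) : ℂ) := by
  have h := hasSum_fin_prod _ _ fun i => hasSum_slkPlane x hx0 hx1 (coordAt u i) (coordAt v i)
  -- A pair of multi-indices is read as a multi-index of pairs, one pair for each axis.
  rw [← (Equiv.arrowProdEquivProdArrow (Fin d) (fun _ => ℕ) (fun _ => ℕ)).hasSum_iff]
  have hc : ∀ r : Fin d → ℕ, (-1) ^ (∑ i, r i) * √(∏ i, (1 - x) * x ^ r i) =
      ∏ i, planeCoeff x (r i) := by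
    intro r
    rw [Real.sqrt_prod _ fun i _ => mul_nonneg (by linarith) (pow_nonneg hx0 _),
      ← Finset.prod_pow_eq_pow_sum, ← Finset.prod_mul_distrib]
    rfl
  refine hasSum_of_eq h (fun p => ?_) ?_
  · simp only [Function.comp, slkTerm, hc, oscPhase, Complex.ofReal_prod]
    rw [← Finset.prod_mul_distrib, ← Finset.prod_mul_distrib, ← Finset.prod_mul_distrib]
    rfl
  · rw [← Complex.ofReal_prod, Finset.prod_mul_distrib, ← Real.exp_sum]
    simp [coordAt]

/-! ### Parameters of harmonium -/

section parameters

variable {ω k : ℝ}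

lemma relFreq_pos (hk : k < ω ^ 2) : 0 < relFreq ω k := Real.sqrt_pos.2 (by linarith)

lemma relFreq_sq (hk : k < ω ^ 2) : relFreq ω k ^ 2 = ω ^ 2 - k := Real.sq_sqrt (by linarith)

lemma relFreq_le (hω : 0 < ω) (hk₀ : 0 ≤ k) : relFreq ω k ≤ ω := by
  rw [relFreq, Real.sqrt_le_left hω.le]; linarith

lemma relFreq_lt (hω : 0 < ω) (hk₀ : 0 < k) : relFreq ω k < ω := by
  rw [relFreq, Real.sqrt_lt' hω]; linarith

lemma lam_eq (hω : 0 < ω) (hk : k < ω ^ 2) :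
    lam ω k = 2 * (√ω * √(relFreq ω k)) / (√ω ^ 2 + √(relFreq ω k) ^ 2) := by
  rw [lam, Real.sqrt_mul hω.le, Real.sq_sqrt hω.le, Real.sq_sqrt (relFreq_pos hk).le]

/-- With a = √ω and b = √μ, 1 ∓ λ = (a ∓ b)²/(a² + b²). The quotient is a perfect square, so the √x
of the series coefficients is rational in a and b. -/
lemma boltzmann_eq (hω : 0 < ω) (hk : k < ω ^ 2) :
    boltzmann ω k = ((√ω - √(relFreq ω k)) / (√ω + √(relFreq ω k))) ^ 2 := by
  have ha := Real.sqrt_pos.2 hω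
  have hb := Real.sqrt_pos.2 (relFreq_pos hk)
  rw [boltzmann, lam_eq hω hk]
  generalize √ω = a at *
  generalize √(relFreq ω k) = b at *
  have h : 1 + 2 * (a * b) / (a ^ 2 + b ^ 2) ≠ 0 := by positivity
  have h' : a ^ 2 + b ^ 2 ≠ 0 := by positivity
  rw [div_eq_iff h]
  field_simp
  ring

lemma lam_pos (hω : 0 < ω) (hk : k < ω ^ 2) : 0 < lam ω k := by
  have ha := Real.sqrt_pos.2 hω
  have hb := Real.sqrt_pos.2 (relFreq_pos hk)
  rw [lam_eq hω hk]
  positivity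

lemma lam_le_one (hω : 0 < ω) (hk : k < ω ^ 2) : lam ω k ≤ 1 := by
  have ha := Real.sqrt_pos.2 hω
  have hb := Real.sqrt_pos.2 (relFreq_pos hk)
  rw [lam_eq hω hk, div_le_one (by positivity)]
  nlinarith [sq_nonneg (√ω - √(relFreq ω k))]

lemma boltzmann_nonneg (hω : 0 < ω) (hk : k < ω ^ 2) : 0 ≤ boltzmann ω k := by
  rw [boltzmann_eq hω hk]; positivity

lemma boltzmann_lt_one (hω : 0 < ω) (hk : k < ω ^ 2) : boltzmann ω k < 1 := by
  have := lam_pos hω hk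
  rw [boltzmann, div_lt_one (by linarith)]
  linarith

lemma sqrt_relFreq_le (hω : 0 < ω) (hk₀ : 0 ≤ k) : √(relFreq ω k) ≤ √ω :=
  Real.sqrt_le_sqrt (relFreq_le hω hk₀)

lemma sqrt_boltzmann (hω : 0 < ω) (hk₀ : 0 ≤ k) (hk : k < ω ^ 2) :
    √(boltzmann ω k) = (√ω - √(relFreq ω k)) / (√ω + √(relFreq ω k)) := by
  have := sqrt_relFreq_le hω hk₀
  rw [boltzmann_eq hω hk, Real.sqrt_sq (div_nonneg (by linarith) (by positivity))]

/-- The scaling factor `(ωμ)^(1/4)`. -/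
def axisScale (ω k : ℝ) : ℝ := (ω * relFreq ω k) ^ (1 / 4 : ℝ)

lemma axisScale_pos (hω : 0 < ω) (hk : k < ω ^ 2) : 0 < axisScale ω k :=
  Real.rpow_pos_of_pos (mul_pos hω (relFreq_pos hk)) _

lemma axisScale_sq (hω : 0 < ω) (hk : k < ω ^ 2) :
    axisScale ω k ^ 2 = √ω * √(relFreq ω k) := by
  rw [← Real.sqrt_mul hω.le, axisScale, ← Real.rpow_natCast, ← Real.rpow_mul
    (mul_pos hω (relFreq_pos hk)).le, Real.sqrt_eq_rpow]
  norm_num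

lemma transition_eq {d : ℕ} (hω : 0 < ω) (hk : k < ω ^ 2) (r s : Fin d → ℕ) (u : Phase d) :
    transition ω k r s u = oscPhase r s (scaleEquiv d _ (axisScale_pos hω hk).ne' u) := by
  unfold transition oscPhase oscPlane
  rw [Real.rpow_neg (mul_pos hω (relFreq_pos hk)).le]
  rfl

/-! ### Occupation numbers -/

theorem hasSum_occupation {d : ℕ} (hω : 0 < ω) (hk : k < ω ^ 2) :
    HasSum (fun r : Fin d → ℕ => occupation ω k r) 1 := by
  have h0 := boltzmann_nonneg hω hk
  have h1 := boltzmann_lt_one hω hk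
  have h := hasSum_fin_prod (fun (_ : Fin d) (r : ℕ) =>
    (((1 - boltzmann ω k) * boltzmann ω k ^ r : ℝ) : ℂ)) (fun _ => 1) fun i => by
      rw [← Complex.ofReal_one, Complex.hasSum_ofReal]
      have := (hasSum_geometric_of_lt_one h0 h1).mul_left (1 - boltzmann ω k)
      rwa [mul_inv_cancel₀ (by linarith)] at this
  rw [← Complex.hasSum_ofReal]
  refine hasSum_of_eq h (fun r => ?_) (by simp)
  simp [occupation]

theorem occupation_of_eq_zero {d : ℕ} (hω : 0 < ω) (r : Fin d → ℕ) :
    occupation ω 0 r = if r = 0 then 1 else 0 := by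
  have hb : boltzmann ω 0 = 0 := by
    have h : relFreq ω 0 = ω := by rw [relFreq, sub_zero, Real.sqrt_sq hω.le]
    rw [boltzmann_eq hω (by positivity), h]
    simp
  unfold occupation
  rw [hb]
  split_ifs with h
  · subst h; simp
  · obtain ⟨i, hi⟩ := Function.ne_iff.1 h
    exact Finset.prod_eq_zero (Finset.mem_univ i) (by simpa using hi)

theorem exists_inverse_temperature {d : ℕ} (hω : 0 < ω) (hk₀ : 0 < k) (hk : k < ω ^ 2) :
    ∃ β : ℝ, 0 < β ∧ Real.tanh (β / 2) = lam ω k ∧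
      ∀ r : Fin d → ℕ,
        occupation ω k r = ∏ i, (1 - Real.exp (-β)) * Real.exp (-((r i : ℝ) * β)) ∧
        occupation ω k r =
          (2 * Real.sinh (β / 2)) ^ d * Real.exp (-(β * ∑ i, ((r i : ℝ) + 1 / 2))) ∧
        occupation ω k r =
          ∏ i, 4 * √(ω * relFreq ω k) / (ω - relFreq ω k) *
            ((√ω - √(relFreq ω k)) / (√ω + √(relFreq ω k))) ^ (2 * r i + 1) := by
  have hb := Real.sqrt_pos.2 (relFreq_pos hk)
  have hab : √(relFreq ω k) < √ω := Real.sqrt_lt_sqrt (relFreq_pos hk).le (relFreq_lt hω hk₀)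
  have hx := boltzmann_eq hω hk
  have hl := lam_eq hω hk
  have hg : √(ω * relFreq ω k) = √ω * √(relFreq ω k) := Real.sqrt_mul hω.le _
  have hs : ω - relFreq ω k = √ω ^ 2 - √(relFreq ω k) ^ 2 := by
    rw [Real.sq_sqrt hω.le, Real.sq_sqrt (relFreq_pos hk).le]
  unfold occupation
  rw [hg, hs, hx, hl]
  generalize √ω = a at *
  generalize √(relFreq ω k) = b at *
  have hab' : 0 < a - b := by linarith
  have hab2 : 0 < a + b := by linarith
  have hE : 0 < (a + b) / (a - b) := by positivity
  set y : ℝ := (a - b) / (a + b) with hy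
  have hy0 : 0 < y := by positivity
  have hy1 : y < 1 := by rw [hy, div_lt_one hab2]; linarith
  -- Chosen so that exp(-β/2) = y = √x, which makes exp(-β) the Boltzmann factor.
  set β : ℝ := -2 * Real.log y with hβ
  have hhalf : Real.exp (-(β / 2)) = y := by
    rw [hβ, show -(-2 * Real.log y / 2) = Real.log y by ring, Real.exp_log hy0]
  have hhalf' : Real.exp (β / 2) = y⁻¹ := by
    rw [← hhalf, Real.exp_neg, inv_inv]
  have hexp : Real.exp (-β) = y ^ 2 := by
    rw [← hhalf, ← Real.exp_nat_mul]; push_cast; ring_nf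
  have hpow : ∀ n : ℕ, Real.exp (-((n : ℝ) * β)) = (y ^ 2) ^ n := by
    intro n
    rw [← hexp, ← Real.exp_nat_mul]; ring_nf
  refine ⟨β, ?_, ?_, fun r => ⟨?_, ?_, ?_⟩⟩
  · have := Real.log_neg hy0 hy1
    rw [hβ]; linarith
  · have h2 : a ^ 2 + b ^ 2 ≠ 0 := by positivity
    have h3 : (a + b) ^ 2 + (a - b) ^ 2 ≠ 0 := by positivity
    rw [Real.tanh_eq_sinh_div_cosh, Real.sinh_eq, Real.cosh_eq, hhalf, hhalf', hy, inv_div,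
      div_eq_div_iff (by positivity) h2]
    field_simp
    ring
  · exact Finset.prod_congr rfl fun i _ => by rw [hpow, hexp]
  · rw [Finset.mul_sum, ← Finset.sum_neg_distrib, Real.exp_sum]
    have : (2 * Real.sinh (β / 2)) ^ d = ∏ _i : Fin d, 2 * Real.sinh (β / 2) := by simp
    rw [this, ← Finset.prod_mul_distrib]
    refine Finset.prod_congr rfl fun i _ => ?_
    rw [show -(β * ((r i : ℝ) + 1 / 2)) = -((r i : ℝ) * β) + -(β / 2) by ring, Real.exp_add, hpow,
      Real.sinh_eq, hhalf, hhalf']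
    field_simp
  · refine Finset.prod_congr rfl fun i _ => ?_
    have h4 : a ^ 2 - b ^ 2 ≠ 0 := by
      rw [sq_sub_sq]; positivity
    rw [pow_succ y (2 * r i), pow_mul, mul_comm ((y ^ 2) ^ r i) y, ← mul_assoc]
    congr 1
    rw [hy]
    field_simp
    ring

/-! ### The Gaussian Wigner functions as products over the axes -/

/-- Since the squared scaling factor is √(ωμ), multiplying λ by it and by its inverse gives
2ωμ/(ω+μ) and 2/(ω+μ). -/
lemma thermalPhase_eq {d : ℕ} (hω : 0 < ω) (hk : k < ω ^ 2) (u : Phase d) :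
    (((lam ω k / Real.pi) ^ d * Real.exp (-(2 * (ω * relFreq ω k * ‖u.1‖ ^ 2 + ‖u.2‖ ^ 2) /
      (ω + relFreq ω k))) : ℝ) : ℂ) =
    thermalPhase (lam ω k) (scaleEquiv d _ (axisScale_pos hω hk).ne' u) := by
  have hκ := axisScale_pos hω hk
  have hκ2 := axisScale_sq hω hk
  have ha := Real.sqrt_pos.2 hω
  have hb := Real.sqrt_pos.2 (relFreq_pos hk)
  have ha2 := Real.sq_sqrt hω.le
  have hb2 := Real.sq_sqrt (relFreq_pos hk).le
  have e : ∀ i, thermalPlane (lam ω k) (coordAt (scaleEquiv d _ hκ.ne' u) i) =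
      ((lam ω k / Real.pi * Real.exp (-(2 * (ω * relFreq ω k * u.1 i ^ 2 + u.2 i ^ 2) /
      (ω + relFreq ω k))) : ℝ) : ℂ) := by
    intro i
    have e1 : -(lam ω k / 2 * (2 * ((axisScale ω k * u.1 i) ^ 2 +
        ((axisScale ω k)⁻¹ * u.2 i) ^ 2))) =
        -(2 * (ω * relFreq ω k * u.1 i ^ 2 + u.2 i ^ 2) / (ω + relFreq ω k)) := by
      rw [mul_pow, mul_pow, inv_pow, hκ2, lam_eq hω hk]
      generalize √ω = a at *
      generalize √(relFreq ω k) = b at *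
      rw [← hb2, ← ha2]
      have : a ^ 2 + b ^ 2 ≠ 0 := by positivity
      field_simp
    rw [thermalPlane, gaussW, wcoord_mul_wconj, zero_mul, zero_mul, add_zero, add_zero,
      ← Complex.ofReal_mul, ← Complex.ofReal_neg, ← Complex.ofReal_exp, ← Complex.ofReal_mul]
    exact congrArg (fun t : ℝ => ((lam ω k / Real.pi * Real.exp t : ℝ) : ℂ)) e1
  rw [thermalPhase, Finset.prod_congr rfl fun i _ => e i, ← Complex.ofReal_prod,
    Finset.prod_mul_distrib, ← Real.exp_sum]
  congr 2
  · simp [div_pow]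
  · rw [EuclideanSpace.norm_sq_eq, EuclideanSpace.norm_sq_eq, Finset.sum_neg_distrib,
      ← Finset.sum_div, ← Finset.mul_sum, Finset.mul_sum, ← Finset.sum_add_distrib]
    simp

/-- Here (1+x)/(1-x) = (ω+μ)/(2√(ωμ)) and 4√x/(1-x) = (ω-μ)/√(ωμ). After rescaling, the position
part of the Mehler exponent becomes ω|q₁+q₂|²/2 + μ|q₁-q₂|²/2 up to sign, and the momentum part
likewise with inverse frequencies. -/
lemma wignerGaussian_eq {d : ℕ} (hω : 0 < ω) (hk₀ : 0 ≤ k) (hk : k < ω ^ 2) (u v : Phase d) :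
    1 / Real.pi ^ (2 * d) * Real.exp (-(2 * extraculeH ω u v / ω)) *
      Real.exp (-(2 * intraculeH ω k u v / relFreq ω k)) =
    (1 / Real.pi ^ 2) ^ d * Real.exp (∑ i, -((1 + boltzmann ω k) *
      ((axisScale ω k * u.1 i) ^ 2 + ((axisScale ω k)⁻¹ * u.2 i) ^ 2 +
        (axisScale ω k * v.1 i) ^ 2 + ((axisScale ω k)⁻¹ * v.2 i) ^ 2) +
      4 * √(boltzmann ω k) * (axisScale ω k * u.1 i * (axisScale ω k * v.1 i) -
        (axisScale ω k)⁻¹ * u.2 i * ((axisScale ω k)⁻¹ * v.2 i))) / (1 - boltzmann ω k)) := by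
  have hκ := axisScale_pos hω hk
  have hκ2 := axisScale_sq hω hk
  have ha := Real.sqrt_pos.2 hω
  have hb := Real.sqrt_pos.2 (relFreq_pos hk)
  have ha2 := Real.sq_sqrt hω.le
  have hb2 := Real.sq_sqrt (relFreq_pos hk).le
  have hm2 := relFreq_sq hk
  rw [mul_assoc, ← Real.exp_add, div_pow, one_pow, ← pow_mul]
  congr 2
  unfold extraculeH intraculeH
  rw [← hm2]
  simp only [EuclideanSpace.norm_sq_eq, PiLp.add_apply, PiLp.sub_apply, PiLp.smul_apply,
    smul_eq_mul, Real.norm_eq_abs, sq_abs, Finset.sum_div, Finset.mul_sum,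
    ← Finset.sum_add_distrib, ← Finset.sum_neg_distrib]
  refine Finset.sum_congr rfl fun i _ => ?_
  rw [sqrt_boltzmann hω hk₀ hk, boltzmann_eq hω hk]
  have e : ∀ x y : ℝ, axisScale ω k * x * (axisScale ω k * y) = axisScale ω k ^ 2 * (x * y) :=
    fun x y => by ring
  have e' : ∀ x y : ℝ, (axisScale ω k)⁻¹ * x * ((axisScale ω k)⁻¹ * y) =
    (axisScale ω k ^ 2)⁻¹ * (x * y) := fun x y => by rw [← inv_pow]; ring
  rw [e, e']
  simp only [mul_pow (axisScale ω k), mul_pow (axisScale ω k)⁻¹, inv_pow, hκ2]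
  generalize √ω = a at *
  generalize √(relFreq ω k) = b at *
  rw [← hb2, ← ha2]
  have h1 : 1 - ((a - b) / (a + b)) ^ 2 = 4 * (a * b) / (a + b) ^ 2 := by
    field_simp
    ring
  rw [h1]
  field_simp
  ring

end parameters

/-! ### Gaussians as Schwartz functions -/

section schwartzGaussian

variable {E F : Type*} [NormedAddCommGroup E] [NormedSpace ℝ E] [NormedAddCommGroup F]
  [NormedSpace ℝ F]

lemma hasTemperateGrowth_fderiv {f : E → F} (hf : f.HasTemperateGrowth) :
    (fderiv ℝ f).HasTemperateGrowth := by
  refine ⟨hf.1.fderiv_right (by simp), fun n => ?_⟩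
  obtain ⟨k, C, h⟩ := hf.2 (n + 1)
  exact ⟨k, C, fun x => by rw [norm_iteratedFDeriv_fderiv]; exact h x⟩

/-- Every derivative of exp(-Q) is exp(-Q) times a factor of temperate growth, so Schwartz decay
reduces to one estimate of a polynomial against a Gaussian. -/
lemma exists_iteratedFDeriv_exp_neg {Q : E → ℝ} (hQ : Q.HasTemperateGrowth) (n : ℕ) :
    ∃ p : E → ContinuousMultilinearMap ℝ (fun _ : Fin n => E) ℂ, p.HasTemperateGrowth ∧
      iteratedFDeriv ℝ n (fun x => ((Real.exp (-Q x) : ℝ) : ℂ)) =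
        fun x => Real.exp (-Q x) • p x := by
  induction n with
  | zero =>
    refine ⟨fun _ => (continuousMultilinearCurryFin0 ℝ E ℂ).symm 1,
      Function.HasTemperateGrowth.const _, ?_⟩
    funext x
    ext m
    simp
  | succ n ih =>
    obtain ⟨p, hp, h⟩ := ih
    let L : (E →L[ℝ] ContinuousMultilinearMap ℝ (fun _ : Fin n => E) ℂ) →L[ℝ]
        ContinuousMultilinearMap ℝ (fun _ : Fin (n + 1) => E) ℂ :=
      ((continuousMultilinearCurryLeftEquiv ℝ (fun _ : Fin (n + 1) => E) ℂ).symm :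
        (E →L[ℝ] ContinuousMultilinearMap ℝ (fun _ : Fin n => E) ℂ) →L[ℝ]
        ContinuousMultilinearMap ℝ (fun _ : Fin (n + 1) => E) ℂ)
    have hL : Function.HasTemperateGrowth L := ContinuousLinearMap.hasTemperateGrowth _
    have hg : (fun x => fderiv ℝ p x - ContinuousLinearMap.smulRightL ℝ E
        (ContinuousMultilinearMap ℝ (fun _ : Fin n => E) ℂ) (fderiv ℝ Q x)
        (p x)).HasTemperateGrowth :=
      (hasTemperateGrowth_fderiv hp).sub
        (ContinuousLinearMap.bilinear_hasTemperateGrowth _ (hasTemperateGrowth_fderiv hQ) hp)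
    refine ⟨fun x => L (fderiv ℝ p x - ContinuousLinearMap.smulRightL ℝ E _ (fderiv ℝ Q x)
      (p x)), hL.comp hg, ?_⟩
    rw [iteratedFDeriv_succ_eq_comp_left, h]
    funext x
    have hQx : HasFDerivAt Q (fderiv ℝ Q x) x :=
      (hQ.1.differentiable (by simp)).differentiableAt.hasFDerivAt
    have hpx : HasFDerivAt p (fderiv ℝ p x) x :=
      (hp.1.differentiable (by simp)).differentiableAt.hasFDerivAt
    have hd : fderiv ℝ (fun x => Real.exp (-Q x) • p x) x = _ := (hQx.neg.exp.smul hpx).fderiv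
    rw [Function.comp_apply, hd]
    change L _ = Real.exp (-Q x) • L _
    rw [← map_smul L]
    congr 1
    ext v : 1
    simp only [Pi.neg_apply, add_apply, smul_apply, sub_apply,
      ContinuousLinearMap.smulRight_apply, neg_apply,
      ContinuousLinearMap.smulRightL_apply_apply, smul_sub, smul_neg, neg_smul, smul_assoc]
    abel

lemma one_add_pow_mul_exp_le {c : ℝ} (hc : 0 < c) (N : ℕ) :
    ∃ C : ℝ, ∀ t : ℝ, 0 ≤ t → (1 + t) ^ N * Real.exp (-(c * t ^ 2)) ≤ C := by
  -- From (1+t)^N ≤ N! exp(1+t) and the maximum 1/(4c) of t - ct².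
  refine ⟨N.factorial * Real.exp (1 + 1 / (4 * c)), fun t ht => ?_⟩
  have h := Real.pow_div_factorial_le_exp (1 + t) (by positivity) N
  rw [div_le_iff₀ (by positivity)] at h
  calc (1 + t) ^ N * Real.exp (-(c * t ^ 2))
      ≤ Real.exp (1 + t) * N.factorial * Real.exp (-(c * t ^ 2)) := by gcongr
    _ = N.factorial * Real.exp (1 + t - c * t ^ 2) := by
        rw [sub_eq_add_neg, Real.exp_add (1 + t)]; ring
    _ ≤ _ := by
        gcongr
        have : c * t ^ 2 - t + 1 / (4 * c) = c * (t - 1 / (2 * c)) ^ 2 := by field_simp; ring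
        nlinarith [mul_nonneg hc.le (sq_nonneg (t - 1 / (2 * c)))]

/-- The Gaussian `exp (-Q)` of a coercive function `Q` of temperate growth. -/
def schwartzGaussian (Q : E → ℝ) (hQ : Q.HasTemperateGrowth) (c : ℝ) (hc : 0 < c)
    (h : ∀ x, c * ‖x‖ ^ 2 ≤ Q x) : 𝓢(E, ℂ) where
  toFun x := ((Real.exp (-Q x) : ℝ) : ℂ)
  smooth' := Complex.ofRealCLM.contDiff.comp (hQ.1.neg.exp)
  decay' k n := by
    obtain ⟨p, hp, e⟩ := exists_iteratedFDeriv_exp_neg hQ n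
    obtain ⟨m, C, hm⟩ := hp.2 0
    obtain ⟨C', hC'⟩ := one_add_pow_mul_exp_le hc (k + m)
    have hC : 0 ≤ C := by
      have := (norm_nonneg _).trans (hm 0)
      simpa using this
    refine ⟨C * C', fun x => ?_⟩
    have hx := hm x
    rw [norm_iteratedFDeriv_zero] at hx
    rw [e, norm_smul, Real.norm_eq_abs, Real.abs_exp]
    have hle : Real.exp (-Q x) ≤ Real.exp (-(c * ‖x‖ ^ 2)) := by
      gcongr; exact h x
    have hk : ‖x‖ ^ k ≤ (1 + ‖x‖) ^ k := by gcongr; linarith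
    calc ‖x‖ ^ k * (Real.exp (-Q x) * ‖p x‖)
        ≤ (1 + ‖x‖) ^ k * (Real.exp (-(c * ‖x‖ ^ 2)) * (C * (1 + ‖x‖) ^ m)) := by gcongr
      _ = C * ((1 + ‖x‖) ^ (k + m) * Real.exp (-(c * ‖x‖ ^ 2))) := by rw [pow_add]; ring
      _ ≤ C * C' := by gcongr; exact hC' _ (norm_nonneg _)

end schwartzGaussian

/-- The exponent of the ground state of two coupled oscillators. -/
def pairForm {d : ℕ} (a b : ℝ) (x : Space d × Space d) : ℝ :=
  a / 4 * ‖x.1 + x.2‖ ^ 2 + b / 4 * ‖x.1 - x.2‖ ^ 2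

lemma hasTemperateGrowth_pairForm {d : ℕ} (a b : ℝ) :
    (pairForm (d := d) a b).HasTemperateGrowth := by
  have h1 := (ContinuousLinearMap.fst ℝ (Space d) (Space d) +
    ContinuousLinearMap.snd ℝ (Space d) (Space d)).hasTemperateGrowth
  have h2 := (ContinuousLinearMap.fst ℝ (Space d) (Space d) -
    ContinuousLinearMap.snd ℝ (Space d) (Space d)).hasTemperateGrowth
  have hn := Function.hasTemperateGrowth_norm_sq (Space d)
  exact ((Function.HasTemperateGrowth.const _).mul (hn.comp h1)).add
    ((Function.HasTemperateGrowth.const _).mul (hn.comp h2))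

/-- The parallelogram law gives coercivity in the Euclidean norm, which dominates the maximum norm
of the product space. -/
lemma le_pairForm {d : ℕ} {a b c : ℝ} (hc : 0 < c) (ha : c ≤ a) (hb : c ≤ b)
    (x : Space d × Space d) : c / 2 * ‖x‖ ^ 2 ≤ pairForm a b x := by
  have hp := parallelogram_law_with_norm ℝ x.1 x.2
  have h1 : ‖x‖ ^ 2 ≤ ‖x.1‖ ^ 2 + ‖x.2‖ ^ 2 := by
    rw [Prod.norm_def]
    rcases max_cases ‖x.1‖ ‖x.2‖ with ⟨h, -⟩ | ⟨h, -⟩ <;> rw [h] <;>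
      nlinarith [sq_nonneg ‖x.1‖, sq_nonneg ‖x.2‖]
  unfold pairForm
  have h3 : c / 4 * ‖x.1 + x.2‖ ^ 2 ≤ a / 4 * ‖x.1 + x.2‖ ^ 2 := by gcongr
  have h4 : c / 4 * ‖x.1 - x.2‖ ^ 2 ≤ b / 4 * ‖x.1 - x.2‖ ^ 2 := by gcongr
  nlinarith

/-- The Gaussian `exp (-a|q₁ + q₂|²/4 - b|q₁ - q₂|²/4)`. -/
def pairGaussian {d : ℕ} {a b : ℝ} (ha : 0 < a) (hb : 0 < b) : 𝓢(Space d × Space d, ℂ) :=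
  schwartzGaussian (pairForm a b) (hasTemperateGrowth_pairForm a b) (min a b / 2)
    (by positivity) (le_pairForm (lt_min ha hb) (min_le_left _ _) (min_le_right _ _))

lemma pairGaussian_apply {d : ℕ} {a b : ℝ} (ha : 0 < a) (hb : 0 < b) (x : Space d × Space d) :
    pairGaussian ha hb x = ((Real.exp (-pairForm a b x) : ℝ) : ℂ) := rfl

/-! ### Factorization of the Hamiltonian -/

section factorization

open scoped LineDeriv

variable {d : ℕ}

instance : (volume : Measure (Space d × Space d)).IsAddHaarMeasure :=
  inferInstanceAs ((volume : Measure (Space d)).prod (volume : Measure (Space d))).IsAddHaarMeasure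

/-- The direction `(e_i, ε e_i)` in the configuration space of two particles. -/
def modeVec (ε : ℝ) (i : Fin d) : Space d × Space d :=
  (EuclideanSpace.single i 1, ε • EuclideanSpace.single i 1)

/-- The coordinate `q₁ᵢ + ε q₂ᵢ`. -/
def modeCoord (ε : ℝ) (i : Fin d) : Space d × Space d →L[ℝ] ℝ :=
  (EuclideanSpace.proj i).comp (ContinuousLinearMap.fst ℝ (Space d) (Space d)) +
    ε • (EuclideanSpace.proj i).comp (ContinuousLinearMap.snd ℝ (Space d) (Space d))

lemma modeCoord_apply (ε : ℝ) (i : Fin d) (x : Space d × Space d) :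
    modeCoord ε i x = x.1 i + ε * x.2 i := rfl

lemma modeCoord_modeVec (ε : ℝ) (i : Fin d) : modeCoord ε i (modeVec ε i) = 1 + ε * ε := by
  simp [modeCoord_apply, modeVec]

/-- Multiplication of a Schwartz function by `a (q₁ᵢ + ε q₂ᵢ)`. -/
def modeMul (a ε : ℝ) (i : Fin d) (φ : 𝓢(Space d × Space d, ℂ)) : 𝓢(Space d × Space d, ℂ) :=
  SchwartzMap.smulLeftCLM ℂ (fun x => a * modeCoord ε i x) φ

lemma hasTemperateGrowth_modeCoord (a ε : ℝ) (i : Fin d) :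
    (fun x => a * modeCoord ε i x).HasTemperateGrowth :=
  (Function.HasTemperateGrowth.const a).mul (modeCoord ε i).hasTemperateGrowth

lemma modeMul_apply (a ε : ℝ) (i : Fin d) (φ : 𝓢(Space d × Space d, ℂ))
    (x : Space d × Space d) : modeMul a ε i φ x = ((a * modeCoord ε i x : ℝ) : ℂ) * φ x := by
  rw [modeMul, SchwartzMap.smulLeftCLM_apply_apply
    (hasTemperateGrowth_modeCoord a ε i), Complex.real_smul]

/-- The annihilation operator of a normal mode. -/
def modeLower (a ε : ℝ) (i : Fin d) (φ : 𝓢(Space d × Space d, ℂ)) : 𝓢(Space d × Space d, ℂ) :=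
  ∂_{modeVec ε i} φ + modeMul a ε i φ

/-- The creation operator of a normal mode. -/
def modeRaise (a ε : ℝ) (i : Fin d) (φ : 𝓢(Space d × Space d, ℂ)) : 𝓢(Space d × Space d, ℂ) :=
  -∂_{modeVec ε i} φ + modeMul a ε i φ

lemma modeLower_apply (a ε : ℝ) (i : Fin d) (φ : 𝓢(Space d × Space d, ℂ))
    (x : Space d × Space d) : modeLower a ε i φ x =
      fderiv ℝ φ x (modeVec ε i) + ((a * modeCoord ε i x : ℝ) : ℂ) * φ x := by
  rw [modeLower, add_apply, modeMul_apply, SchwartzMap.lineDerivOp_apply_eq_fderiv]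

/-- The commutator of derivative and coordinate is a(1 + ε²), that is 2a for ε = ±1; it is the
source of the zero-point energy. -/
lemma modeRaise_modeLower (a ε : ℝ) (i : Fin d) (φ : 𝓢(Space d × Space d, ℂ))
    (x : Space d × Space d) : modeRaise a ε i (modeLower a ε i φ) x =
      -(∂_{modeVec ε i} (∂_{modeVec ε i} φ)) x - ((a * (1 + ε * ε) : ℝ) : ℂ) * φ x +
        ((a ^ 2 * modeCoord ε i x ^ 2 : ℝ) : ℂ) * φ x := by
  have h : (∂_{modeVec ε i} (modeMul a ε i φ)) x = ((a * (1 + ε * ε) : ℝ) : ℂ) * φ x +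
      ((a * modeCoord ε i x : ℝ) : ℂ) * (∂_{modeVec ε i} φ) x := by
    have h1 : HasFDerivAt (fun y => a • modeCoord ε i y) (a • modeCoord ε i) x :=
      (modeCoord ε i).hasFDerivAt.const_smul a
    have h2 := h1.smul (φ.hasFDerivAt x)
    have e : (modeMul a ε i φ : Space d × Space d → ℂ) =
        fun y => (a • modeCoord ε i y) • φ y := by
      funext y
      rw [modeMul_apply, smul_eq_mul, Complex.real_smul]
    have h3 : fderiv ℝ (fun y => (a • modeCoord ε i y) • φ y) x = _ := h2.fderiv
    rw [SchwartzMap.lineDerivOp_apply_eq_fderiv, e, h3, SchwartzMap.lineDerivOp_apply_eq_fderiv,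
      ← modeCoord_modeVec ε i]
    simp only [add_apply, smul_apply, ContinuousLinearMap.smulRight_apply, smul_eq_mul,
      Complex.real_smul]
    ring
  rw [modeRaise, add_apply, neg_apply, modeMul_apply]
  conv_lhs => rw [modeLower, LineDeriv.lineDerivOp_add]
  simp only [add_apply, h, modeMul_apply]
  push_cast
  ring

/-- Creation is the adjoint of annihilation, by parts. The real inner product on ℂ suffices because
only real parts of energies are compared. -/
lemma integral_inner_modeRaise (a ε : ℝ) (i : Fin d) (φ ψ : 𝓢(Space d × Space d, ℂ)) :
    ∫ x, inner ℝ (φ x) (modeRaise a ε i ψ x) = ∫ x, inner ℝ (modeLower a ε i φ x) (ψ x) := by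
  have hint : ∀ f g : 𝓢(Space d × Space d, ℂ), Integrable fun x => inner ℝ (f x) (g x) :=
    fun f g => (SchwartzMap.pairing (innerSL ℝ) f g).integrable
  have h := SchwartzMap.integral_bilinear_lineDerivOp_right_eq_neg_left
    (μ := (volume : Measure (Space d × Space d))) φ ψ (innerSL ℝ) (modeVec ε i)
  change ∫ x, inner ℝ (φ x) ((∂_{modeVec ε i} ψ) x) =
    -∫ x, inner ℝ ((∂_{modeVec ε i} φ) x) (ψ x) at h
  have e1 : ∀ x, inner ℝ (φ x) (modeRaise a ε i ψ x) =
      -inner ℝ (φ x) ((∂_{modeVec ε i} ψ) x) + inner ℝ (φ x) (modeMul a ε i ψ x) := by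
    intro x
    rw [modeRaise, add_apply, neg_apply, inner_add_right, inner_neg_right]
  have e2 : ∀ x, inner ℝ (modeLower a ε i φ x) (ψ x) =
      inner ℝ ((∂_{modeVec ε i} φ) x) (ψ x) + inner ℝ (φ x) (modeMul a ε i ψ x) := by
    intro x
    rw [modeLower, add_apply, inner_add_left, modeMul_apply, modeMul_apply,
      ← Complex.real_smul, ← Complex.real_smul, real_inner_smul_left, real_inner_smul_right]
  simp only [e1, e2]
  rw [integral_add (hint _ _).fun_neg (hint _ _), integral_add (hint _ _) (hint _ _), integral_neg, h,
    neg_neg]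

lemma laplacian_eq_sum_fderiv {f : Space d → ℂ} (hf : ContDiff ℝ 2 f) (x : Space d) :
    Laplacian.laplacian f x = ∑ i : Fin d,
      fderiv ℝ (fun y => fderiv ℝ f y (EuclideanSpace.single i 1)) x
        (EuclideanSpace.single i 1) := by
  rw [congrFun (InnerProductSpace.laplacian_eq_iteratedFDeriv_orthonormalBasis f
    (EuclideanSpace.basisFun (Fin d) ℝ)) x]
  refine Finset.sum_congr rfl fun i _ => ?_
  have hd : DifferentiableAt ℝ (fderiv ℝ f) x :=
    (hf.fderiv_right (m := 1) (by norm_num)).differentiable (by simp) x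
  rw [iteratedFDeriv_two_apply, fderiv_clm_apply hd (differentiableAt_const _)]
  simp

lemma fderiv_slice_left (φ : 𝓢(Space d × Space d, ℂ)) (x y v : Space d) :
    fderiv ℝ (fun z => φ (z, y)) x v = (∂_{((v, 0) : Space d × Space d)} φ) (x, y) := by
  have h : HasFDerivAt (fun z => φ (z, y)) _ x :=
    (φ.hasFDerivAt (x, y)).comp x (hasFDerivAt_prodMk_left x y)
  rw [h.fderiv, SchwartzMap.lineDerivOp_apply_eq_fderiv]
  simp

lemma fderiv_slice_right (φ : 𝓢(Space d × Space d, ℂ)) (x y v : Space d) :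
    fderiv ℝ (fun z => φ (x, z)) y v = (∂_{((0, v) : Space d × Space d)} φ) (x, y) := by
  have h : HasFDerivAt (fun z => φ (x, z)) _ y :=
    (φ.hasFDerivAt (x, y)).comp y (hasFDerivAt_prodMk_right x y)
  rw [h.fderiv, SchwartzMap.lineDerivOp_apply_eq_fderiv]
  simp

/-- The mixed derivatives of the directions ε = 1 and ε = -1 cancel, so the normal directions
diagonalize the kinetic energy. -/
lemma lineDeriv_modeVec_modeVec (φ : 𝓢(Space d × Space d, ℂ)) (i : Fin d) :
    ∂_{modeVec 1 i} (∂_{modeVec 1 i} φ) + ∂_{modeVec (-1) i} (∂_{modeVec (-1) i} φ) =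
      (2 : ℝ) • (∂_{((EuclideanSpace.single i 1, 0) : Space d × Space d)}
        (∂_{((EuclideanSpace.single i 1, 0) : Space d × Space d)} φ) +
      ∂_{((0, EuclideanSpace.single i 1) : Space d × Space d)}
        (∂_{((0, EuclideanSpace.single i 1) : Space d × Space d)} φ)) := by
  have h : ∀ ε : ℝ, modeVec ε i = ((EuclideanSpace.single i 1, 0) : Space d × Space d) +
      ε • ((0, EuclideanSpace.single i 1) : Space d × Space d) := by
    intro ε; simp [modeVec]
  simp only [h, LineDeriv.lineDerivOp_left_add, LineDeriv.lineDerivOp_left_smul,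
    LineDeriv.lineDerivOp_add, LineDeriv.lineDerivOp_smul]
  module

/-- The potential is ω²|q₁+q₂|²/4 + μ²|q₁-q₂|²/4: two independent oscillators per axis, each
completed to a square. -/
lemma hamiltonian_eq {ω k : ℝ} (hk : k < ω ^ 2) (φ : 𝓢(Space d × Space d, ℂ))
    (x : Space d × Space d) :
    hamiltonian ω k φ x = (1 / 4 : ℂ) * ∑ i : Fin d, (modeRaise ω 1 i (modeLower ω 1 i φ) x +
      modeRaise (relFreq ω k) (-1) i (modeLower (relFreq ω k) (-1) i φ) x) +
      ((d * (ω + relFreq ω k) / 2 : ℝ) : ℂ) * φ x := by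
  have h1 : Laplacian.laplacian (fun y : Space d => φ (y, x.2)) x.1 = ∑ i : Fin d,
      (∂_{((EuclideanSpace.single i 1, 0) : Space d × Space d)}
        (∂_{((EuclideanSpace.single i 1, 0) : Space d × Space d)} φ)) x := by
    rw [laplacian_eq_sum_fderiv]
    · simp only [fderiv_slice_left]
    · exact (φ.smooth 2).comp (contDiff_prodMk_left x.2)
  have h2 : Laplacian.laplacian (fun y : Space d => φ (x.1, y)) x.2 = ∑ i : Fin d,
      (∂_{((0, EuclideanSpace.single i 1) : Space d × Space d)}
        (∂_{((0, EuclideanSpace.single i 1) : Space d × Space d)} φ)) x := by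
    rw [laplacian_eq_sum_fderiv]
    · simp only [fderiv_slice_right]
    · exact (φ.smooth 2).comp (contDiff_prodMk_right x.1)
  have h3 : ω ^ 2 / 2 * (‖x.1‖ ^ 2 + ‖x.2‖ ^ 2) - k / 4 * ‖x.1 - x.2‖ ^ 2 =
      ∑ i : Fin d, (ω ^ 2 / 4 * modeCoord 1 i x ^ 2 +
        relFreq ω k ^ 2 / 4 * modeCoord (-1) i x ^ 2) := by
    rw [relFreq_sq hk]
    simp only [EuclideanSpace.norm_sq_eq, Real.norm_eq_abs, sq_abs, PiLp.sub_apply,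
      modeCoord_apply, Finset.mul_sum, ← Finset.sum_add_distrib, ← Finset.sum_sub_distrib]
    exact Finset.sum_congr rfl fun i _ => by ring
  have h4 : ((d * (ω + relFreq ω k) / 2 : ℝ) : ℂ) * φ x =
      ∑ _i : Fin d, (((ω + relFreq ω k) / 2 : ℝ) : ℂ) * φ x := by
    rw [Finset.sum_const, Finset.card_univ, Fintype.card_fin, nsmul_eq_mul]
    push_cast
    ring
  rw [hamiltonian, h1, h2, h3, h4, Complex.ofReal_sum, Finset.mul_sum, Finset.mul_sum,
    Finset.mul_sum, Finset.sum_mul, ← Finset.sum_sub_distrib, ← Finset.sum_add_distrib,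
    ← Finset.sum_add_distrib]
  refine Finset.sum_congr rfl fun i _ => ?_
  have h5 := congrArg (fun f : 𝓢(Space d × Space d, ℂ) => f x) (lineDeriv_modeVec_modeVec φ i)
  simp only [add_apply, smul_apply, Complex.real_smul] at h5
  rw [modeRaise_modeLower, modeRaise_modeLower]
  push_cast at h5 ⊢
  linear_combination (1 / 4 : ℂ) * h5

end factorization

/-! ### Ground states -/

section groundState

variable {d : ℕ}

/-- The energy of a component of a wave function above the ground state energy. -/
def excitationEnergy (a b : ℝ) (φ : 𝓢(Space d × Space d, ℂ)) : ℝ :=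
  1 / 4 * ∑ i : Fin d, ((∫ x, ‖modeLower a 1 i φ x‖ ^ 2) + ∫ x, ‖modeLower b (-1) i φ x‖ ^ 2)

lemma excitationEnergy_nonneg (a b : ℝ) (φ : 𝓢(Space d × Space d, ℂ)) :
    0 ≤ excitationEnergy a b φ :=
  mul_nonneg (by norm_num) (Finset.sum_nonneg fun _ _ => add_nonneg
    (integral_nonneg fun _ => by positivity) (integral_nonneg fun _ => by positivity))

lemma integral_conj_mul_hamiltonian {ω k : ℝ} (hk : k < ω ^ 2) (φ : 𝓢(Space d × Space d, ℂ)) :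
    (∫ x, conj (φ x) * hamiltonian ω k φ x).re =
      excitationEnergy ω (relFreq ω k) φ + d * (ω + relFreq ω k) / 2 * ∫ x, ‖φ x‖ ^ 2 := by
  have hint : ∀ f g : 𝓢(Space d × Space d, ℂ), Integrable fun x => inner ℝ (f x) (g x) :=
    fun f g => (SchwartzMap.pairing (innerSL ℝ) f g).integrable
  -- Hφ packaged as a Schwartz function, so that integrability of the pairings is automatic.
  let ψ : 𝓢(Space d × Space d, ℂ) := (1 / 4 : ℝ) • ∑ i : Fin d, (modeRaise ω 1 i
    (modeLower ω 1 i φ) + modeRaise (relFreq ω k) (-1) i (modeLower (relFreq ω k) (-1) i φ)) +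
      (d * (ω + relFreq ω k) / 2 : ℝ) • φ
  have hψ : ∀ x, hamiltonian ω k φ x = ψ x := by
    intro x
    simp only [hamiltonian_eq hk, ψ, add_apply, smul_apply, sum_apply,
      Complex.real_smul]
    push_cast
    ring
  have hi : Integrable fun x => conj (φ x) * ψ x :=
    (SchwartzMap.pairing ((ContinuousLinearMap.mul ℝ ℂ).comp
      (Complex.conjCLE : ℂ →L[ℝ] ℂ)) φ ψ).integrable
  rw [integral_congr_ae (Filter.Eventually.of_forall fun x => by rw [hψ])]
  rw [← RCLike.re_eq_complex_re, ← integral_re hi]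
  have e : ∀ x, RCLike.re (conj (φ x) * ψ x) = 1 / 4 * ∑ i : Fin d,
      (inner ℝ (φ x) (modeRaise ω 1 i (modeLower ω 1 i φ) x) +
      inner ℝ (φ x) (modeRaise (relFreq ω k) (-1) i (modeLower (relFreq ω k) (-1) i φ) x)) +
      (d * (ω + relFreq ω k) / 2) * inner ℝ (φ x) (φ x) := by
    intro x
    rw [RCLike.re_eq_complex_re, mul_comm, ← Complex.inner]
    simp only [ψ, add_apply, smul_apply, sum_apply,
      inner_add_right, inner_smul_right, inner_sum]
  simp only [e]
  have h2 : ∀ i : Fin d, Integrable fun x => inner ℝ (φ x) (modeRaise ω 1 i (modeLower ω 1 i φ) x) +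
      inner ℝ (φ x) (modeRaise (relFreq ω k) (-1) i (modeLower (relFreq ω k) (-1) i φ) x) :=
    fun i => (hint _ _).add (hint _ _)
  rw [integral_add ((integrable_finsetSum _ fun i _ => h2 i).const_mul _) ((hint _ _).const_mul _),
    integral_const_mul, integral_const_mul, integral_finsetSum _ fun i _ => h2 i,
    excitationEnergy]
  simp only [integral_add (hint _ _) (hint _ _), integral_inner_modeRaise,
    real_inner_self_eq_norm_sq]

lemma modeCoord_modeVec_of_ne (ε ε' : ℝ) {i j : Fin d} (h : i ≠ j) :
    modeCoord ε i (modeVec ε' j) = 0 := by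
  simp [modeCoord_apply, modeVec, h]

lemma pairForm_eq_sum (a b : ℝ) (x : Space d × Space d) :
    pairForm a b x = ∑ i : Fin d, (a / 4 * modeCoord 1 i x ^ 2 + b / 4 * modeCoord (-1) i x ^ 2) := by
  unfold pairForm
  simp only [EuclideanSpace.norm_sq_eq, Real.norm_eq_abs, sq_abs, PiLp.sub_apply, PiLp.add_apply,
    modeCoord_apply, Finset.mul_sum, ← Finset.sum_add_distrib]
  exact Finset.sum_congr rfl fun i _ => by ring

lemma hasFDerivAt_pairForm (a b : ℝ) (x : Space d × Space d) :
    HasFDerivAt (pairForm a b) (∑ i : Fin d, ((a / 2 * modeCoord 1 i x) • modeCoord 1 i +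
      (b / 2 * modeCoord (-1) i x) • modeCoord (-1) i)) x := by
  have e : pairForm a b = fun x : Space d × Space d => ∑ i : Fin d,
      (a / 4 * modeCoord 1 i x ^ 2 + b / 4 * modeCoord (-1) i x ^ 2) :=
    funext (pairForm_eq_sum a b)
  rw [e]
  refine HasFDerivAt.fun_sum fun i _ => ?_
  have h : ∀ c ε : ℝ, HasFDerivAt (fun y => c / 4 * modeCoord ε i y ^ 2)
      ((c / 2 * modeCoord ε i x) • modeCoord ε i) x := by
    intro c ε
    have := ((modeCoord ε i).hasFDerivAt (x := x)).pow 2 |>.const_mul (c / 4)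
    refine this.congr_fderiv ?_
    refine ContinuousLinearMap.ext fun v => ?_
    simp only [smul_apply, smul_eq_mul, nsmul_eq_mul]
    push_cast
    ring
  exact (h a 1).add (h b (-1))

/-- The mode derivative of the exponent Q is the multiplier in the annihilation operator, which
therefore equals exp(-Q) ∂ exp(Q). -/
lemma fderiv_pairForm_modeVec (a b : ℝ) (x : Space d × Space d) (i : Fin d) :
    fderiv ℝ (pairForm a b) x (modeVec 1 i) = a * modeCoord 1 i x ∧
      fderiv ℝ (pairForm a b) x (modeVec (-1) i) = b * modeCoord (-1) i x := by
  rw [(hasFDerivAt_pairForm a b x).fderiv]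
  simp only [sum_apply, add_apply, smul_apply, smul_eq_mul]
  constructor
  · rw [Finset.sum_eq_single i (fun j _ hj => by simp [modeCoord_modeVec_of_ne _ _ hj])
      (by simp), modeCoord_modeVec]
    have : modeCoord (-1) i (modeVec 1 i) = 0 := by simp [modeCoord_apply, modeVec]
    rw [this]; ring
  · rw [Finset.sum_eq_single i (fun j _ hj => by simp [modeCoord_modeVec_of_ne _ _ hj])
      (by simp), modeCoord_modeVec]
    have : modeCoord 1 i (modeVec (-1) i) = 0 := by simp [modeCoord_apply, modeVec]
    rw [this]; ring

lemma clm_eq_of_modeVec {F : Type*} [NormedAddCommGroup F] [NormedSpace ℝ F]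
    {L M : Space d × Space d →L[ℝ] F} (h1 : ∀ i, L (modeVec 1 i) = M (modeVec 1 i))
    (h2 : ∀ i, L (modeVec (-1) i) = M (modeVec (-1) i)) : L = M := by
  refine ContinuousLinearMap.ext fun x => ?_
  have e : x = ∑ i : Fin d, ((1 / 2 * (x.1 i + x.2 i)) • modeVec 1 i +
      (1 / 2 * (x.1 i - x.2 i)) • modeVec (-1) i) := by
    ext j
    · simp [modeVec, Prod.fst_sum, Pi.single_apply, Finset.sum_add_distrib]
      ring
    · simp [modeVec, Prod.snd_sum, Pi.single_apply, Finset.sum_add_distrib]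
      ring
  rw [e]
  simp only [map_sum, map_add, map_smul, h1, h2]

lemma modeLower_pairGaussian {a b : ℝ} (ha : 0 < a) (hb : 0 < b) (i : Fin d) :
    modeLower a 1 i (pairGaussian ha hb) = 0 ∧ modeLower b (-1) i (pairGaussian ha hb) = 0 := by
  have h : ∀ x, HasFDerivAt (pairGaussian ha hb : Space d × Space d → ℂ) _ x := fun x =>
    (Complex.ofRealCLM.hasFDerivAt).comp x (hasFDerivAt_pairForm a b x).neg.exp
  have e := fun x => fderiv_pairForm_modeVec a b x i
  constructor
  · ext x
    rw [modeLower_apply, (h x).fderiv, ← (e x).1, (hasFDerivAt_pairForm a b x).fderiv,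
      pairGaussian_apply]
    simp
    ring
  · ext x
    rw [modeLower_apply, (h x).fderiv, ← (e x).2, (hasFDerivAt_pairForm a b x).fderiv,
      pairGaussian_apply]
    simp
    ring

/-- With the integrating factor exp(Q), all mode derivatives of exp(Q)φ vanish; the modes span the
configuration space, so this function is constant. -/
lemma eq_smul_pairGaussian {a b : ℝ} (ha : 0 < a) (hb : 0 < b) (φ : 𝓢(Space d × Space d, ℂ))
    (h1 : ∀ i, modeLower a 1 i φ = 0) (h2 : ∀ i, modeLower b (-1) i φ = 0) :
    ∃ c : ℂ, φ = c • pairGaussian ha hb := by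
  have hd : ∀ x, HasFDerivAt (fun y => Real.exp (pairForm a b y) • φ y)
      (0 : Space d × Space d →L[ℝ] ℂ) x := by
    intro x
    have hQ := hasFDerivAt_pairForm a b x
    refine (hQ.exp.smul (φ.hasFDerivAt x)).congr_fderiv ?_
    rw [← hQ.fderiv]
    have e := fun i => fderiv_pairForm_modeVec a b x i
    refine clm_eq_of_modeVec (fun i => ?_) fun i => ?_
    · have := congrArg (fun f : 𝓢(Space d × Space d, ℂ) => f x) (h1 i)
      simp only [modeLower_apply, ← (e i).1] at this
      have h0 : (0 : 𝓢(Space d × Space d, ℂ)) x = 0 := rfl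
      rw [h0] at this
      simp only [add_apply, smul_apply, ContinuousLinearMap.smulRight_apply, smul_eq_mul,
        Complex.real_smul, zero_apply]
      push_cast
      linear_combination (Complex.exp (pairForm a b x)) * this
    · have := congrArg (fun f : 𝓢(Space d × Space d, ℂ) => f x) (h2 i)
      simp only [modeLower_apply, ← (e i).2] at this
      have h0 : (0 : 𝓢(Space d × Space d, ℂ)) x = 0 := rfl
      rw [h0] at this
      simp only [add_apply, smul_apply, ContinuousLinearMap.smulRight_apply, smul_eq_mul,
        Complex.real_smul, zero_apply]
      push_cast
      linear_combination (Complex.exp (pairForm a b x)) * this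
  have hc := is_const_of_fderiv_eq_zero (𝕜 := ℝ) (fun x => (hd x).differentiableAt)
    (fun x => (hd x).fderiv)
  refine ⟨Real.exp (pairForm a b (0 : Space d × Space d)) • φ 0, ?_⟩
  ext x
  rw [smul_apply, pairGaussian_apply, hc 0 x, Complex.real_smul, smul_eq_mul, mul_right_comm,
    ← Complex.ofReal_mul, ← Real.exp_add]
  simp

end groundState

/-! ### The spin singlet; existence and uniqueness of the ground state -/

section singletState

variable {d : ℕ}

lemma spin_cases (σ : Fin 2) : σ = 0 ∨ σ = 1 := by omega

lemma singlet_swap (σ₁ σ₂ : Spin) : singlet σ₂ σ₁ = -singlet σ₁ σ₂ := by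
  obtain rfl | rfl : σ₁ = 0 ∨ σ₁ = 1 := spin_cases σ₁
  all_goals obtain rfl | rfl : σ₂ = 0 ∨ σ₂ = 1 := spin_cases σ₂
  all_goals simp [singlet]

/-- The partial trace of the singlet is half the identity; the 1/2 cancels the particle number 2 in
`oneBody`. -/
lemma sum_singlet_mul_singlet (σ σ' : Spin) :
    ∑ τ, singlet σ τ * singlet σ' τ = if σ = σ' then 1 / 2 else 0 := by
  have h : (√2)⁻¹ * (√2)⁻¹ = (2 : ℝ)⁻¹ := by
    rw [← mul_inv, Real.mul_self_sqrt (by norm_num)]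
  obtain rfl | rfl : σ = 0 ∨ σ = 1 := spin_cases σ
  all_goals obtain rfl | rfl : σ' = 0 ∨ σ' = 1 := spin_cases σ'
  all_goals simp [singlet, h]

/-- The singlet wave functions with Gaussian orbital part. -/
def singletWave {a b : ℝ} (ha : 0 < a) (hb : 0 < b) (c : ℂ) : SpinorWave d :=
  fun σ₁ σ₂ => (c * singlet σ₁ σ₂) • pairGaussian ha hb

lemma singletWave_apply {a b : ℝ} (ha : 0 < a) (hb : 0 < b) (c : ℂ) (σ₁ σ₂ : Spin)
    (x : Space d × Space d) : singletWave ha hb c σ₁ σ₂ x =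
      c * singlet σ₁ σ₂ * ((Real.exp (-pairForm a b x) : ℝ) : ℂ) := rfl

lemma pairForm_swap (a b : ℝ) (x y : Space d) : pairForm a b (y, x) = pairForm a b (x, y) := by
  simp only [pairForm, add_comm y x, norm_sub_rev y x]

lemma isFermionic_singletWave {a b : ℝ} (ha : 0 < a) (hb : 0 < b) (c : ℂ) :
    IsFermionic (d := d) (singletWave ha hb c) := by
  intro σ₁ σ₂ x y
  rw [singletWave_apply, singletWave_apply, pairForm_swap, singlet_swap]
  push_cast
  ring

/-- The squared norm of the Gaussian orbital. -/
def pairNormSq (d : ℕ) (a b : ℝ) : ℝ :=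
  ∫ x : Space d × Space d, Real.exp (-pairForm a b x) ^ 2

lemma integrable_pairGaussian_sq {a b : ℝ} (ha : 0 < a) (hb : 0 < b) :
    Integrable fun x : Space d × Space d => Real.exp (-pairForm a b x) ^ 2 := by
  have h : Integrable fun x : Space d × Space d =>
      inner ℝ (pairGaussian ha hb x) (pairGaussian ha hb x) :=
    (SchwartzMap.pairing (innerSL ℝ) (pairGaussian ha hb) (pairGaussian ha hb)).integrable
  refine h.congr (Filter.Eventually.of_forall fun x => ?_)
  simp only [real_inner_self_eq_norm_sq, pairGaussian_apply, Complex.norm_real, Real.norm_eq_abs,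
    sq_abs]

lemma pairNormSq_pos {a b : ℝ} (ha : 0 < a) (hb : 0 < b) : 0 < pairNormSq d a b := by
  rw [pairNormSq, integral_pos_iff_support_of_nonneg (fun x => by positivity)
    (integrable_pairGaussian_sq ha hb)]
  have : (Function.support fun x : Space d × Space d => Real.exp (-pairForm a b x) ^ 2) =
      Set.univ := by
    ext x
    simp [Real.exp_ne_zero]
  rw [this]
  exact Measure.measure_univ_pos.2 (NeZero.ne _)

lemma sum_integral_norm_sq_singletWave {a b : ℝ} (ha : 0 < a) (hb : 0 < b) (c : ℂ) :
    ∑ σ₁, ∑ σ₂, ∫ x : Space d × Space d, ‖singletWave ha hb c σ₁ σ₂ x‖ ^ 2 =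
      ‖c‖ ^ 2 * pairNormSq d a b := by
  have h : ∀ σ₁ σ₂, ∫ x : Space d × Space d, ‖singletWave ha hb c σ₁ σ₂ x‖ ^ 2 =
      ‖c‖ ^ 2 * pairNormSq d a b * (singlet σ₁ σ₂ * singlet σ₁ σ₂) := by
    intro σ₁ σ₂
    have : ∀ x : Space d × Space d, ‖singletWave ha hb c σ₁ σ₂ x‖ ^ 2 =
        ‖c‖ ^ 2 * (singlet σ₁ σ₂ * singlet σ₁ σ₂) * Real.exp (-pairForm a b x) ^ 2 := by
      intro x
      rw [singletWave_apply, norm_mul, norm_mul, Complex.norm_real, Complex.norm_real, mul_pow,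
        mul_pow, Real.norm_eq_abs, Real.norm_eq_abs, sq_abs, sq_abs, sq (singlet σ₁ σ₂)]
    simp only [this]
    rw [integral_const_mul, pairNormSq]
    ring
  simp only [h, ← Finset.mul_sum, sum_singlet_mul_singlet]
  simp

lemma modeLower_smul (a ε : ℝ) (i : Fin d) (c : ℂ) (φ : 𝓢(Space d × Space d, ℂ)) :
    modeLower a ε i (c • φ) = c • modeLower a ε i φ := by
  ext x
  rw [modeLower, LineDeriv.lineDerivOp_smul, modeLower, smul_add]
  simp only [add_apply, smul_apply, modeMul_apply, smul_eq_mul]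
  ring

lemma modeRaise_zero (a ε : ℝ) (i : Fin d) : modeRaise a ε i 0 = 0 := by
  rw [modeRaise, modeMul, LineDeriv.lineDerivOp_zero, map_zero, neg_zero, add_zero]

lemma hamiltonian_singletWave {ω k : ℝ} (hω : 0 < ω) (hk : k < ω ^ 2) (c : ℂ) (σ₁ σ₂ : Spin)
    (x : Space d × Space d) :
    hamiltonian ω k (singletWave hω (relFreq_pos hk) c σ₁ σ₂) x =
      ((d * (ω + relFreq ω k) / 2 : ℝ) : ℂ) * singletWave hω (relFreq_pos hk) c σ₁ σ₂ x := by
  rw [hamiltonian_eq hk, Finset.sum_eq_zero, mul_zero, zero_add]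
  intro i _
  rw [singletWave, modeLower_smul, modeLower_smul,
    (modeLower_pairGaussian hω (relFreq_pos hk) i).1,
    (modeLower_pairGaussian hω (relFreq_pos hk) i).2, smul_zero, modeRaise_zero, modeRaise_zero]
  exact add_zero _

lemma expectedEnergy_eq {ω k : ℝ} (hk : k < ω ^ 2) {Φ : SpinorWave d} (h : IsNormalized Φ) :
    expectedEnergy ω k Φ = (∑ σ₁, ∑ σ₂, excitationEnergy ω (relFreq ω k) (Φ σ₁ σ₂)) +
      d * (ω + relFreq ω k) / 2 := by
  simp only [expectedEnergy, Complex.re_sum, integral_conj_mul_hamiltonian hk,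
    Finset.sum_add_distrib, ← Finset.mul_sum]
  rw [IsNormalized] at h
  rw [h, mul_one]

lemma expectedEnergy_of_eigen {ω k E : ℝ} {Ψ : SpinorWave d} (hn : IsNormalized Ψ)
    (h : ∀ σ₁ σ₂ x, hamiltonian ω k (Ψ σ₁ σ₂) x = (E : ℂ) * Ψ σ₁ σ₂ x) :
    expectedEnergy ω k Ψ = E := by
  have e : ∀ σ₁ σ₂, ∫ x, conj (Ψ σ₁ σ₂ x) * hamiltonian ω k (Ψ σ₁ σ₂) x =
      ((E * ∫ x, ‖Ψ σ₁ σ₂ x‖ ^ 2 : ℝ) : ℂ) := by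
    intro σ₁ σ₂
    rw [← integral_const_mul]
    refine Eq.trans ?_ (integral_ofReal (𝕜 := ℂ))
    refine integral_congr_ae (Filter.Eventually.of_forall fun x => ?_)
    simp only [h]
    rw [mul_left_comm, Complex.conj_mul']
    push_cast
    rfl
  simp only [expectedEnergy, e, ← Complex.ofReal_sum, ← Finset.mul_sum, Complex.ofReal_re]
  rw [IsNormalized] at hn
  rw [hn, mul_one]

lemma isGroundState_singletWave {ω k : ℝ} (hω : 0 < ω) (hk : k < ω ^ 2) {c : ℂ}
    (hc : ‖c‖ ^ 2 * pairNormSq d ω (relFreq ω k) = 1) :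
    IsGroundState ω k (singletWave (d := d) hω (relFreq_pos hk) c) := by
  refine ⟨isFermionic_singletWave _ _ _, ?_, d * (ω + relFreq ω k) / 2,
    hamiltonian_singletWave hω hk c, fun Φ _ hΦ => ?_⟩
  · rw [IsNormalized, sum_integral_norm_sq_singletWave, hc]
  · rw [expectedEnergy_eq hk hΦ, le_add_iff_nonneg_left]
    exact Finset.sum_nonneg fun _ _ => Finset.sum_nonneg fun _ _ => excitationEnergy_nonneg _ _ _

theorem exists_isGroundState (d : ℕ) {ω k : ℝ} (hω : 0 < ω) (hk : k < ω ^ 2) :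
    ∃ c : ℂ, IsGroundState ω k (singletWave (d := d) hω (relFreq_pos hk) c) := by
  have hN := pairNormSq_pos (d := d) hω (relFreq_pos hk)
  refine ⟨((√(pairNormSq d ω (relFreq ω k)))⁻¹ : ℝ), isGroundState_singletWave hω hk ?_⟩
  rw [Complex.norm_real, Real.norm_eq_abs, sq_abs, inv_pow, Real.sq_sqrt hN.le,
    inv_mul_cancel₀ hN.ne']

/-- A vanishing sum of squared norms makes each term vanish almost everywhere, hence everywhere by
continuity. -/
lemma modeLower_eq_zero_of_excitationEnergy {a b : ℝ} {φ : 𝓢(Space d × Space d, ℂ)}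
    (h : excitationEnergy a b φ = 0) (i : Fin d) :
    modeLower a 1 i φ = 0 ∧ modeLower b (-1) i φ = 0 := by
  have hn : ∀ ψ : 𝓢(Space d × Space d, ℂ), 0 ≤ ∫ x, ‖ψ x‖ ^ 2 :=
    fun ψ => integral_nonneg fun _ => by positivity
  have hz : ∀ ψ : 𝓢(Space d × Space d, ℂ), ∫ x, ‖ψ x‖ ^ 2 = 0 → ψ = 0 := by
    intro ψ h0
    have hi : Integrable fun x => inner ℝ (ψ x) (ψ x) :=
      (SchwartzMap.pairing (innerSL ℝ) ψ ψ).integrable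
    simp only [real_inner_self_eq_norm_sq] at hi
    have hc : Continuous fun x => ‖ψ x‖ ^ 2 := by fun_prop
    have := (integral_eq_zero_iff_of_nonneg (fun x => by positivity) hi).1 h0
    have := (hc.ae_eq_iff_eq volume continuous_const).1 this
    ext x
    exact norm_eq_zero.1 (pow_eq_zero_iff two_ne_zero |>.1 (congrFun this x))
  rw [excitationEnergy, mul_eq_zero, or_iff_right (by norm_num),
    Finset.sum_eq_zero_iff_of_nonneg fun i _ => add_nonneg (hn _) (hn _)] at h
  have h' := (add_eq_zero_iff_of_nonneg (hn _) (hn _)).1 (h i (Finset.mem_univ i))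
  exact ⟨hz _ h'.1, hz _ h'.2⟩

/-- Comparison with the explicit singlet leaves no excitation energy, so each component is a
multiple of the same symmetric Gaussian. The Pauli principle then acts on the 2 × 2 coefficient
matrix alone, and antisymmetric matrices of this size form a line. -/
theorem IsGroundState.eq_singletWave {ω k : ℝ} (hω : 0 < ω) (hk : k < ω ^ 2)
    {Ψ : SpinorWave d} (h : IsGroundState ω k Ψ) :
    ∃ c : ℂ, ‖c‖ ^ 2 * pairNormSq d ω (relFreq ω k) = 1 ∧
      Ψ = singletWave hω (relFreq_pos hk) c := by
  obtain ⟨hf, hn, E, hE, hmin⟩ := h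
  have hμ := relFreq_pos hk
  obtain ⟨c₀, hc₀⟩ := exists_isGroundState d hω hk
  have hle := hmin _ hc₀.1 hc₀.2.1
  rw [expectedEnergy_of_eigen hc₀.2.1 (hamiltonian_singletWave hω hk c₀),
    ← expectedEnergy_of_eigen hn hE, expectedEnergy_eq hk hn, add_le_iff_nonpos_left] at hle
  have hpos : ∀ σ₁ σ₂, 0 ≤ excitationEnergy ω (relFreq ω k) (Ψ σ₁ σ₂) :=
    fun _ _ => excitationEnergy_nonneg _ _ _
  have hzero : ∀ σ₁ σ₂, excitationEnergy ω (relFreq ω k) (Ψ σ₁ σ₂) = 0 := by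
    intro σ₁ σ₂
    have h1 := Finset.single_le_sum (f := fun σ₁ =>
      ∑ σ₂, excitationEnergy ω (relFreq ω k) (Ψ σ₁ σ₂))
      (fun σ _ => Finset.sum_nonneg fun τ _ => hpos σ τ) (Finset.mem_univ σ₁)
    have h2 := Finset.single_le_sum (f := fun σ₂ =>
      excitationEnergy ω (relFreq ω k) (Ψ σ₁ σ₂))
      (fun τ _ => hpos σ₁ τ) (Finset.mem_univ σ₂)
    exact le_antisymm (h2.trans (h1.trans hle)) (hpos _ _)
  choose c hc using fun σ₁ σ₂ => eq_smul_pairGaussian hω hμ (Ψ σ₁ σ₂)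
    (fun i => (modeLower_eq_zero_of_excitationEnergy (hzero σ₁ σ₂) i).1)
    (fun i => (modeLower_eq_zero_of_excitationEnergy (hzero σ₁ σ₂) i).2)
  have hanti : ∀ σ₁ σ₂, c σ₂ σ₁ = -c σ₁ σ₂ := by
    intro σ₁ σ₂
    -- At the origin the Gaussian equals 1, which exposes the coefficients.
    have := hf σ₁ σ₂ 0 0
    rw [hc, hc σ₁ σ₂] at this
    simpa [pairGaussian_apply, pairForm] using this
  have hdiag : ∀ σ, c σ σ = 0 := fun σ => by
    have := hanti σ σ
    linear_combination (1 / 2 : ℂ) * this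
  have h2 : ((√2 : ℝ) : ℂ) * ((√2 : ℝ) : ℂ)⁻¹ = 1 :=
    mul_inv_cancel₀ (by simp)
  have hΨ : Ψ = singletWave hω hμ (√2 * c 0 1) := by
    funext σ₁ σ₂
    rw [hc, singletWave]
    congr 1
    obtain rfl | rfl : σ₁ = 0 ∨ σ₁ = 1 := spin_cases σ₁
    all_goals obtain rfl | rfl : σ₂ = 0 ∨ σ₂ = 1 := spin_cases σ₂
    · simp [singlet, hdiag]
    · simp [singlet]
      linear_combination -c 0 1 * h2
    · simp [singlet, hanti 0 1]
      linear_combination -c 0 1 * h2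
    · simp [singlet, hdiag]
  refine ⟨√2 * c 0 1, ?_, hΨ⟩
  rw [← sum_integral_norm_sq_singletWave hω hμ, ← hΨ]
  exact hn

end singletState

/-! ### The Wigner function of the ground state -/

section wignerFunction

variable {d : ℕ}

/-- Half the sum and half the difference of two vectors. -/
def halfSumDiff (d : ℕ) : (Space d × Space d) ≃L[ℝ] (Space d × Space d) :=
  ContinuousLinearEquiv.equivOfInverse
    (((1 / 2 : ℝ) • (ContinuousLinearMap.fst ℝ (Space d) (Space d) +
      ContinuousLinearMap.snd ℝ (Space d) (Space d))).prod
      ((1 / 2 : ℝ) • (ContinuousLinearMap.fst ℝ (Space d) (Space d) -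
      ContinuousLinearMap.snd ℝ (Space d) (Space d))))
    ((ContinuousLinearMap.fst ℝ (Space d) (Space d) +
      ContinuousLinearMap.snd ℝ (Space d) (Space d)).prod
      (ContinuousLinearMap.fst ℝ (Space d) (Space d) -
      ContinuousLinearMap.snd ℝ (Space d) (Space d)))
    (fun x => by
      ext1 <;> simp [← smul_add, ← smul_sub] <;> module)
    (fun x => by
      ext1
      · simp; module
      · simp; module)

lemma halfSumDiff_apply (x : Space d × Space d) :
    halfSumDiff d x = ((1 / 2 : ℝ) • (x.1 + x.2), (1 / 2 : ℝ) • (x.1 - x.2)) := rfl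

/-- Uniqueness of Haar measure suffices: the Jacobian constant need not be known, since the
normalization will absorb it. -/
lemma exists_integral_eq_mul_comp_halfSumDiff (d : ℕ) :
    ∃ C : ℂ, ∀ f : Space d × Space d → ℂ, ∫ x, f x = C * ∫ x, f (halfSumDiff d x) := by
  have h : (Measure.map (halfSumDiff d) (volume : Measure (Space d × Space d))).IsAddHaarMeasure :=
    (halfSumDiff d).isAddHaarMeasure_map _
  refine ⟨(Measure.addHaarScalarFactor (volume : Measure (Space d × Space d))
    (Measure.map (halfSumDiff d) volume) : ℝ), fun f => ?_⟩
  conv_lhs => rw [Measure.isAddLeftInvariant_eq_smul (volume : Measure (Space d × Space d))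
    (Measure.map (halfSumDiff d) volume)]
  have hm : ∫ x, f x ∂(Measure.map (halfSumDiff d) volume) = ∫ x, f (halfSumDiff d x) :=
    (halfSumDiff d).toHomeomorph.measurableEmbedding.integral_map f
  rw [integral_smul_nnreal_measure, hm]
  rfl

lemma integral_pairGaussian_mul_exp {a b : ℝ} (ha : 0 < a) (hb : 0 < b) (p₁ p₂ : Space d) :
    ∫ z : Space d × Space d, ((Real.exp (-pairForm a b z) ^ 2 : ℝ) : ℂ) *
      Complex.exp (2 * Complex.I * ((inner ℝ p₁ z.1 + inner ℝ p₂ z.2 : ℝ) : ℂ)) =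
    ((pairNormSq d a b * Real.exp (-(‖p₁ + p₂‖ ^ 2 / (2 * a)) - ‖p₁ - p₂‖ ^ 2 / (2 * b)) : ℝ) :
      ℂ) := by
  obtain ⟨C, hC⟩ := exists_integral_eq_mul_comp_halfSumDiff d
  have key : ∀ p₁ p₂ : Space d, ∫ z : Space d × Space d, ((Real.exp (-pairForm a b z) ^ 2 : ℝ) : ℂ) *
      Complex.exp (2 * Complex.I * ((inner ℝ p₁ z.1 + inner ℝ p₂ z.2 : ℝ) : ℂ)) =
      C * ((Real.pi / ((a / 2 : ℝ) : ℂ)) ^ (Module.finrank ℝ (Space d) / 2 : ℂ) *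
        (Real.pi / ((b / 2 : ℝ) : ℂ)) ^ (Module.finrank ℝ (Space d) / 2 : ℂ)) *
        ((Real.exp (-(‖p₁ + p₂‖ ^ 2 / (2 * a)) - ‖p₁ - p₂‖ ^ 2 / (2 * b)) : ℝ) : ℂ) := by
    intro p₁ p₂
    have e : ∀ z : Space d × Space d,
        ((Real.exp (-pairForm a b (halfSumDiff d z)) ^ 2 : ℝ) : ℂ) *
        Complex.exp (2 * Complex.I * ((inner ℝ p₁ (halfSumDiff d z).1 +
          inner ℝ p₂ (halfSumDiff d z).2 : ℝ) : ℂ)) =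
        Complex.exp (-((a / 2 : ℝ) : ℂ) * ‖z.1‖ ^ 2 + Complex.I * (inner ℝ (p₁ + p₂) z.1 : ℝ)) *
        Complex.exp (-((b / 2 : ℝ) : ℂ) * ‖z.2‖ ^ 2 + Complex.I * (inner ℝ (p₁ - p₂) z.2 : ℝ)) := by
      intro z
      have e1 : (1 / 2 : ℝ) • (z.1 + z.2) + (1 / 2 : ℝ) • (z.1 - z.2) = z.1 := by module
      have e2 : (1 / 2 : ℝ) • (z.1 + z.2) - (1 / 2 : ℝ) • (z.1 - z.2) = z.2 := by module
      rw [← Real.exp_nat_mul, Complex.ofReal_exp, ← Complex.exp_add, ← Complex.exp_add,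
        halfSumDiff_apply, pairForm, e1, e2]
      simp only [inner_smul_right, inner_add_right, inner_sub_right, inner_add_left,
        inner_sub_left]
      push_cast
      congr 1
      ring
    rw [hC]
    simp only [e]
    rw [Measure.volume_eq_prod, integral_prod_mul
      (fun x : Space d => Complex.exp (-((a / 2 : ℝ) : ℂ) * ‖x‖ ^ 2 +
        Complex.I * (inner ℝ (p₁ + p₂) x : ℝ)))
      (fun x : Space d => Complex.exp (-((b / 2 : ℝ) : ℂ) * ‖x‖ ^ 2 +
        Complex.I * (inner ℝ (p₁ - p₂) x : ℝ))),
      GaussianFourier.integral_cexp_neg_mul_sq_norm_add (by simpa using ha),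
      GaussianFourier.integral_cexp_neg_mul_sq_norm_add (by simpa using hb),
      mul_mul_mul_comm, ← Complex.exp_add, ← mul_assoc C, Complex.ofReal_exp]
    congr 2
    push_cast
    rw [Complex.I_sq]
    have ha' : (a : ℂ) ≠ 0 := by exact_mod_cast ha.ne'
    have hb' : (b : ℂ) ≠ 0 := by exact_mod_cast hb.ne'
    field_simp
    ring
  -- Zero momentum identifies the unknown prefactor with the squared norm of the Gaussian.
  have h0 : ((pairNormSq d a b : ℝ) : ℂ) = C *
      ((Real.pi / ((a / 2 : ℝ) : ℂ)) ^ (Module.finrank ℝ (Space d) / 2 : ℂ) *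
        (Real.pi / ((b / 2 : ℝ) : ℂ)) ^ (Module.finrank ℝ (Space d) / 2 : ℂ)) := by
    have := key 0 0
    simp only [inner_zero_left, add_zero, Complex.ofReal_zero, mul_zero, Complex.exp_zero,
      mul_one, norm_zero, sub_zero, ne_eq, OfNat.ofNat_ne_zero, not_false_eq_true, zero_pow,
      zero_div, neg_zero, Real.exp_zero, Complex.ofReal_one] at this
    rw [← this, pairNormSq]
    exact integral_ofReal.symm
  rw [key, Complex.ofReal_mul, h0]

/-- The parallelogram law separates q from z in the Wigner integrand and leaves a Gaussian Fourier
transform in z. -/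
lemma pairForm_sub_add (a b : ℝ) (x z : Space d × Space d) :
    pairForm a b (x - z) + pairForm a b (x + z) = 2 * pairForm a b x + 2 * pairForm a b z := by
  have h1 := parallelogram_law_with_norm ℝ (x.1 + x.2) (z.1 + z.2)
  have h2 := parallelogram_law_with_norm ℝ (x.1 - x.2) (z.1 - z.2)
  have e1 : (x - z).1 + (x - z).2 = x.1 + x.2 - (z.1 + z.2) := by
    rw [Prod.fst_sub, Prod.snd_sub]; abel
  have e2 : (x - z).1 - (x - z).2 = x.1 - x.2 - (z.1 - z.2) := by
    rw [Prod.fst_sub, Prod.snd_sub]; abel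
  have e3 : (x + z).1 + (x + z).2 = x.1 + x.2 + (z.1 + z.2) := by
    rw [Prod.fst_add, Prod.snd_add]; abel
  have e4 : (x + z).1 - (x + z).2 = x.1 - x.2 + (z.1 - z.2) := by
    rw [Prod.fst_add, Prod.snd_add]; abel
  unfold pairForm
  rw [e1, e2, e3, e4]
  linear_combination a / 4 * h1 + b / 4 * h2

/-- The Fourier transform carries the squared norm of the Gaussian, which cancels ‖c‖²; the phase of
c drops out. -/
theorem wigner_singletWave {ω k : ℝ} (hω : 0 < ω) (hk : k < ω ^ 2) {c : ℂ}
    (hc : ‖c‖ ^ 2 * pairNormSq d ω (relFreq ω k) = 1) (u₁ u₂ : Phase d)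
    (σ₁ σ₂ σ₁' σ₂' : Spin) :
    wigner (singletWave hω (relFreq_pos hk) c) u₁ u₂ σ₁ σ₂ σ₁' σ₂' =
      ((singlet σ₁ σ₂ * singlet σ₁' σ₂' * (1 / Real.pi ^ (2 * d) *
        Real.exp (-(2 * extraculeH ω u₁ u₂ / ω)) *
        Real.exp (-(2 * intraculeH ω k u₁ u₂ / relFreq ω k))) : ℝ) : ℂ) := by
  have hμ := relFreq_pos hk
  have e : ∀ z : Space d × Space d,
      singletWave hω hμ c σ₁ σ₂ (u₁.1 - z.1, u₂.1 - z.2) *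
        conj (singletWave hω hμ c σ₁' σ₂' (u₁.1 + z.1, u₂.1 + z.2)) *
        Complex.exp (2 * Complex.I * ((inner ℝ u₁.2 z.1 + inner ℝ u₂.2 z.2 : ℝ) : ℂ)) =
      ((‖c‖ ^ 2 * (singlet σ₁ σ₂ * singlet σ₁' σ₂') *
        Real.exp (-2 * pairForm ω (relFreq ω k) (u₁.1, u₂.1)) : ℝ) : ℂ) *
      (((Real.exp (-pairForm ω (relFreq ω k) z) ^ 2 : ℝ) : ℂ) *
        Complex.exp (2 * Complex.I * ((inner ℝ u₁.2 z.1 + inner ℝ u₂.2 z.2 : ℝ) : ℂ))) := by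
    intro z
    have h1 : Real.exp (-pairForm ω (relFreq ω k) (u₁.1 - z.1, u₂.1 - z.2)) *
        Real.exp (-pairForm ω (relFreq ω k) (u₁.1 + z.1, u₂.1 + z.2)) =
        Real.exp (-2 * pairForm ω (relFreq ω k) (u₁.1, u₂.1)) *
          Real.exp (-pairForm ω (relFreq ω k) z) ^ 2 := by
      have := pairForm_sub_add ω (relFreq ω k) (u₁.1, u₂.1) z
      rw [← Real.exp_nat_mul, ← Real.exp_add, ← Real.exp_add]
      congr 1
      push_cast
      linear_combination -this
    rw [singletWave_apply, singletWave_apply]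
    simp only [map_mul, Complex.conj_ofReal]
    have h2 := congrArg (fun t : ℝ => (t : ℂ)) h1
    simp only [Complex.ofReal_mul] at h2 ⊢
    rw [Complex.ofReal_pow ‖c‖, ← Complex.mul_conj']
    linear_combination (c * conj c * singlet σ₁ σ₂ * singlet σ₁' σ₂' *
      Complex.exp (2 * Complex.I * ((inner ℝ u₁.2 z.1 + inner ℝ u₂.2 z.2 : ℝ) : ℂ))) * h2
  have h3 : Real.exp (-2 * pairForm ω (relFreq ω k) (u₁.1, u₂.1)) *
      Real.exp (-(‖u₁.2 + u₂.2‖ ^ 2 / (2 * ω)) - ‖u₁.2 - u₂.2‖ ^ 2 / (2 * relFreq ω k)) =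
      Real.exp (-(2 * extraculeH ω u₁ u₂ / ω)) *
        Real.exp (-(2 * intraculeH ω k u₁ u₂ / relFreq ω k)) := by
    rw [← Real.exp_add, ← Real.exp_add]
    congr 1
    rw [pairForm, extraculeH, intraculeH, ← relFreq_sq hk, norm_smul, norm_smul, mul_pow, mul_pow]
    have hω' := hω.ne'
    have hμ' := hμ.ne'
    norm_num
    field_simp
    ring
  unfold wigner
  simp only [e]
  rw [integral_const_mul, integral_pairGaussian_mul_exp hω hμ, ← Complex.ofReal_mul,
    ← Complex.ofReal_mul]
  congr 1
  linear_combination (1 / Real.pi ^ (2 * d) * (singlet σ₁ σ₂ * singlet σ₁' σ₂')) * h3 +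
    (1 / Real.pi ^ (2 * d) * (singlet σ₁ σ₂ * singlet σ₁' σ₂')) *
    (Real.exp (-2 * pairForm ω (relFreq ω k) (u₁.1, u₂.1)) *
      Real.exp (-(‖u₁.2 + u₂.2‖ ^ 2 / (2 * ω)) - ‖u₁.2 - u₂.2‖ ^ 2 / (2 * relFreq ω k))) * hc

end wignerFunction

/-! ### Reduction to the one-body quasidensity -/

section oneBodyReduction

variable {d : ℕ}

/-- Completing the square in v leaves the coefficient 4ab/(a+b): 2ωμ/(ω+μ) for positions, and
2/(ω+μ) for momenta, where a and b are 1/(2ω) and 1/(2μ). -/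
lemma integral_exp_norm_sq_add_norm_sq_sub {a b : ℝ} (ha : 0 < a) (hb : 0 < b) (q : Space d) :
    ∫ v : Space d, ((Real.exp (-(a * ‖q + v‖ ^ 2 + b * ‖q - v‖ ^ 2)) : ℝ) : ℂ) =
      (((Real.pi / (a + b)) ^ (d / 2 : ℝ) * Real.exp (-(4 * a * b / (a + b) * ‖q‖ ^ 2)) : ℝ) :
        ℂ) := by
  have hab : 0 < a + b := add_pos ha hb
  have e : ∀ v : Space d, ((Real.exp (-(a * ‖q + v‖ ^ 2 + b * ‖q - v‖ ^ 2)) : ℝ) : ℂ) =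
      Complex.exp (-((a + b : ℝ) : ℂ) * ‖v‖ ^ 2 + ((-2 * (a - b) : ℝ) : ℂ) * (inner ℝ q v : ℝ)) *
        ((Real.exp (-((a + b) * ‖q‖ ^ 2)) : ℝ) : ℂ) := by
    intro v
    rw [norm_add_sq_real, norm_sub_sq_real, Complex.ofReal_exp, Complex.ofReal_exp,
      ← Complex.exp_add]
    congr 1
    push_cast
    ring
  simp only [e]
  rw [integral_mul_const, GaussianFourier.integral_cexp_neg_mul_sq_norm_add (by simpa using hab),
    Complex.ofReal_mul ((Real.pi / (a + b)) ^ (d / 2 : ℝ)), Complex.ofReal_cpow (by positivity),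
    mul_assoc, Complex.ofReal_exp,
    ← Complex.exp_add, Complex.ofReal_exp]
  congr 1
  · simp
  · congr 1
    have : (a : ℂ) + b ≠ 0 := by exact_mod_cast hab.ne'
    push_cast
    field_simp
    ring

/-- The position and momentum prefactors have exponent d/2 each, but their bases multiply to the
square of πλ. -/
lemma rpow_mul_rpow_eq_lam {ω k : ℝ} (hω : 0 < ω) (hk : k < ω ^ 2) :
    (Real.pi / (ω / 2 + relFreq ω k / 2)) ^ (d / 2 : ℝ) *
      (Real.pi / (1 / (2 * ω) + 1 / (2 * relFreq ω k))) ^ (d / 2 : ℝ) =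
      (Real.pi * lam ω k) ^ d := by
  have hμ := relFreq_pos hk
  have hl := lam_pos hω hk
  have h : Real.pi / (ω / 2 + relFreq ω k / 2) *
      (Real.pi / (1 / (2 * ω) + 1 / (2 * relFreq ω k))) = (Real.pi * lam ω k) ^ 2 := by
    rw [mul_pow, lam, div_pow, mul_pow, Real.sq_sqrt (by positivity)]
    field_simp
    ring
  rw [← Real.mul_rpow (by positivity) (by positivity), h, ← Real.rpow_natCast,
    ← Real.rpow_mul (by positivity), ← Real.rpow_natCast]
  congr 1
  push_cast
  ring

lemma integral_wignerGaussian {ω k : ℝ} (hω : 0 < ω) (hk : k < ω ^ 2) (u : Phase d) :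
    ∫ v : Phase d, ((1 / Real.pi ^ (2 * d) * Real.exp (-(2 * extraculeH ω u v / ω)) *
      Real.exp (-(2 * intraculeH ω k u v / relFreq ω k)) : ℝ) : ℂ) =
    (((lam ω k / Real.pi) ^ d * Real.exp (-(2 * (ω * relFreq ω k * ‖u.1‖ ^ 2 + ‖u.2‖ ^ 2) /
      (ω + relFreq ω k))) : ℝ) : ℂ) := by
  have hμ := relFreq_pos hk
  have e : ∀ v : Phase d, ((1 / Real.pi ^ (2 * d) * Real.exp (-(2 * extraculeH ω u v / ω)) *
      Real.exp (-(2 * intraculeH ω k u v / relFreq ω k)) : ℝ) : ℂ) =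
      ((1 / Real.pi ^ (2 * d) : ℝ) : ℂ) *
      (((Real.exp (-(ω / 2 * ‖u.1 + v.1‖ ^ 2 + relFreq ω k / 2 * ‖u.1 - v.1‖ ^ 2)) : ℝ) : ℂ) *
      ((Real.exp (-(1 / (2 * ω) * ‖u.2 + v.2‖ ^ 2 + 1 / (2 * relFreq ω k) * ‖u.2 - v.2‖ ^ 2)) :
        ℝ) : ℂ)) := by
    intro v
    rw [← Complex.ofReal_mul, ← Complex.ofReal_mul, mul_assoc, ← Real.exp_add, ← Real.exp_add]
    congr 3
    rw [extraculeH, intraculeH, ← relFreq_sq hk, norm_smul, norm_smul, mul_pow, mul_pow]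
    norm_num
    field_simp
    ring
  simp only [e]
  rw [integral_const_mul, Measure.volume_eq_prod, integral_prod_mul
    (fun x : Space d => ((Real.exp (-(ω / 2 * ‖u.1 + x‖ ^ 2 +
      relFreq ω k / 2 * ‖u.1 - x‖ ^ 2)) : ℝ) : ℂ))
    (fun x : Space d => ((Real.exp (-(1 / (2 * ω) * ‖u.2 + x‖ ^ 2 +
      1 / (2 * relFreq ω k) * ‖u.2 - x‖ ^ 2)) : ℝ) : ℂ)),
    integral_exp_norm_sq_add_norm_sq_sub (by positivity) (by positivity),
    integral_exp_norm_sq_add_norm_sq_sub (by positivity) (by positivity),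
    ← Complex.ofReal_mul, ← Complex.ofReal_mul, mul_mul_mul_comm, rpow_mul_rpow_eq_lam hω hk,
    ← Real.exp_add, ← mul_assoc]
  congr 3
  · rw [mul_pow, div_pow, mul_comm 2 d, pow_mul]
    field_simp
  · field_simp
    ring

theorem oneBody_wigner_singletWave {ω k : ℝ} (hω : 0 < ω) (hk : k < ω ^ 2) {c : ℂ}
    (hc : ‖c‖ ^ 2 * pairNormSq d ω (relFreq ω k) = 1) (u : Phase d) (σ σ' : Spin) :
    oneBody (wigner (singletWave hω (relFreq_pos hk) c)) u σ σ' =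
      if σ = σ' then (((lam ω k / Real.pi) ^ d *
        Real.exp (-(2 * (ω * relFreq ω k * ‖u.1‖ ^ 2 + ‖u.2‖ ^ 2) /
          (ω + relFreq ω k))) : ℝ) : ℂ) else 0 := by
  unfold oneBody
  simp only [wigner_singletWave hω hk hc, ← Complex.ofReal_sum, ← Finset.sum_mul,
    sum_singlet_mul_singlet]
  split_ifs with h
  · simp only [Complex.ofReal_mul (1 / 2)]
    rw [integral_const_mul, integral_wignerGaussian hω hk, ← mul_assoc]
    norm_num
  · simp

end oneBodyReduction

end Harmonium

end

/-! ### Assembly of the main theorem -/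

theorem mainTheorem6 (d : ℕ) (hd : 1 ≤ d) (ω k : ℝ) (hω : 0 < ω) (hk₀ : 0 ≤ k)
    (hk : k < ω ^ 2) :
    (∃ Ψ : Harmonium.SpinorWave d, Harmonium.IsGroundState ω k Ψ) ∧
    (∀ Ψ : Harmonium.SpinorWave d, Harmonium.IsGroundState ω k Ψ →
      -- the two-body Wigner function in closed form
      (∀ (u₁ u₂ : Harmonium.Phase d) (σ₁ σ₂ σ₁' σ₂' : Harmonium.Spin),
        Harmonium.wigner Ψ u₁ u₂ σ₁ σ₂ σ₁' σ₂' =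
          ((Harmonium.singlet σ₁ σ₂ * Harmonium.singlet σ₁' σ₂' *
            (1 / Real.pi ^ (2 * d) *
              Real.exp (-(2 * Harmonium.extraculeH ω u₁ u₂ / ω)) *
              Real.exp (-(2 * Harmonium.intraculeH ω k u₁ u₂ / Harmonium.relFreq ω k))) : ℝ) :
                ℂ)) ∧
      -- the one-body quasidensity: closed form, and expansion as a thermal state
      (∀ (u : Harmonium.Phase d) (σ σ' : Harmonium.Spin), σ ≠ σ' →
        Harmonium.oneBody (Harmonium.wigner Ψ) u σ σ' = 0) ∧
      (∀ (u : Harmonium.Phase d) (σ : Harmonium.Spin),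
        Harmonium.oneBody (Harmonium.wigner Ψ) u σ σ =
          (((Harmonium.lam ω k / Real.pi) ^ d *
            Real.exp (-(2 * (ω * Harmonium.relFreq ω k * ‖u.1‖ ^ 2 + ‖u.2‖ ^ 2) /
              (ω + Harmonium.relFreq ω k))) : ℝ) : ℂ)) ∧
      (∀ (u : Harmonium.Phase d) (σ : Harmonium.Spin),
        HasSum (fun r : Fin d → ℕ =>
            (Harmonium.occupation ω k r : ℂ) * Harmonium.transition ω k r r u)
          (Harmonium.oneBody (Harmonium.wigner Ψ) u σ σ)) ∧
      -- the Laguerre functions are its natural eigentransitions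
      (∀ σ : Harmonium.Spin, Harmonium.IsNaturalSystem
        (fun u => Harmonium.oneBody (Harmonium.wigner Ψ) u σ σ)
        (Harmonium.occupation ω k : (Fin d → ℕ) → ℝ) (Harmonium.transition ω k)) ∧
      -- the series with alternating signs sums to the two-body Wigner function
      (∀ (u₁ u₂ : Harmonium.Phase d) (σ₁ σ₂ σ₁' σ₂' : Harmonium.Spin),
        HasSum (fun x : (Fin d → ℕ) × (Fin d → ℕ) =>
            ((Harmonium.singlet σ₁ σ₂ * Harmonium.singlet σ₁' σ₂' : ℝ) : ℂ) *
              Harmonium.slkTerm (Harmonium.alternatingCoeff ω k) (Harmonium.transition ω k)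
                u₁ u₂ x)
          (Harmonium.wigner Ψ u₁ u₂ σ₁ σ₂ σ₁' σ₂'))) ∧
    -- the Laguerre functions are the eigentransitions of the harmonic oscillator
    (∀ (r s : ℕ) (Q P : ℝ),
      Harmonium.oscHamiltonianTwisted (Harmonium.osc r s) Q P =
        ((r : ℂ) + 1 / 2) * Harmonium.osc r s Q P) ∧
    -- the occupation numbers
    HasSum (fun r : Fin d → ℕ => Harmonium.occupation ω k r) 1 ∧
    (k = 0 → ∀ r : Fin d → ℕ, Harmonium.occupation ω k r = if r = 0 then 1 else 0) ∧
    (0 < k → ∃ β : ℝ, 0 < β ∧ Real.tanh (β / 2) = Harmonium.lam ω k ∧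
      ∀ r : Fin d → ℕ,
        Harmonium.occupation ω k r =
          ∏ i, (1 - Real.exp (-β)) * Real.exp (-((r i : ℝ) * β)) ∧
        Harmonium.occupation ω k r =
          (2 * Real.sinh (β / 2)) ^ d * Real.exp (-(β * ∑ i, ((r i : ℝ) + 1 / 2))) ∧
        Harmonium.occupation ω k r =
          ∏ i, 4 * √(ω * Harmonium.relFreq ω k) / (ω - Harmonium.relFreq ω k) *
            ((√ω - √(Harmonium.relFreq ω k)) / (√ω + √(Harmonium.relFreq ω k))) ^
              (2 * r i + 1)) := by
  have hx0 := Harmonium.boltzmann_nonneg hω hk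
  have hx1 := Harmonium.boltzmann_lt_one hω hk
  have hl := Harmonium.lam_pos hω hk
  have hl1 := Harmonium.lam_le_one hω hk
  have hκ := (Harmonium.axisScale_pos hω hk).ne'
  refine ⟨?_, fun Ψ hΨ => ?_, Harmonium.oscHamiltonianTwisted_osc,
    Harmonium.hasSum_occupation hω hk, ?_,
    fun hk' => Harmonium.exists_inverse_temperature hω hk' hk⟩
  · obtain ⟨c, hc⟩ := Harmonium.exists_isGroundState d hω hk
    exact ⟨_, hc⟩
  -- By uniqueness the claims need checking only for the explicit singlet, with c known through its
  -- modulus alone.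
  · obtain ⟨c, hc, rfl⟩ := hΨ.eq_singletWave hω hk
    have hdiag : ∀ (u : Harmonium.Phase d) (σ : Harmonium.Spin), Harmonium.oneBody
        (Harmonium.wigner (Harmonium.singletWave hω (Harmonium.relFreq_pos hk) c)) u σ σ =
        Harmonium.thermalPhase (Harmonium.lam ω k) (Harmonium.scaleEquiv d _ hκ u) := by
      intro u σ
      rw [Harmonium.oneBody_wigner_singletWave hω hk hc, if_pos rfl,
        Harmonium.thermalPhase_eq hω hk]
    refine ⟨Harmonium.wigner_singletWave hω hk hc, fun u σ σ' h => ?_, fun u σ => ?_,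
      fun u σ => ?_, fun σ => ?_, fun u v σ₁ σ₂ σ₁' σ₂' => ?_⟩
    · rw [Harmonium.oneBody_wigner_singletWave hω hk hc, if_neg h]
    · rw [Harmonium.oneBody_wigner_singletWave hω hk hc, if_pos rfl]
    · refine Harmonium.hasSum_of_eq (Harmonium.hasSum_thermalPhase (Harmonium.lam ω k)
        (Harmonium.boltzmann ω k) hl hl1 rfl (Harmonium.scaleEquiv d _ hκ u))
        (fun r => ?_) (hdiag u σ)
      rw [Harmonium.transition_eq hω hk, Harmonium.occupation]
    · have hχ : Harmonium.transition (d := d) ω k =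
          fun r s u => Harmonium.oscPhase r s (Harmonium.scaleEquiv d _ hκ u) :=
        funext fun r => funext fun s => funext fun u => Harmonium.transition_eq hω hk r s u
      rw [hχ, funext fun u => hdiag u σ]
      exact Harmonium.isNaturalSystem_scaled hκ _ _ hl rfl
    · have h := (Harmonium.hasSum_slkPhase (Harmonium.boltzmann ω k) hx0 hx1
        (Harmonium.scaleEquiv d _ hκ u) (Harmonium.scaleEquiv d _ hκ v)).mul_left
        ((Harmonium.singlet σ₁ σ₂ * Harmonium.singlet σ₁' σ₂' : ℝ) : ℂ)
      refine Harmonium.hasSum_of_eq h (fun p => ?_) ?_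
      · simp only [Harmonium.slkTerm, Harmonium.transition_eq hω hk, Harmonium.alternatingCoeff,
          Harmonium.occupation]
      · rw [Harmonium.wigner_singletWave hω hk hc, Complex.ofReal_mul,
          Harmonium.wignerGaussian_eq hω hk₀ hk]
        rfl
  · rintro rfl r
    exact Harmonium.occupation_of_eq_zero hω r
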